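/- Let $(\mathbb{X},\mathcal{F},\mu)$ be a probability space. A connection function is a measurable symmetric function $\phi:\mathbb{X}\times\mathbb{X}\to[0,1]$; write $\overline\phi=\sup_{x,y}\phi(x,y)$, and for $\varepsilon>0$ call $\phi$ $\varepsilon$-homogeneous if $$\inf_{x\in\mathbb{X}}\int\phi(x,y)\,\mu(dy)\ \ge\ \varepsilon\,\sup_{x\in\mathbb{X}}\int\phi(x,y)\,\mu(dy).$$ For $n\in\mathbb{N}$ let $\mathcal{X}_n$ consist of $n$ independent random points of $\mathbb{X}$ with common law $\mu$, and for $s>0$ let $\mathcal{P}_s$ be a Poisson point process on $\mathbb{X}$ with mean measure $s\mu$, i.e. a Poisson$(s)$-distributed number of independent $\mu$-distributed points (points are counted with multiplicity). For a finite collection of points $\mathcal{V}$ let $G(\mathcal{V},\phi)$ be the random graph with vertex set $\mathcal{V}$ in which, given $\mathcal V$, each pair $x,y$ of distinct vertices is joined by an edge with probability $\phi(x,y)$, independently of all other pairs. For a finite graph $G$ let $D_i(G)$ be the number of vertices of degree $i$, and set $D_{\le j}(G)=\sum_{i=0}^{j}D_i(G)$, $D_{\le -1}(G)=0$. Theorem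 2.1. Let $j\in\{0,1,2,\dots\}$ and $\varepsilon>0$, and for each $s>0$ let $\phi_s$ be an $\varepsilon$-homogeneous connection function with $\overline\phi_s\le 1-\varepsilon$. If $\mathbb{E}\,D_{\le j}(G(\mathcal{P}_s,\phi_s))\to\alpha\in(0,\infty)$ as $s\to\infty$, then as $s\to\infty$ $$D_j(G(\mathcal{P}_s,\phi_s))\to Z_\alpha\quad\text{and}\quad D_j(G(\mathcal{X}_{\lfloor s\rfloor},\phi_{\lfloor s\rfloor}))\to Z_\alpha\quad\text{in distribution},$$ where $Z_\alpha$ is Poisson distributed with parameter $\alpha$, and $$D_{\le j-1}(G(\mathcal{P}_s,\phi_s))\to 0\quad\text{and}\quad D_{\le j-1}(G(\mathcal{X}_{\lfloor s\rfloor},\phi_{\lfloor s\rfloor}))\to 0\quad\text{in probability}.$$ -/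

import Mathlib

open MeasureTheory ProbabilityTheory Filter Topology
open scoped NNReal unitInterval

/-- A connection function on `𝕏`: a measurable symmetric function `𝕏 × 𝕏 → [0,1]`. -/
structure ConnectionFunction (𝕏 : Type*) [MeasurableSpace 𝕏] where
  toFun : 𝕏 → 𝕏 → ℝ
  measurable' : Measurable (Function.uncurry toFun)
  symm' : ∀ x y, toFun x y = toFun y x
  mem_Icc' : ∀ x y, toFun x y ∈ Set.Icc (0 : ℝ) 1

namespace ConnectionFunction

variable {𝕏 : Type*} [MeasurableSpace 𝕏]

/-- `ε`-homogeneity: `inf_x ∫ φ(x,y) μ(dy) ≥ ε * sup_x ∫ φ(x,y) μ(dy)`.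
For a probability measure `μ` these integrals lie in `[0,1]` and `𝕏` is non-empty,
so the infimum and the supremum are genuine ones. -/
def IsHomogeneous (φ : ConnectionFunction 𝕏) (μ : Measure 𝕏) (ε : ℝ) : Prop :=
  ε * (⨆ x, ∫ y, φ.toFun x y ∂μ) ≤ ⨅ x, ∫ y, φ.toFun x y ∂μ

/-- The supremum of a connection function over all pairs of points. -/
noncomputable def sup (φ : ConnectionFunction 𝕏) : ℝ :=
  ⨆ p : 𝕏 × 𝕏, φ.toFun p.1 p.2

end ConnectionFunction

/-- The law of a mark: a sequence of independent uniform random variables on the unit interval. -/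
noncomputable def markMeasure : Measure (ℕ → I) :=
  Measure.infinitePi fun _ : ℕ => (volume : Measure I)

instance : IsProbabilityMeasure markMeasure :=
  inferInstanceAs (IsProbabilityMeasure (Measure.infinitePi fun _ : ℕ => (volume : Measure I)))

/-- The random input of the model on a probability space `(Ω, P)`: the points `X i` with their
marks `T i` form an i.i.d. sequence with common law `μ ⊗ markMeasure`, and for each `s` the
variable `Z s` is Poisson with mean `s` and independent of that sequence. In particular
`X 0, …, X (n - 1)` is a binomial point process and `X 0, …, X (Z s - 1)` is a Poisson process
with mean measure `s • μ`. -/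
structure IsMarkedSample {𝕏 Ω : Type*} [MeasurableSpace 𝕏] [MeasurableSpace Ω]
    (μ : Measure 𝕏) (P : Measure Ω) (X : ℕ → Ω → 𝕏) (T : ℕ → Ω → ℕ → I)
    (Z : ℝ≥0 → Ω → ℕ) : Prop where
  measurable_point : ∀ i, Measurable (X i)
  measurable_mark : ∀ i, Measurable (T i)
  measurable_count : ∀ s, Measurable (Z s)
  law_point : ∀ i, HasLaw (fun ω => (X i ω, T i ω)) (μ.prod markMeasure) P
  indep_point : iIndepFun (fun i ω => (X i ω, T i ω)) P
  law_count : ∀ s, HasLaw (Z s) (poissonMeasure s) P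
  indep_count : ∀ s, IndepFun (Z s) (fun ω i => (X i ω, T i ω)) P

/-- Such a random input exists for every probability measure `μ`. -/
theorem exists_isMarkedSample {𝕏 : Type*} [MeasurableSpace 𝕏] (μ : Measure 𝕏)
    [IsProbabilityMeasure μ] :
    ∃ (P : Measure ((ℝ≥0 → ℕ) × (ℕ → 𝕏 × (ℕ → I)))), IsProbabilityMeasure P ∧
      IsMarkedSample μ P (fun i ω => (ω.2 i).1) (fun i ω => (ω.2 i).2) (fun s ω => ω.1 s) := by
  let A : Measure (ℝ≥0 → ℕ) := Measure.infinitePi fun s => poissonMeasure s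
  let B : Measure (ℕ → 𝕏 × (ℕ → I)) := Measure.infinitePi fun _ : ℕ => μ.prod markMeasure
  have hsnd : MeasurePreserving Prod.snd (A.prod B) B := measurePreserving_snd
  have hfst : MeasurePreserving Prod.fst (A.prod B) A := measurePreserving_fst
  have hB : ∀ i, MeasurePreserving (Function.eval i) B (μ.prod markMeasure) :=
    fun i => measurePreserving_eval_infinitePi _ i
  refine ⟨A.prod B, inferInstance, ⟨fun i => by fun_prop, fun i => by fun_prop,
    fun s => by fun_prop, fun i => ?_, ?_, fun s => ?_, fun s => ?_⟩⟩
  · exact ⟨by fun_prop, ((hB i).comp hsnd).map_eq⟩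
  · rw [iIndepFun_iff_map_fun_eq_infinitePi_map (fun i => by fun_prop)]
    have h1 : (A.prod B).map (fun ω i => ((ω.2 i).1, (ω.2 i).2)) = B := hsnd.map_eq
    rw [h1]
    have h2 : ∀ i : ℕ, (A.prod B).map (fun ω => ((ω.2 i).1, (ω.2 i).2)) = μ.prod markMeasure :=
      fun i => ((hB i).comp hsnd).map_eq
    simp_rw [h2]
    rfl
  · exact ⟨by fun_prop, ((measurePreserving_eval_infinitePi _ s).comp hfst).map_eq⟩
  · exact indepFun_prod (μ := A) (ν := B) (X := fun a => a s) (Y := fun b => b)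
      (measurable_pi_apply s) measurable_id

/-- The graph on the `n` points `x 0, …, x (n - 1)` in which, for `i < k`, the `i`-th and the
`k`-th point are joined iff `t i k ≤ φ (x i) (x k)`. The vertices are the indices, so repeated
points count as separate vertices. If the `t i k` are independent and uniform on `[0,1]`, then the
edges are present independently with probabilities `φ (x i) (x k)`. -/
def irg {𝕏 : Type*} [MeasurableSpace 𝕏] (φ : ConnectionFunction 𝕏) (n : ℕ) (x : ℕ → 𝕏)
    (t : ℕ → ℕ → I) : SimpleGraph (Fin n) :=
  SimpleGraph.fromRel fun i k => i < k ∧ (t i k : ℝ) ≤ φ.toFun (x i) (x k)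

open Classical in
/-- `D_j(G)`: the number of vertices of degree `j`. -/
noncomputable def numDeg {V : Type*} [Fintype V] (G : SimpleGraph V) (j : ℕ) : ℕ :=
  (Finset.univ.filter fun v => G.degree v = j).card

/-- `D_{≤ j}(G)`: the number of vertices of degree at most `j`. -/
noncomputable def numDegLE {V : Type*} [Fintype V] (G : SimpleGraph V) (j : ℕ) : ℕ :=
  ∑ i ∈ Finset.range (j + 1), numDeg G i

/-- `D_{≤ j - 1}(G)`: the number of vertices of degree less than `j` (zero for `j = 0`). -/
noncomputable def numDegLT {V : Type*} [Fintype V] (G : SimpleGraph V) (j : ℕ) : ℕ :=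
  ∑ i ∈ Finset.range j, numDeg G i

/-!
The proof is a Stein-Chen argument for a fixed number of points, carried over to the Poisson model
by mixing over the number of points.

Let `W` be the number of vertices of degree `j` among `n + 1` points and `p k` the probability of
`W = k`. Counting pairs of the event `W = k + 1` and a vertex of degree `j` in two ways shows that
`(k + 1) * p (k + 1)` is the sum over the vertices `v` of the probability that `v` has degree `j` and
exactly `k` other vertices have degree `j`. If the degree of `v` were independent of the rest of the
graph, this would be the expectation of `W` times the probability that the graph without `v` has `k`
vertices of degree `j`, and hence about `α * p k`. A sequence of probabilities which satisfies this
recursion in the limit converges to the Poisson weights (`tendsto_poisson_of_recursion`).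

The independence holds up to a small error, thanks to a coupling. Condition on the location `x` of
`v`, and give every other point together with the mark of its edge to `v` a second, independent copy.
Replace each point one of whose two copies is linked to `x` by its second copy. The resulting hybrid
points form a fresh sample independent of the degree of `v` (`coupledLaw_hybrid`). The replacement
changes the number of vertices of degree `j` only if a vertex that has few neighbours is replaced,
or is joined to a replaced one (`exists_of_numFull_ne_numRest`). For this to happen while `v` has
degree `j`, two vertices must have small degree at once. The connection probabilities are at most
`1 - ε`, so that a point which is not linked to `x` still has a chance to be linked to any given
second location, however close to `x` (`le_measureReal_linked_or`); with homogeneity, the probability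
that both vertices have small degree is smaller than that for `v` alone by a factor
`exp (-c * b)`, up to constants, where `b` is the maximal expected degree and `c > 0` depends only on
`ε`. As `b` tends to infinity (`tendsto_maxDegree_atTop`), this outweighs the number of vertices
within reach of `v`, which is of order `b ^ 2`; hence `abs_succ_mul_sub_le` and
`tendsto_measureReal_numDeg`.

For the expectations, conditionally on its location a vertex has binomial degree in the binomial
model and Poisson degree in the Poisson model. As the expected degrees tend to infinity and are
comparable with each other, degrees less than `j` are negligible compared with degree `j`
(`tendsto_poissonMean_zero_of_lt`), so that the assumption on vertices of degree at most `j` is one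
on vertices of degree `j`. As `b` is at most of logarithmic order in `s` (`tendsto_rpow_mul_zero`),
the expectations in the binomial models with `n` points are asymptotically the same for all `n` with
`|n - s| ≤ s ^ (3 / 4)` (`tendsto_succ_mul_degProb`). Thus the limits hold uniformly for these `n`
(`tendsto_window`). This includes `n = s` for integer `s`, and by Chebyshev's inequality a Poisson
number of points of mean `s` falls into this window with probability tending to one
(`tendsto_tsum_poisson`).
-/

/-! ### Binomial tails under product measures -/

open Classical in
/-- Exponential Markov inequality for the number of coordinates of an i.i.d. family which fall into
a set of probability at least `c`, by way of the expectation of `θ` to the power of that number. -/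
lemma pi_card_le {ι R : Type*} [Fintype ι] [MeasurableSpace R] (ρ : Measure R)
    [IsProbabilityMeasure ρ] {B : Set R} (hB : MeasurableSet B) {c θ : ℝ} (hθ0 : 0 < θ)
    (hθ1 : θ ≤ 1) (hc : c ≤ ρ.real B) (m : ℕ) :
    Measure.pi (fun _ : ι => ρ) {r | (Finset.univ.filter fun i => r i ∈ B).card ≤ m} ≤
      ENNReal.ofReal ((θ ^ m)⁻¹ * Real.exp (-((1 - θ) * c * Fintype.card ι))) := by
  let g : R → ENNReal := fun r => if r ∈ B then ENNReal.ofReal θ else 1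
  have hg : Measurable g := Measurable.ite hB measurable_const measurable_const
  have hgint : ∫⁻ r, g r ∂ρ ≤ ENNReal.ofReal (Real.exp (-((1 - θ) * c))) := by
    have h1 : ∫⁻ r, g r ∂ρ = ENNReal.ofReal θ * ρ B + ρ Bᶜ := by
      rw [← lintegral_add_compl g hB, setLIntegral_congr_fun (g := fun _ => ENNReal.ofReal θ) hB,
        setLIntegral_congr_fun (g := fun _ => 1) hB.compl]
      · simp
      · intro r hr
        simp only [g, if_neg (by simpa using hr)]
      · intro r hr
        simp only [g, if_pos hr]
    rw [h1, ← ofReal_measureReal (μ := ρ) (s := B), ← ofReal_measureReal (μ := ρ) (s := Bᶜ),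
      ← ENNReal.ofReal_mul hθ0.le, ← ENNReal.ofReal_add (by positivity) (by positivity),
      probReal_compl_eq_one_sub hB]
    refine ENNReal.ofReal_le_ofReal ?_
    have := Real.add_one_le_exp (-((1 - θ) * c))
    nlinarith
  have hprod : ∫⁻ r : ι → R, ∏ i, g (r i) ∂(Measure.pi fun _ => ρ) = ∏ _i : ι, ∫⁻ r, g r ∂ρ := by
    have hi : iIndepFun (fun (i : ι) (r : ι → R) => g (r i)) (Measure.pi fun _ : ι => ρ) :=
      iIndepFun_pi (X := fun _ : ι => g) (fun _ => hg.aemeasurable)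
    rw [lintegral_prod_eq_prod_lintegral_of_indepFun _ _ hi
      (fun i => hg.comp (measurable_pi_apply i))]
    refine Finset.prod_congr rfl fun i _ => ?_
    exact (measurePreserving_eval (fun _ : ι => ρ) i).lintegral_comp hg
  have hval : ∀ r : ι → R, ∏ i, g (r i) =
      ENNReal.ofReal θ ^ (Finset.univ.filter fun i => r i ∈ B).card := by
    intro r
    simp [g, Finset.prod_ite]
  have hsub : {r : ι → R | (Finset.univ.filter fun i => r i ∈ B).card ≤ m} ⊆
      {r | ENNReal.ofReal θ ^ m ≤ ∏ i, g (r i)} := by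
    intro r hr
    simp only [Set.mem_ofPred_eq] at hr ⊢
    rw [hval]
    exact pow_le_pow_right_of_le_one' (by simpa using hθ1) hr
  have hmark := mul_meas_ge_le_lintegral (μ := Measure.pi fun _ : ι => ρ)
    (f := fun r => ∏ i, g (r i))
    (Finset.measurable_prod _ fun i _ => hg.comp (measurable_pi_apply i)) (ENNReal.ofReal θ ^ m)
  rw [hprod, Finset.prod_const, Finset.card_univ] at hmark
  have hθm : ENNReal.ofReal θ ^ m = ENNReal.ofReal (θ ^ m) := by
    rw [ENNReal.ofReal_pow hθ0.le]
  refine (measure_mono hsub).trans ?_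
  have h0 : ENNReal.ofReal (θ ^ m) ≠ 0 := by simpa using pow_pos hθ0 m
  rw [hθm] at hmark ⊢
  rw [ENNReal.ofReal_mul (by positivity), ENNReal.ofReal_inv_of_pos (pow_pos hθ0 m)]
  rw [← ENNReal.mul_le_iff_le_inv h0 ENNReal.ofReal_ne_top]
  refine hmark.trans ?_
  calc (∫⁻ r, g r ∂ρ) ^ Fintype.card ι
      ≤ ENNReal.ofReal (Real.exp (-((1 - θ) * c))) ^ Fintype.card ι := by gcongr
    _ = _ := by
      rw [← ENNReal.ofReal_pow (Real.exp_pos _).le, ← Real.exp_nat_mul]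
      congr 2
      ring

open Classical in
/-- The tail bound `pi_card_le` with a set which depends on the coordinates singled out by `p`,
jointly with an event in those coordinates. -/
lemma pi_inter_card_le {ι R : Type*} [Fintype ι] [MeasurableSpace R] (ρ : Measure R)
    [IsProbabilityMeasure ρ] (p : ι → Prop) {K : Set ({i // p i} → R)} (hK : MeasurableSet K)
    {B : ({i // p i} → R) → Set R} (hB : MeasurableSet {q : ({i // p i} → R) × R | q.2 ∈ B q.1})
    {c θ : ℝ} (hθ0 : 0 < θ) (hθ1 : θ ≤ 1) (hc : ∀ z, c ≤ ρ.real (B z)) (m : ℕ) :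
    Measure.pi (fun _ : ι => ρ) {r | (fun i : {i // p i} => r i) ∈ K ∧
        (Finset.univ.filter fun i => ¬ p i ∧ r i ∈ B fun i => r i).card ≤ m} ≤
      ENNReal.ofReal ((θ ^ m)⁻¹ * Real.exp (-((1 - θ) * c * Fintype.card {i // ¬ p i}))) *
        Measure.pi (fun _ : ι => ρ) {r | (fun i : {i // p i} => r i) ∈ K} := by
  have hmp := measurePreserving_piEquivPiSubtypeProd (fun _ : ι => ρ) p
  set M₁ := Measure.pi fun _ : {i // p i} => ρ
  set M₂ := Measure.pi fun _ : {i // ¬ p i} => ρ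
  have hcard : ∀ r : ι → R, (Finset.univ.filter fun i => ¬ p i ∧ r i ∈ B fun i => r i).card =
      (Finset.univ.filter fun i : {i // ¬ p i} => r i ∈ B fun i => r i).card := by
    intro r
    rw [← Finset.card_map (Function.Embedding.subtype fun i => ¬ p i)]
    congr 1
    ext i
    simp [and_comm]
  let A : Set (({i // p i} → R) × ({i // ¬ p i} → R)) :=
    {q | q.1 ∈ K ∧ (Finset.univ.filter fun i => q.2 i ∈ B q.1).card ≤ m}
  have hcm : Measurable fun q : ({i // p i} → R) × ({i // ¬ p i} → R) =>
      (Finset.univ.filter fun i => q.2 i ∈ B q.1).card := by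
    simp_rw [Finset.card_filter]
    refine Finset.measurable_sum _ fun i _ => Measurable.ite ?_ measurable_const measurable_const
    have : Measurable fun q : ({i // p i} → R) × ({i // ¬ p i} → R) => (q.1, q.2 i) := by fun_prop
    exact this hB
  have hA : MeasurableSet A :=
    (measurable_fst hK).inter (hcm (measurableSet_Iic (a := m)))
  have h1 : {r : ι → R | (fun i : {i // p i} => r i) ∈ K ∧
      (Finset.univ.filter fun i => ¬ p i ∧ r i ∈ B fun i => r i).card ≤ m} =
      MeasurableEquiv.piEquivPiSubtypeProd (fun _ : ι => R) p ⁻¹' A := by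
    ext r
    simp only [Set.mem_ofPred_eq, Set.mem_preimage, A, hcard]
    rfl
  have h2 : {r : ι → R | (fun i : {i // p i} => r i) ∈ K} =
      MeasurableEquiv.piEquivPiSubtypeProd (fun _ : ι => R) p ⁻¹' (Prod.fst ⁻¹' K) := rfl
  rw [h1, h2, hmp.measure_preimage hA.nullMeasurableSet,
    hmp.measure_preimage (measurable_fst hK).nullMeasurableSet, Measure.prod_apply hA,
    ← Set.prod_univ, Measure.prod_prod, measure_univ, mul_one]
  rw [← lintegral_indicator_const hK]
  refine lintegral_mono fun z => ?_
  by_cases hz : z ∈ K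
  · rw [Set.indicator_of_mem hz]
    have hBz : MeasurableSet (B z) := measurable_prodMk_left hB
    refine (measure_mono ?_).trans (pi_card_le ρ hBz hθ0 hθ1 (hc z) m)
    intro w hw
    exact hw.2
  · rw [Set.indicator_of_notMem hz]
    have : Prod.mk z ⁻¹' A = ∅ := by
      ext w
      simp [A, hz]
    simp [this]

open Classical in
/-- The number of successes in independent Bernoulli trials is binomial. -/
lemma pi_card_eq {ι R : Type*} [Fintype ι] [MeasurableSpace R] (ρ : Measure R)
    [IsProbabilityMeasure ρ] {B : Set R} (hB : MeasurableSet B) (i : ℕ) :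
    Measure.pi (fun _ : ι => ρ) {r | (Finset.univ.filter fun l => r l ∈ B).card = i} =
      ENNReal.ofReal ((Fintype.card ι).choose i * ρ.real B ^ i *
        (1 - ρ.real B) ^ (Fintype.card ι - i)) := by
  have hset : {r : ι → R | (Finset.univ.filter fun l => r l ∈ B).card = i} =
      ⋃ S ∈ Finset.powersetCard i (Finset.univ : Finset ι),
        Set.pi Set.univ fun l => if l ∈ S then B else Bᶜ := by
    ext r
    simp only [Set.mem_ofPred_eq, Set.mem_iUnion, Finset.mem_powersetCard, Finset.subset_univ,
      true_and, exists_prop, Set.mem_univ_pi]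
    constructor
    · intro h
      refine ⟨_, h, fun l => ?_⟩
      by_cases hl : r l ∈ B <;> simp [hl]
    · rintro ⟨S, hS, h⟩
      rw [← hS]
      congr 1
      ext l
      have := h l
      by_cases hl : l ∈ S <;> simp_all
  rw [hset, measure_biUnion_finset]
  · have : ∀ S ∈ Finset.powersetCard i (Finset.univ : Finset ι),
        Measure.pi (fun _ : ι => ρ) (Set.pi Set.univ fun l => if l ∈ S then B else Bᶜ) =
        ENNReal.ofReal (ρ.real B ^ i * (1 - ρ.real B) ^ (Fintype.card ι - i)) := by
      intro S hS
      have hS' : S.card = i := (Finset.mem_powersetCard.1 hS).2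
      rw [Measure.pi_pi]
      simp_rw [apply_ite ρ]
      rw [Finset.prod_ite, Finset.prod_const, Finset.prod_const]
      have h1 : (Finset.univ.filter fun l => l ∈ S).card = i := by simpa using hS'
      have h2 : (Finset.univ.filter fun l => l ∉ S).card = Fintype.card ι - i := by
        rw [← hS', ← Finset.card_compl]
        congr 1
        ext l
        simp
      rw [h1, h2, ← ofReal_measureReal (μ := ρ) (s := B), ← ofReal_measureReal (μ := ρ) (s := Bᶜ),
        probReal_compl_eq_one_sub hB, ← ENNReal.ofReal_pow measureReal_nonneg,
        ← ENNReal.ofReal_pow (sub_nonneg.2 measureReal_le_one),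
        ← ENNReal.ofReal_mul (by positivity)]
    rw [Finset.sum_congr rfl this, Finset.sum_const, Finset.card_powersetCard, Finset.card_univ,
      nsmul_eq_mul, mul_assoc, ENNReal.ofReal_mul (Nat.cast_nonneg _), ENNReal.ofReal_natCast]
  · intro S _ S' _ hne
    refine Set.disjoint_left.2 fun r h h' => hne ?_
    ext l
    have h1 := h l trivial
    have h2 := h' l trivial
    by_cases hl : l ∈ S <;> by_cases hl' : l ∈ S' <;> simp_all
  · intro S _
    exact MeasurableSet.univ_pi fun l => by split_ifs; exacts [hB, hB.compl]

/-! ### The graph as seen from one vertex -/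

section Model

variable {𝕏 : Type*} [MeasurableSpace 𝕏]

namespace ConnectionFunction

/-- A point `x` is linked to a point `a.1` with mark `a.2` if the mark does not exceed the
connection probability. -/
def Linked (φ : ConnectionFunction 𝕏) (x : 𝕏) (a : 𝕏 × I) : Prop :=
  (a.2 : ℝ) ≤ φ.toFun x a.1

/-- The probability `∫ φ(x, y) μ(dy)` that `x` is linked to a random point. -/
noncomputable def meanDeg (φ : ConnectionFunction 𝕏) (μ : Measure 𝕏) (x : 𝕏) : ℝ :=
  ∫ y, φ.toFun x y ∂μ

lemma nonneg (φ : ConnectionFunction 𝕏) (x y : 𝕏) : 0 ≤ φ.toFun x y := (φ.mem_Icc' x y).1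

lemma le_one (φ : ConnectionFunction 𝕏) (x y : 𝕏) : φ.toFun x y ≤ 1 := (φ.mem_Icc' x y).2

lemma measurable_right (φ : ConnectionFunction 𝕏) (x : 𝕏) : Measurable (φ.toFun x) :=
  φ.measurable'.comp measurable_prodMk_left

lemma measurable_comp {β : Type*} [MeasurableSpace β] (φ : ConnectionFunction 𝕏) {f g : β → 𝕏}
    (hf : Measurable f) (hg : Measurable g) : Measurable fun b => φ.toFun (f b) (g b) :=
  φ.measurable'.comp (hf.prodMk hg)

lemma measurableSet_linked {β : Type*} [MeasurableSpace β] (φ : ConnectionFunction 𝕏)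
    {f : β → 𝕏} {g : β → 𝕏 × I} (hf : Measurable f) (hg : Measurable g) :
    MeasurableSet {b | φ.Linked (f b) (g b)} :=
  measurableSet_le (measurable_subtype_coe.comp (measurable_snd.comp hg))
    (φ.measurable_comp hf (measurable_fst.comp hg))

lemma volume_mark_le {c : ℝ} (h : c ∈ Set.Icc (0 : ℝ) 1) :
    (volume : Measure I) {w | (w : ℝ) ≤ c} = ENNReal.ofReal c := by
  have : {w : I | (w : ℝ) ≤ c} = Set.Iic (⟨c, h⟩ : I) := rfl
  rw [this, unitInterval.volume_Iic]

lemma integrable (φ : ConnectionFunction 𝕏) (μ : Measure 𝕏) [IsProbabilityMeasure μ] (x : 𝕏) :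
    Integrable (φ.toFun x) μ :=
  Integrable.of_bound (φ.measurable_right x).aestronglyMeasurable 1 (ae_of_all _ fun y => by
    rw [Real.norm_eq_abs, abs_of_nonneg (φ.nonneg x y)]; exact φ.le_one x y)

lemma lintegral_eq (φ : ConnectionFunction 𝕏) (μ : Measure 𝕏) [IsProbabilityMeasure μ] (x : 𝕏) :
    ∫⁻ y, ENNReal.ofReal (φ.toFun x y) ∂μ = ENNReal.ofReal (φ.meanDeg μ x) :=
  (ofReal_integral_eq_lintegral_ofReal (φ.integrable μ x) (ae_of_all _ (φ.nonneg x))).symm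

lemma meanDeg_nonneg (φ : ConnectionFunction 𝕏) (μ : Measure 𝕏) (x : 𝕏) : 0 ≤ φ.meanDeg μ x :=
  integral_nonneg (φ.nonneg x)

lemma meanDeg_le_one (φ : ConnectionFunction 𝕏) (μ : Measure 𝕏) [IsProbabilityMeasure μ] (x : 𝕏) :
    φ.meanDeg μ x ≤ 1 := by
  have := integral_mono (φ.integrable μ x) (integrable_const 1) (φ.le_one x)
  simpa [meanDeg] using this

lemma measurable_meanDeg (φ : ConnectionFunction 𝕏) (μ : Measure 𝕏) [IsProbabilityMeasure μ] :
    Measurable (φ.meanDeg μ) :=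
  (φ.measurable'.stronglyMeasurable.integral_prod_right' (ν := μ)).measurable

lemma measure_linked (φ : ConnectionFunction 𝕏) (μ : Measure 𝕏) [IsProbabilityMeasure μ] (x : 𝕏) :
    (μ.prod (volume : Measure I)) {a | φ.Linked x a} = ENNReal.ofReal (φ.meanDeg μ x) := by
  rw [Measure.prod_apply (φ.measurableSet_linked (g := fun a => a) measurable_const
    measurable_id), ← lintegral_eq]
  exact lintegral_congr fun y => volume_mark_le (φ.mem_Icc' x y)

lemma measureReal_linked (φ : ConnectionFunction 𝕏) (μ : Measure 𝕏) [IsProbabilityMeasure μ]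
    (x : 𝕏) : (μ.prod (volume : Measure I)).real {a | φ.Linked x a} = φ.meanDeg μ x := by
  rw [measureReal_def, measure_linked, ENNReal.toReal_ofReal (φ.meanDeg_nonneg μ x)]

end ConnectionFunction

variable {O : Type*} [Fintype O]

open Classical in
/-- The number of points of the marked family `a` which are linked to `x`. -/
noncomputable def starDeg (φ : ConnectionFunction 𝕏) (x : 𝕏) (a : O → 𝕏 × I) : ℕ :=
  (Finset.univ.filter fun l => φ.Linked x (a l)).card

open Classical in
/-- The degree of `u` in the graph on the points `(a l).1` whose edge marks are given by `t`. -/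
noncomputable def restDeg (φ : ConnectionFunction 𝕏) (a : O → 𝕏 × I) (t : Sym2 O → I) (u : O) : ℕ :=
  (Finset.univ.filter fun l => l ≠ u ∧ φ.Linked (a u).1 ((a l).1, t s(u, l))).card

open Classical in
/-- The number of vertices of degree `j` in the graph on the points `(a l).1`. -/
noncomputable def numRest (φ : ConnectionFunction 𝕏) (j : ℕ) (a : O → 𝕏 × I) (t : Sym2 O → I) : ℕ :=
  (Finset.univ.filter fun u => restDeg φ a t u = j).card

open Classical in
/-- The number of vertices other than `x` of degree `j` in the graph obtained by adding `x` to the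
points `(a l).1`; the edge between `x` and `(a l).1` is decided by the mark `(a l).2`. -/
noncomputable def numFull (φ : ConnectionFunction 𝕏) (j : ℕ) (x : 𝕏) (a : O → 𝕏 × I)
    (t : Sym2 O → I) : ℕ :=
  (Finset.univ.filter fun u => restDeg φ a t u + (if φ.Linked x (a u) then 1 else 0) = j).card

/-- The law of the marked points and of the edge marks that make up the rest of the graph, as seen
from one vertex. The edge marks are indexed by all unordered pairs; those on the diagonal are never
used. -/
noncomputable def restLaw (μ : Measure 𝕏) (O : Type*) [Fintype O] :
    Measure ((O → 𝕏 × I) × (Sym2 O → I)) :=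
  (Measure.pi fun _ => μ.prod volume).prod (Measure.pi fun _ => volume)

instance (μ : Measure 𝕏) [IsProbabilityMeasure μ] : IsProbabilityMeasure (restLaw μ O) := by
  unfold restLaw; infer_instance

lemma irg_adj (φ : ConnectionFunction 𝕏) (n : ℕ) (x : ℕ → 𝕏) (t : ℕ → ℕ → I) (i k : Fin n) :
    (irg φ n x t).Adj i k ↔ i ≠ k ∧ φ.Linked (x i) (x k, t (s(i, k).inf) (s(i, k).sup)) := by
  simp only [irg, SimpleGraph.fromRel_adj, ConnectionFunction.Linked, Sym2.inf_mk, Sym2.sup_mk]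
  refine and_congr_right fun hne => ?_
  rcases lt_or_gt_of_ne hne with h | h
  · simp [h, h.le, h.not_gt]
  · simp [h, h.le, h.not_gt, φ.symm' (x i) (x k)]

/-- The graph on `n + 1` points as seen from the vertex `v`: the point of `v`, the other points with
the marks of their edges to `v`, and the marks of the edges which avoid `v`. -/
def viewFrom {n : ℕ} (v : Fin (n + 1)) (x : ℕ → 𝕏) (t : ℕ → ℕ → I) :
    𝕏 × (Fin n → 𝕏 × I) × (Sym2 (Fin n) → I) :=
  (x v, fun l => (x (v.succAbove l), t (s(v, v.succAbove l).inf) (s(v, v.succAbove l).sup)),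
    fun s => t (s.map v.succAbove).inf (s.map v.succAbove).sup)

open Classical in
lemma degree_irg_self (φ : ConnectionFunction 𝕏) {n : ℕ} (v : Fin (n + 1)) (x : ℕ → 𝕏)
    (t : ℕ → ℕ → I) :
    (irg φ (n + 1) x t).degree v = starDeg φ (viewFrom v x t).1 (viewFrom v x t).2.1 := by
  rw [← SimpleGraph.card_neighborFinset_eq_degree, SimpleGraph.neighborFinset_eq_filter,
    Finset.card_filter, Fin.sum_univ_succAbove _ v, starDeg, Finset.card_filter,
    if_neg (SimpleGraph.irrefl _), zero_add]
  refine Finset.sum_congr rfl fun l _ => if_congr ?_ rfl rfl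
  simp [irg_adj, viewFrom, (Fin.succAbove_ne v _).symm]

open Classical in
lemma degree_irg_succAbove (φ : ConnectionFunction 𝕏) {n : ℕ} (v : Fin (n + 1)) (x : ℕ → 𝕏)
    (t : ℕ → ℕ → I) (u : Fin n) :
    (irg φ (n + 1) x t).degree (v.succAbove u) =
      restDeg φ (viewFrom v x t).2.1 (viewFrom v x t).2.2 u +
        (if φ.Linked (viewFrom v x t).1 ((viewFrom v x t).2.1 u) then 1 else 0) := by
  rw [← SimpleGraph.card_neighborFinset_eq_degree, SimpleGraph.neighborFinset_eq_filter,
    Finset.card_filter, Fin.sum_univ_succAbove _ v, restDeg, Finset.card_filter, add_comm]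
  congr 1
  · refine Finset.sum_congr rfl fun l _ => ?_
    congr 1
    simp [irg_adj, viewFrom, eq_comm (a := u)]
  · refine if_congr ?_ rfl rfl
    rw [SimpleGraph.adj_comm]
    simp [irg_adj, viewFrom, (Fin.succAbove_ne v _).symm]

open Classical in
/-- The vertices of degree `j` are counted by separating `v` from the other vertices. -/
lemma numDeg_irg (φ : ConnectionFunction 𝕏) {n : ℕ} (v : Fin (n + 1)) (x : ℕ → 𝕏)
    (t : ℕ → ℕ → I) (j : ℕ) :
    numDeg (irg φ (n + 1) x t) j =
      (if starDeg φ (viewFrom v x t).1 (viewFrom v x t).2.1 = j then 1 else 0) +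
        numFull φ j (viewFrom v x t).1 (viewFrom v x t).2.1 (viewFrom v x t).2.2 := by
  rw [numDeg, Finset.card_filter, Fin.sum_univ_succAbove _ v, numFull, Finset.card_filter]
  congr 1
  · rw [← degree_irg_self]
  · refine Finset.sum_congr rfl fun u _ => ?_
    rw [← degree_irg_succAbove]

/-- All vertices have the same view of the graph in law: an independent point, an i.i.d. family of
other points with uniform marks, and independent uniform marks for the remaining edges. -/
lemma map_viewFrom {Ω : Type*} [MeasurableSpace Ω] {μ : Measure 𝕏} [IsProbabilityMeasure μ]
    {P : Measure Ω} [IsProbabilityMeasure P] {X : ℕ → Ω → 𝕏} {T : ℕ → Ω → ℕ → I}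
    {Z : ℝ≥0 → Ω → ℕ} (h : IsMarkedSample μ P X T Z) {n : ℕ} (v : Fin (n + 1)) :
    MeasurePreserving (fun ω => viewFrom v (X · ω) (T · ω)) P (μ.prod (restLaw μ (Fin n))) := by
  -- the first `n + 1` points and their marks
  have h1 : MeasurePreserving (fun ω (i : Fin (n + 1)) => (X i ω, T i ω)) P
      (Measure.pi fun _ => μ.prod markMeasure) := by
    refine ⟨by have := h.measurable_point; have := h.measurable_mark; fun_prop, ?_⟩
    have hi : iIndepFun (fun (i : Fin (n + 1)) ω => (X i ω, T i ω)) P :=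
      h.indep_point.precomp Fin.val_injective
    rw [(iIndepFun_iff_map_fun_eq_pi_map (fun i : Fin (n + 1) => (h.law_point i).aemeasurable)).1 hi]
    congr 1
    ext1 i
    exact (h.law_point i).map_eq
  have h2 := measurePreserving_arrowProdEquivProdArrow 𝕏 (ℕ → I) (Fin (n + 1)) (fun _ => μ)
    (fun _ => markMeasure)
  -- the marks as one family of independent uniform variables, and its reindexing
  let ι := Fin n ⊕ Sym2 (Fin n)
  let pr : ι → Sym2 (Fin (n + 1)) :=
    Sum.elim (fun l => s(v, v.succAbove l)) (fun s => s.map v.succAbove)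
  have hpr : Function.Injective pr := by
    refine Function.Injective.sumElim ?_ (Sym2.map.injective Fin.succAbove_right_injective) ?_
    · intro l l' hl
      simpa using hl
    · intro l s hls
      have : v ∈ s.map v.succAbove := by rw [← hls]; simp
      obtain ⟨k, _, hk⟩ := Sym2.mem_map.1 this
      exact Fin.succAbove_ne v k hk
  let g : ι → Fin (n + 1) × ℕ := fun i => ((pr i).inf, ((pr i).sup : Fin (n + 1)))
  have hg : Function.Injective g := by
    intro i i' hi
    simp only [g, Prod.mk.injEq, Fin.val_inj] at hi
    exact hpr (Sym2.inf_eq_inf_and_sup_eq_sup.1 hi)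
  have h3 : MeasurePreserving (fun (τ : Fin (n + 1) → ℕ → I) (i : ι) => τ (g i).1 (g i).2)
      (Measure.pi fun _ => markMeasure) (Measure.pi fun _ => volume) := by
    have e1 : (Measure.infinitePi fun _ : Fin (n + 1) => Measure.infinitePi fun _ : ℕ =>
        (volume : Measure I)).map (MeasurableEquiv.curry (Fin (n + 1)) ℕ I).symm = _ :=
      Measure.infinitePi_map_curry_symm fun _ _ => volume
    have e2 : (Measure.infinitePi fun _ : Fin (n + 1) × ℕ => (volume : Measure I)).map
        (fun τ i => τ (g i)) = _ := Measure.map_infinitePi_infinitePi_of_inj hg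
    refine ⟨by fun_prop, ?_⟩
    rw [← Measure.infinitePi_eq_pi, ← Measure.infinitePi_eq_pi, ← e2, ← e1,
      Measure.map_map (by fun_prop) (MeasurableEquiv.measurable _)]
    rfl
  have h4 := measurePreserving_sumPiEquivProdPi (X := fun _ : ι => I) (fun _ => volume)
  have h5 := measurePreserving_piFinSuccAbove (fun _ : Fin (n + 1) => μ) v
  have h6 := (h5.prod (h4.comp h3)).comp (h2.comp h1)
  have h7 := (measurePreserving_arrowProdEquivProdArrow 𝕏 I (Fin n) (fun _ => μ)
    (fun _ => (volume : Measure I))).symm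
  have h8 := MeasurePreserving.prod (MeasurePreserving.id μ)
    (MeasurePreserving.prod h7 (MeasurePreserving.id
      (Measure.pi fun _ : Sym2 (Fin n) => (volume : Measure I))))
  have a1 := measurePreserving_prodAssoc μ (Measure.pi fun _ : Fin n => μ)
    ((Measure.pi fun _ : Fin n => (volume : Measure I)).prod
      (Measure.pi fun _ : Sym2 (Fin n) => (volume : Measure I)))
  have a2 := (MeasurePreserving.id μ).prod (measurePreserving_prodAssoc
    (Measure.pi fun _ : Fin n => μ) (Measure.pi fun _ : Fin n => (volume : Measure I))
    (Measure.pi fun _ : Sym2 (Fin n) => (volume : Measure I))).symm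
  exact h8.comp (a2.comp (a1.comp h6))

end Model

/-! ### Decoupling one vertex from the rest of the graph -/

section Tools

/-- Exchanging the two entries of a pair of independent copies off a symmetric set does not change
the law of the pair. -/
lemma measurePreserving_ite_swap {α : Type*} [MeasurableSpace α] (ν : Measure α)
    [IsProbabilityMeasure ν] (S : α × α → Prop) [DecidablePred S] (hS : MeasurableSet {c | S c})
    (hsymm : ∀ c, S c.swap ↔ S c) :
    MeasurePreserving (fun c => if S c then c else c.swap) (ν.prod ν) (ν.prod ν) := by
  have hm : Measurable fun c : α × α => if S c then c else c.swap :=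
    Measurable.ite hS measurable_id measurable_swap
  refine ⟨hm, ?_⟩
  ext A hA
  rw [Measure.map_apply hm hA]
  have hsw : MeasurePreserving Prod.swap (ν.prod ν) (ν.prod ν) := Measure.measurePreserving_swap
  have hc : MeasurableSet {c | ¬ S c} := hS.compl
  rw [← measure_inter_add_sdiff A hS, ← measure_inter_add_sdiff _ hS]
  congr 1
  · congr 1
    ext c
    by_cases h : S c <;> simp [h]
  · rw [← hsw.measure_preimage (hA.diff hS).nullMeasurableSet]
    congr 1
    ext c
    by_cases h : S c <;> simp [h, hsymm]

variable {O : Type*} [Fintype O]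

/-- The marks of the edges at `u`, together with the data of the other endpoints, are i.i.d. -/
lemma measurePreserving_star {α : Type*} [MeasurableSpace α] (ρ : Measure α)
    [IsProbabilityMeasure ρ] (u : O) :
    MeasurePreserving (fun (q : (O → α) × (Sym2 O → I)) l => (q.1 l, q.2 s(u, l)))
      ((Measure.pi fun _ => ρ).prod (Measure.pi fun _ => volume))
      (Measure.pi fun _ => ρ.prod volume) := by
  have hinj : Function.Injective fun l : O => s(u, l) := fun l l' h => Sym2.congr_right.1 h
  have h1 : MeasurePreserving (fun (t : Sym2 O → I) l => t s(u, l))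
      (Measure.pi fun _ => volume) (Measure.pi fun _ => volume) := by
    refine ⟨by fun_prop, ?_⟩
    rw [← Measure.infinitePi_eq_pi, ← Measure.infinitePi_eq_pi]
    exact Measure.map_infinitePi_infinitePi_of_inj hinj
  have h2 := (measurePreserving_arrowProdEquivProdArrow α I O (fun _ => ρ)
    (fun _ => (volume : Measure I))).symm
  exact h2.comp ((MeasurePreserving.id _).prod h1)

end Tools

section Coupling

variable {𝕏 : Type*} [MeasurableSpace 𝕏] {O : Type*} [Fintype O]

/-- The quantitative assumptions on a connection function: all expected degrees (per point) lie in
`[ε m, m]` with `m ≤ 1 / 2`, and no connection probability exceeds `1 - ε`. -/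
structure Regular (φ : ConnectionFunction 𝕏) (μ : Measure 𝕏) (ε m : ℝ) : Prop where
  pos : 0 < ε
  le_half : m ≤ 1 / 2
  le : ∀ x, φ.meanDeg μ x ≤ m
  ge : ∀ x, ε * m ≤ φ.meanDeg μ x
  bound : ∀ x y, φ.toFun x y ≤ 1 - ε

lemma Regular.nonneg {φ : ConnectionFunction 𝕏} {μ : Measure 𝕏} [IsProbabilityMeasure μ]
    {ε m : ℝ} (h : Regular φ μ ε m) : 0 ≤ m := by
  obtain ⟨x⟩ : Nonempty 𝕏 := nonempty_of_isProbabilityMeasure μ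
  exact (φ.meanDeg_nonneg μ x).trans (h.le x)

/-- One of the two marked points is linked to `x`. -/
def NearBy (φ : ConnectionFunction 𝕏) (x : 𝕏) (c : (𝕏 × I) × (𝕏 × I)) : Prop :=
  φ.Linked x c.1 ∨ φ.Linked x c.2

lemma measurableSet_nearBy {β : Type*} [MeasurableSpace β] (φ : ConnectionFunction 𝕏) (x : 𝕏)
    {f : β → (𝕏 × I) × (𝕏 × I)} (hf : Measurable f) : MeasurableSet {b | NearBy φ x (f b)} :=
  (φ.measurableSet_linked measurable_const hf.fst).union
    (φ.measurableSet_linked measurable_const hf.snd)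

open Classical in
/-- The hybrid of two copies of a marked point: the first copy if neither copy is linked to `x`,
and the second copy otherwise. -/
noncomputable def hybrid (φ : ConnectionFunction 𝕏) (x : 𝕏) (c : (𝕏 × I) × (𝕏 × I)) : 𝕏 × I :=
  if NearBy φ x c then c.2 else c.1

open Classical in
/-- The number of neighbours, among the points with no copy linked to `x`, of a point `y` put in
the place of `u`. -/
noncomputable def farDeg (φ : ConnectionFunction 𝕏) (x y : 𝕏) (c : O → (𝕏 × I) × (𝕏 × I))
    (t : Sym2 O → I) (u : O) : ℕ :=
  (Finset.univ.filter fun l => l ≠ u ∧ ¬ NearBy φ x (c l) ∧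
    φ.Linked y ((c l).1.1, t s(u, l))).card

/-- The joint law of two independent copies of each marked point and of a single family of marks for
the edges between them. -/
noncomputable def coupledLaw (μ : Measure 𝕏) (O : Type*) [Fintype O] :
    Measure ((O → (𝕏 × I) × (𝕏 × I)) × (Sym2 O → I)) :=
  (Measure.pi fun _ => (μ.prod volume).prod (μ.prod volume)).prod (Measure.pi fun _ => volume)

instance (μ : Measure 𝕏) [IsProbabilityMeasure μ] : IsProbabilityMeasure (coupledLaw μ O) := by
  unfold coupledLaw; infer_instance

lemma measurable_starDeg {β : Type*} [MeasurableSpace β] (φ : ConnectionFunction 𝕏)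
    {f : β → 𝕏} {g : β → O → 𝕏 × I} (hf : Measurable f) (hg : Measurable g) :
    Measurable fun b => starDeg φ (f b) (g b) := by
  classical
  simp_rw [starDeg, Finset.card_filter]
  refine Finset.measurable_sum _ fun l _ => Measurable.ite ?_ measurable_const measurable_const
  exact φ.measurableSet_linked hf ((measurable_pi_apply l).comp hg)

lemma measurable_restDeg {β : Type*} [MeasurableSpace β] (φ : ConnectionFunction 𝕏)
    {g : β → O → 𝕏 × I} {t : β → Sym2 O → I} (hg : Measurable g) (ht : Measurable t) (u : O) :
    Measurable fun b => restDeg φ (g b) (t b) u := by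
  classical
  simp_rw [restDeg, Finset.card_filter]
  refine Finset.measurable_sum _ fun l _ => Measurable.ite ?_ measurable_const measurable_const
  by_cases h : l = u
  · simp [h]
  · simp only [ne_eq, h, not_false_eq_true, true_and]
    exact φ.measurableSet_linked (by fun_prop) (by fun_prop)

lemma measurable_numRest {β : Type*} [MeasurableSpace β] (φ : ConnectionFunction 𝕏) (j : ℕ)
    {g : β → O → 𝕏 × I} {t : β → Sym2 O → I} (hg : Measurable g) (ht : Measurable t) :
    Measurable fun b => numRest φ j (g b) (t b) := by
  classical
  simp_rw [numRest, Finset.card_filter]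
  refine Finset.measurable_sum _ fun u _ => Measurable.ite ?_ measurable_const measurable_const
  exact measurable_restDeg φ hg ht u (measurableSet_singleton j)

lemma measurable_numFull {β : Type*} [MeasurableSpace β] (φ : ConnectionFunction 𝕏) (j : ℕ)
    {f : β → 𝕏} {g : β → O → 𝕏 × I} {t : β → Sym2 O → I} (hf : Measurable f) (hg : Measurable g)
    (ht : Measurable t) : Measurable fun b => numFull φ j (f b) (g b) (t b) := by
  classical
  simp_rw [numFull, Finset.card_filter]
  refine Finset.measurable_sum _ fun u _ => Measurable.ite ?_ measurable_const measurable_const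
  refine ((measurable_restDeg φ hg ht u).add (Measurable.ite
    (φ.measurableSet_linked hf ((measurable_pi_apply u).comp hg))
    measurable_const measurable_const)) (measurableSet_singleton j)

/-- The graph on the hybrid points is independent of the degree of `x`, and has the law of the graph
without `x`. Indeed, exchanging the two copies of every point with no copy linked to `x` preserves
the law, turns the second copies into the hybrid points, and leaves the degree of `x` as it is. -/
lemma coupledLaw_hybrid (φ : ConnectionFunction 𝕏) (μ : Measure 𝕏) [IsProbabilityMeasure μ] (x : 𝕏)
    (j k : ℕ) :
    coupledLaw μ O {q | starDeg φ x (fun l => (q.1 l).1) = j ∧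
      numRest φ j (fun l => hybrid φ x (q.1 l)) q.2 = k} =
    restLaw μ O {q | starDeg φ x q.1 = j} * restLaw μ O {q | numRest φ j q.1 q.2 = k} := by
  classical
  let ν : Measure (𝕏 × I) := μ.prod volume
  let f : (𝕏 × I) × (𝕏 × I) → (𝕏 × I) × (𝕏 × I) := fun c => if NearBy φ x c then c else c.swap
  have hf : MeasurePreserving f (ν.prod ν) (ν.prod ν) :=
    measurePreserving_ite_swap ν (NearBy φ x) (measurableSet_nearBy φ x measurable_id)
      fun c => or_comm
  have hF : MeasurePreserving (Prod.map (fun (c : O → _) l => f (c l)) id)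
      (coupledLaw μ O) (coupledLaw μ O) :=
    (measurePreserving_pi _ _ fun _ => hf).prod (MeasurePreserving.id _)
  have hA := (measurePreserving_prodAssoc (Measure.pi fun _ : O => ν) (Measure.pi fun _ : O => ν)
    (Measure.pi fun _ : Sym2 O => (volume : Measure I))).comp
    ((measurePreserving_arrowProdEquivProdArrow (𝕏 × I) (𝕏 × I) O (fun _ => ν)
      (fun _ => ν)).prod (MeasurePreserving.id (Measure.pi fun _ : Sym2 O => (volume : Measure I))))
  have hm1 : MeasurableSet {a : O → 𝕏 × I | starDeg φ x a = j} :=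
    measurable_starDeg φ measurable_const measurable_id (measurableSet_singleton j)
  have hm2 : MeasurableSet {q : (O → 𝕏 × I) × (Sym2 O → I) | numRest φ j q.1 q.2 = k} :=
    measurable_numRest φ j measurable_fst measurable_snd (measurableSet_singleton k)
  have h1 : restLaw μ O {q | starDeg φ x q.1 = j} =
      Measure.pi (fun _ : O => ν) {a | starDeg φ x a = j} :=
    (measurePreserving_fst (μ := Measure.pi fun _ : O => ν)
      (ν := Measure.pi fun _ : Sym2 O => (volume : Measure I))).measure_preimage
      hm1.nullMeasurableSet
  have h2 : coupledLaw μ O {q | starDeg φ x (fun l => (q.1 l).1) = j ∧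
      numRest φ j (fun l => (q.1 l).2) q.2 = k} =
      restLaw μ O {q | starDeg φ x q.1 = j} * restLaw μ O {q | numRest φ j q.1 q.2 = k} := by
    rw [h1, restLaw, ← Measure.prod_prod]
    exact hA.measure_preimage (hm1.prod hm2).nullMeasurableSet
  rw [← h2]
  have hm3 : MeasurableSet {q : (O → (𝕏 × I) × (𝕏 × I)) × (Sym2 O → I) |
      starDeg φ x (fun l => (q.1 l).1) = j ∧ numRest φ j (fun l => (q.1 l).2) q.2 = k} :=
    (measurable_starDeg φ measurable_const (by fun_prop) (measurableSet_singleton j)).inter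
      (measurable_numRest φ j (by fun_prop) measurable_snd (measurableSet_singleton k))
  rw [← hF.measure_preimage hm3.nullMeasurableSet]
  congr 1
  ext q
  have e1 : starDeg φ x (fun l => (f (q.1 l)).1) = starDeg φ x (fun l => (q.1 l).1) := by
    unfold starDeg
    congr 2
    ext l
    by_cases h : NearBy φ x (q.1 l)
    · simp [f, h]
    · have h' := h
      simp only [NearBy, not_or] at h'
      simp [f, h, h'.1, h'.2]
  have e2 : (fun l => (f (q.1 l)).2) = fun l => hybrid φ x (q.1 l) := by
    ext1 l
    by_cases h : NearBy φ x (q.1 l) <;> simp [f, hybrid, h]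
  simp only [Set.mem_ofPred_eq, Set.mem_preimage, Prod.map_fst, Prod.map_snd, id, e1, e2]

/-- If the number of vertices other than `x` of degree `j` differs between the full graph and the
graph on the hybrid points, then there is a vertex with few far neighbours which has a copy linked
to `x`, or is joined to a copy of a point that has a copy linked to `x`. -/
lemma exists_of_numFull_ne_numRest (φ : ConnectionFunction 𝕏) (x : 𝕏) (j : ℕ)
    (c : O → (𝕏 × I) × (𝕏 × I)) (t : Sym2 O → I)
    (h : numFull φ j x (fun l => (c l).1) t ≠ numRest φ j (fun l => hybrid φ x (c l)) t) :
    ∃ u, (NearBy φ x (c u) ∧ farDeg φ x (c u).1.1 c t u ≤ j) ∨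
      (NearBy φ x (c u) ∧ farDeg φ x (c u).2.1 c t u ≤ j) ∨
      ∃ k, k ≠ u ∧ farDeg φ x (c u).1.1 c t u ≤ j ∧ NearBy φ x (c k) ∧
        (φ.Linked (c u).1.1 ((c k).1.1, t s(u, k)) ∨
          φ.Linked (c u).1.1 ((c k).2.1, t s(u, k))) := by
  classical
  obtain ⟨u, hu⟩ : ∃ u, ¬ ((restDeg φ (fun l => (c l).1) t u +
      (if φ.Linked x (c u).1 then 1 else 0) = j) ↔
      restDeg φ (fun l => hybrid φ x (c l)) t u = j) := by
    by_contra! hcon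
    refine h ?_
    unfold numFull numRest
    congr 1
    ext u
    simpa using hcon u
  refine ⟨u, ?_⟩
  have hf1 : farDeg φ x (c u).1.1 c t u ≤ restDeg φ (fun l => (c l).1) t u :=
    Finset.card_le_card fun l hl => by
      simp only [Finset.mem_filter, Finset.mem_univ, true_and] at hl ⊢
      exact ⟨hl.1, hl.2.2⟩
  have hf2 : farDeg φ x (hybrid φ x (c u)).1 c t u ≤ restDeg φ (fun l => hybrid φ x (c l)) t u :=
    Finset.card_le_card fun l hl => by
      simp only [Finset.mem_filter, Finset.mem_univ, true_and] at hl ⊢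
      refine ⟨hl.1, ?_⟩
      simpa [hybrid, hl.2.1] using hl.2.2
  by_cases hn : NearBy φ x (c u)
  · have hhyb : hybrid φ x (c u) = (c u).2 := by simp [hybrid, hn]
    rw [hhyb] at hf2
    by_cases h2 : restDeg φ (fun l => hybrid φ x (c l)) t u = j
    · exact Or.inr (Or.inl ⟨hn, hf2.trans h2.le⟩)
    · refine Or.inl ⟨hn, ?_⟩
      have : restDeg φ (fun l => (c l).1) t u + (if φ.Linked x (c u).1 then 1 else 0) = j := by
        tauto
      omega
  · refine Or.inr (Or.inr ?_)
    have hhyb : hybrid φ x (c u) = (c u).1 := by simp [hybrid, hn]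
    have hnl : ¬ φ.Linked x (c u).1 := fun h => hn (Or.inl h)
    rw [hhyb] at hf2
    rw [if_neg hnl, add_zero] at hu
    have hfj : farDeg φ x (c u).1.1 c t u ≤ j := by
      by_cases h2 : restDeg φ (fun l => hybrid φ x (c l)) t u = j
      · exact hf2.trans h2.le
      · have : restDeg φ (fun l => (c l).1) t u = j := by tauto
        exact hf1.trans this.le
    by_contra! hcon
    refine hu ?_
    have : restDeg φ (fun l => (c l).1) t u = restDeg φ (fun l => hybrid φ x (c l)) t u := by
      unfold restDeg
      congr 1
      ext l
      simp only [Finset.mem_filter, Finset.mem_univ, true_and, hhyb]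
      refine and_congr_right fun hl => ?_
      by_cases hnl : NearBy φ x (c l)
      · have h3 := hcon l hl hfj hnl
        simp [hybrid, hnl, h3.1, h3.2]
      · simp [hybrid, hnl]
    rw [this]

end Coupling

/-! ### Estimates for the decoupling error -/

section Estimates

variable {𝕏 : Type*} [MeasurableSpace 𝕏] {O : Type*} [Fintype O]
  {φ : ConnectionFunction 𝕏} {μ : Measure 𝕏} [IsProbabilityMeasure μ] {ε m : ℝ}

lemma measure_nearBy_le (h : Regular φ μ ε m) (x : 𝕏) :
    ((μ.prod (volume : Measure I)).prod (μ.prod (volume : Measure I))) {c | NearBy φ x c} ≤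
      ENNReal.ofReal (2 * m) := by
  have h1 := (measurePreserving_fst (μ := μ.prod (volume : Measure I))
    (ν := μ.prod (volume : Measure I))).measure_preimage
      (φ.measurableSet_linked (f := fun _ => x) measurable_const measurable_id).nullMeasurableSet
  have h2 := (measurePreserving_snd (μ := μ.prod (volume : Measure I))
    (ν := μ.prod (volume : Measure I))).measure_preimage
      (φ.measurableSet_linked (f := fun _ => x) measurable_const measurable_id).nullMeasurableSet
  refine (measure_union_le _ _).trans ?_
  have hl := φ.measure_linked μ x
  have hm := h.nonneg
  calc _ = ENNReal.ofReal (φ.meanDeg μ x) + ENNReal.ofReal (φ.meanDeg μ x) :=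
        congrArg₂ (· + ·) (h1.trans hl) (h2.trans hl)
    _ ≤ ENNReal.ofReal m + ENNReal.ofReal m :=
        add_le_add (ENNReal.ofReal_le_ofReal (h.le x)) (ENNReal.ofReal_le_ofReal (h.le x))
    _ = _ := by rw [← ENNReal.ofReal_add hm hm]; ring_nf

/-- The probability that a random point is joined to `x`, or else is joined to `y` and neither of
its copies is linked to `x`. As no connection probability exceeds `1 - ε`, the second point `y`
contributes a fixed proportion of its expected degree, however close it is to `x`. -/
lemma le_measureReal_linked_or (h : Regular φ μ ε m) (x y : 𝕏) :
    φ.meanDeg μ x + ε ^ 2 * m / 2 ≤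
      (((μ.prod (volume : Measure I)).prod (μ.prod (volume : Measure I))).prod
        (volume : Measure I)).real
        {r | φ.Linked x r.1.1 ∨ (¬ NearBy φ x r.1 ∧ φ.Linked y (r.1.1.1, r.2))} := by
  set ν : Measure (𝕏 × I) := μ.prod (volume : Measure I)
  have hm := h.nonneg
  have hεp := h.pos
  have hL : ∀ z, MeasurableSet {a : 𝕏 × I | φ.Linked z a} := fun z =>
    φ.measurableSet_linked (f := fun _ => z) measurable_const measurable_id
  let B1 : Set (((𝕏 × I) × (𝕏 × I)) × I) := {r | φ.Linked x r.1.1}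
  let B2 : Set (((𝕏 × I) × (𝕏 × I)) × I) :=
    {r | ¬ NearBy φ x r.1 ∧ φ.Linked y (r.1.1.1, r.2)}
  have hB1 : MeasurableSet B1 := φ.measurableSet_linked measurable_const (by fun_prop)
  have hB2 : MeasurableSet B2 := (measurableSet_nearBy φ x measurable_fst).compl.inter
    (φ.measurableSet_linked measurable_const (by fun_prop))
  have hdisj : Disjoint B1 B2 := Set.disjoint_left.2 fun r h1 h2 => h2.1 (Or.inl h1)
  have hB1m : ((ν.prod ν).prod (volume : Measure I)).real B1 = φ.meanDeg μ x := by
    rw [← φ.measureReal_linked μ x, measureReal_def, measureReal_def]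
    congr 1
    exact ((measurePreserving_fst (μ := ν) (ν := ν)).comp
      (measurePreserving_fst (μ := ν.prod ν) (ν := (volume : Measure I)))).measure_preimage
      (hL x).nullMeasurableSet
  have hnl : ENNReal.ofReal (1 / 2) ≤ ν {a | ¬ φ.Linked x a} := by
    have : ν {a | ¬ φ.Linked x a} = ENNReal.ofReal (1 - φ.meanDeg μ x) := by
      rw [← φ.measureReal_linked μ x, ← probReal_compl_eq_one_sub (hL x), ofReal_measureReal]
      rfl
    rw [this]
    exact ENNReal.ofReal_le_ofReal (by linarith [h.le x, h.le_half])
  have hfm : Measurable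
      ({a | ¬ φ.Linked x a}.indicator fun a : 𝕏 × I => ENNReal.ofReal (φ.toFun y a.1)) :=
    Measurable.indicator
      (φ.measurable_comp measurable_const measurable_fst).ennreal_ofReal (hL x).compl
  have h1m : Measurable ({a | ¬ φ.Linked x a}.indicator fun _ : 𝕏 × I => (1 : ENNReal)) :=
    measurable_const.indicator (hL x).compl
  -- homogeneity gives one factor `ε`, the bound `1 - ε` on the connection probabilities the other
  have hfar : ENNReal.ofReal (ε * (ε * m)) ≤
      ∫⁻ a, {a | ¬ φ.Linked x a}.indicator (fun a => ENNReal.ofReal (φ.toFun y a.1)) a ∂ν := by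
    rw [show ν = μ.prod volume from rfl, lintegral_prod _ hfm.aemeasurable]
    calc ENNReal.ofReal (ε * (ε * m)) ≤ ENNReal.ofReal ε * ENNReal.ofReal (φ.meanDeg μ y) := by
          rw [← ENNReal.ofReal_mul hεp.le]
          exact ENNReal.ofReal_le_ofReal (mul_le_mul_of_nonneg_left (h.ge y) hεp.le)
      _ = ∫⁻ z, ENNReal.ofReal ε * ENNReal.ofReal (φ.toFun y z) ∂μ := by
          rw [lintegral_const_mul _ (φ.measurable_right y).ennreal_ofReal, φ.lintegral_eq]
      _ ≤ _ := lintegral_mono fun z => ?_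
    have hset : MeasurableSet {w : I | ¬ φ.Linked x (z, w)} :=
      (φ.measurableSet_linked (f := fun _ => x) (g := fun w => (z, w)) measurable_const
        (by fun_prop)).compl
    have e1 : (fun w : I => {a | ¬ φ.Linked x a}.indicator
        (fun a => ENNReal.ofReal (φ.toFun y a.1)) (z, w)) =
        {w : I | ¬ φ.Linked x (z, w)}.indicator fun _ => ENNReal.ofReal (φ.toFun y z) := rfl
    rw [e1, lintegral_indicator_const hset, mul_comm]
    refine mul_le_mul_right ?_ _
    have e2 : (volume : Measure I) {w : I | ¬ φ.Linked x (z, w)} =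
        1 - ENNReal.ofReal (φ.toFun x z) := by
      rw [← ConnectionFunction.volume_mark_le (φ.mem_Icc' x z)]
      have := prob_compl_eq_one_sub (μ := (volume : Measure I))
        (s := {w : I | (w : ℝ) ≤ φ.toFun x z})
        (measurableSet_le measurable_subtype_coe measurable_const)
      exact this
    rw [e2, ← ENNReal.ofReal_one, ← ENNReal.ofReal_sub _ (φ.nonneg x z)]
    exact ENNReal.ofReal_le_ofReal (by linarith [h.bound x z])
  have hB2m : ENNReal.ofReal (ε ^ 2 * m / 2) ≤ ((ν.prod ν).prod (volume : Measure I)) B2 := by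
    rw [Measure.prod_apply hB2]
    have e1 : ∀ c : (𝕏 × I) × (𝕏 × I), (volume : Measure I) (Prod.mk c ⁻¹' B2) =
        {a | ¬ φ.Linked x a}.indicator (fun a => ENNReal.ofReal (φ.toFun y a.1)) c.1 *
          {a | ¬ φ.Linked x a}.indicator (fun _ => 1) c.2 := by
      intro c
      by_cases h1 : φ.Linked x c.1
      · have : Prod.mk c ⁻¹' B2 = ∅ := by
          ext w; simp [B2, NearBy, h1]
        simp [this, h1]
      by_cases h2 : φ.Linked x c.2
      · have : Prod.mk c ⁻¹' B2 = ∅ := by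
          ext w; simp [B2, NearBy, h2]
        simp [this, h2]
      have : Prod.mk c ⁻¹' B2 = {w : I | (w : ℝ) ≤ φ.toFun y c.1.1} := by
        ext w
        exact ⟨fun hw => hw.2, fun hw => ⟨fun hn => hn.elim h1 h2, hw⟩⟩
      rw [this, ConnectionFunction.volume_mark_le (φ.mem_Icc' y c.1.1)]
      simp [h1, h2]
    simp_rw [e1]
    rw [lintegral_prod_mul hfm.aemeasurable h1m.aemeasurable]
    have e3 : ∫⁻ a, {a | ¬ φ.Linked x a}.indicator (fun _ => (1 : ENNReal)) a ∂ν =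
        ν {a | ¬ φ.Linked x a} := lintegral_indicator_one (hL x).compl
    rw [e3]
    refine le_trans (le_of_eq ?_) (mul_le_mul' hfar hnl)
    rw [← ENNReal.ofReal_mul (by positivity)]
    congr 1
    ring
  have hunion : {r : ((𝕏 × I) × (𝕏 × I)) × I | φ.Linked x r.1.1 ∨
      (¬ NearBy φ x r.1 ∧ φ.Linked y (r.1.1.1, r.2))} = B1 ∪ B2 := rfl
  rw [hunion, measureReal_union hdisj hB2, hB1m]
  gcongr
  rwa [measureReal_def, ← ENNReal.ofReal_le_iff_le_toReal (measure_ne_top _ _)]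

/-- The probability that a point has a copy linked to `x` and that one of the two copies is joined
to another random point. -/
lemma measure_nearBy_linked_le (h : Regular φ μ ε m) (x : 𝕏) :
    ((((μ.prod (volume : Measure I)).prod (μ.prod (volume : Measure I))).prod
        (volume : Measure I)).prod
      (((μ.prod (volume : Measure I)).prod (μ.prod (volume : Measure I))).prod
        (volume : Measure I)))
      {p | NearBy φ x p.2.1 ∧ (φ.Linked p.1.1.1.1 (p.2.1.1.1, p.2.2) ∨
        φ.Linked p.1.1.1.1 (p.2.1.2.1, p.2.2))} ≤ ENNReal.ofReal (4 * m ^ 2) := by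
  set ν : Measure (𝕏 × I) := μ.prod (volume : Measure I)
  set κ := (ν.prod ν).prod (volume : Measure I)
  have hm := h.nonneg
  let A : Set ((𝕏 × I) × (𝕏 × I)) := {c | NearBy φ x c}
  have hA : MeasurableSet A := measurableSet_nearBy φ x measurable_id
  have hS : MeasurableSet {p : (((𝕏 × I) × (𝕏 × I)) × I) × (((𝕏 × I) × (𝕏 × I)) × I) |
      NearBy φ x p.2.1 ∧ (φ.Linked p.1.1.1.1 (p.2.1.1.1, p.2.2) ∨
        φ.Linked p.1.1.1.1 (p.2.1.2.1, p.2.2))} :=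
    (measurableSet_nearBy φ x (by fun_prop)).inter
      ((φ.measurableSet_linked (by fun_prop) (by fun_prop)).union
        (φ.measurableSet_linked (by fun_prop) (by fun_prop)))
  rw [Measure.prod_apply hS]
  let F : (((𝕏 × I) × (𝕏 × I)) × I) → ((𝕏 × I) × (𝕏 × I)) → ENNReal := fun r c =>
    A.indicator (fun c => ENNReal.ofReal (φ.toFun r.1.1.1 c.1.1) +
      ENNReal.ofReal (φ.toFun r.1.1.1 c.2.1)) c
  have hF : Measurable (Function.uncurry F) := by
    have : Function.uncurry F = (Prod.snd ⁻¹' A).indicator fun q =>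
      ENNReal.ofReal (φ.toFun q.1.1.1.1 q.2.1.1) + ENNReal.ofReal (φ.toFun q.1.1.1.1 q.2.2.1) := rfl
    rw [this]
    refine Measurable.indicator (Measurable.fun_add ?_ ?_) (measurable_snd hA)
    · exact (φ.measurable_comp (by fun_prop) (by fun_prop)).ennreal_ofReal
    · exact (φ.measurable_comp (by fun_prop) (by fun_prop)).ennreal_ofReal
  have h1 : ∀ r, κ (Prod.mk r ⁻¹' {p | NearBy φ x p.2.1 ∧
      (φ.Linked p.1.1.1.1 (p.2.1.1.1, p.2.2) ∨ φ.Linked p.1.1.1.1 (p.2.1.2.1, p.2.2))}) ≤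
      ∫⁻ c, F r c ∂(ν.prod ν) := by
    intro r
    rw [Measure.prod_apply (measurable_prodMk_left hS)]
    refine lintegral_mono fun c => ?_
    by_cases hc : NearBy φ x c
    · have e1 : F r c = ENNReal.ofReal (φ.toFun r.1.1.1 c.1.1) +
          ENNReal.ofReal (φ.toFun r.1.1.1 c.2.1) := Set.indicator_of_mem (s := A) hc _
      rw [e1, ← ConnectionFunction.volume_mark_le (φ.mem_Icc' _ _),
        ← ConnectionFunction.volume_mark_le (φ.mem_Icc' _ _)]
      refine le_trans (measure_mono ?_) (measure_union_le _ _)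
      intro w hw
      exact hw.2
    · have : Prod.mk c ⁻¹' (Prod.mk r ⁻¹' {p : (((𝕏 × I) × (𝕏 × I)) × I) ×
          (((𝕏 × I) × (𝕏 × I)) × I) | NearBy φ x p.2.1 ∧
          (φ.Linked p.1.1.1.1 (p.2.1.1.1, p.2.2) ∨
            φ.Linked p.1.1.1.1 (p.2.1.2.1, p.2.2))}) = ∅ := by
        ext w; simp [hc]
      rw [this, measure_empty]
      exact zero_le
  have h2 : ∀ z, ∫⁻ r, ENNReal.ofReal (φ.toFun r.1.1.1 z) ∂κ ≤ ENNReal.ofReal m := by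
    intro z
    have hmp : MeasurePreserving (fun r : ((𝕏 × I) × (𝕏 × I)) × I => r.1.1.1) κ μ :=
      measurePreserving_fst.comp (measurePreserving_fst.comp measurePreserving_fst)
    have := hmp.lintegral_comp (f := fun y => ENNReal.ofReal (φ.toFun y z))
      (φ.measurable_comp measurable_id measurable_const).ennreal_ofReal
    rw [this]
    simp_rw [φ.symm' _ z]
    rw [φ.lintegral_eq]
    exact ENNReal.ofReal_le_ofReal (h.le z)
  calc _ ≤ ∫⁻ r, ∫⁻ c, F r c ∂(ν.prod ν) ∂κ := lintegral_mono h1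
    _ = ∫⁻ c, ∫⁻ r, F r c ∂κ ∂(ν.prod ν) := lintegral_lintegral_swap hF.aemeasurable
    _ ≤ ∫⁻ c, A.indicator (fun _ => ENNReal.ofReal (2 * m)) c ∂(ν.prod ν) := by
        refine lintegral_mono fun c => ?_
        by_cases hc : c ∈ A
        · simp only [F, Set.indicator_of_mem hc]
          rw [lintegral_add_left (φ.measurable_comp (by fun_prop) (by fun_prop)).ennreal_ofReal,
            two_mul, ENNReal.ofReal_add hm hm]
          exact add_le_add (h2 _) (h2 _)
        · simp [F, hc]
    _ = ENNReal.ofReal (2 * m) * (ν.prod ν) A := lintegral_indicator_const hA _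
    _ ≤ ENNReal.ofReal (2 * m) * ENNReal.ofReal (2 * m) :=
        mul_le_mul_right (measure_nearBy_le h x) _
    _ = _ := by rw [← ENNReal.ofReal_mul (by positivity)]; ring_nf

open Classical in
/-- Few neighbours of `x` and few far neighbours of a point at `u` are jointly unlikely, even given
the data of the vertices singled out by `p`. -/
lemma coupledLaw_farDeg_le (h : Regular φ μ ε m) {θ : ℝ} (hθ0 : 0 < θ) (hθ1 : θ ≤ 1) (x : 𝕏)
    (j : ℕ) (u : O) (p : O → Prop) (hp : p u) {y : (𝕏 × I) × (𝕏 × I) → 𝕏} (hy : Measurable y)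
    {K : Set ({l // p l} → ((𝕏 × I) × (𝕏 × I)) × I)} (hK : MeasurableSet K) :
    coupledLaw μ O {q | starDeg φ x (fun l => (q.1 l).1) = j ∧
      farDeg φ x (y (q.1 u)) q.1 q.2 u ≤ j ∧
      (fun l : {l // p l} => (q.1 l, q.2 s(u, (l : O)))) ∈ K} ≤
    ENNReal.ofReal ((θ ^ (2 * j))⁻¹ *
      Real.exp (-((1 - θ) * (φ.meanDeg μ x + ε ^ 2 * m / 2) * Fintype.card {l // ¬ p l}))) *
    Measure.pi (fun _ : O => ((μ.prod (volume : Measure I)).prod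
      (μ.prod (volume : Measure I))).prod (volume : Measure I))
      {r | (fun l : {l // p l} => r l) ∈ K} := by
  let B : ({l // p l} → ((𝕏 × I) × (𝕏 × I)) × I) → Set (((𝕏 × I) × (𝕏 × I)) × I) := fun z =>
    {r | φ.Linked x r.1.1 ∨
      (¬ NearBy φ x r.1 ∧ φ.Linked (y (z ⟨u, hp⟩).1) (r.1.1.1, r.2))}
  have hB : MeasurableSet {q : ({l // p l} → ((𝕏 × I) × (𝕏 × I)) × I) ×
      (((𝕏 × I) × (𝕏 × I)) × I) | q.2 ∈ B q.1} :=
    (φ.measurableSet_linked measurable_const (by fun_prop)).union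
      ((measurableSet_nearBy φ x (by fun_prop)).compl.inter
        (φ.measurableSet_linked (hy.comp (by fun_prop)) (by fun_prop)))
  have hkey := pi_inter_card_le (ι := O) (((μ.prod (volume : Measure I)).prod
      (μ.prod (volume : Measure I))).prod (volume : Measure I)) p hK hB hθ0 hθ1
      (fun z => le_measureReal_linked_or h x (y (z ⟨u, hp⟩).1)) (2 * j)
  refine le_trans ?_ hkey
  have hstar := measurePreserving_star
    ((μ.prod (volume : Measure I)).prod (μ.prod (volume : Measure I))) u
  rw [← hstar.map_eq]
  refine le_trans (measure_mono ?_) (Measure.le_map_apply hstar.measurable.aemeasurable _)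
  rintro q ⟨h1, h2, h3⟩
  refine ⟨h3, ?_⟩
  calc _ ≤ ((Finset.univ.filter fun l => φ.Linked x (q.1 l).1) ∪
        (Finset.univ.filter fun l => l ≠ u ∧ ¬ NearBy φ x (q.1 l) ∧
          φ.Linked (y (q.1 u)) ((q.1 l).1.1, q.2 s(u, l)))).card := by
        refine Finset.card_le_card fun l hl => ?_
        simp only [Finset.mem_filter, Finset.mem_univ, true_and, Finset.mem_union] at hl ⊢
        rcases hl with ⟨hpl, hl | hl⟩
        · exact Or.inl hl
        · exact Or.inr ⟨fun e => hpl (e ▸ hp), hl⟩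
    _ ≤ _ := Finset.card_union_le _ _
    _ ≤ j + j := add_le_add h1.le h2
    _ = 2 * j := by ring

end Estimates

section Decoupling

variable {𝕏 : Type*} [MeasurableSpace 𝕏] {O : Type*} [Fintype O]
  {φ : ConnectionFunction 𝕏} {μ : Measure 𝕏} [IsProbabilityMeasure μ] {ε m : ℝ}

/-- The bound on the decoupling error for a vertex at `x`, in a graph with `n` other vertices. -/
noncomputable def decouplingError (φ : ConnectionFunction 𝕏) (μ : Measure 𝕏) (ε m θ : ℝ) (j n : ℕ)
    (x : 𝕏) : ℝ :=
  (θ ^ (2 * j))⁻¹ * Real.exp (-((1 - θ) * (φ.meanDeg μ x + ε ^ 2 * m / 2) * (n - 2))) *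
    (4 * n * m + 4 * n ^ 2 * m ^ 2)

/-- The bound on the probability that removing a vertex changes the number of other vertices of
degree `j`. -/
noncomputable def removalError (ε m θ : ℝ) (j n : ℕ) : ℝ :=
  n * ((θ ^ j)⁻¹ * Real.exp (-((1 - θ) * (ε * m) * (n - 1))) * m)

lemma card_le_card_compl_add {p : O → Prop} [DecidablePred p] {s : Finset O}
    (hs : ∀ l, p l → l ∈ s) :
    (Fintype.card O : ℝ) - s.card ≤ Fintype.card {l // ¬ p l} := by
  have h1 : Fintype.card {l // p l} ≤ s.card := by
    rw [Fintype.card_subtype]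
    exact Finset.card_le_card fun l hl => hs l (Finset.mem_filter.1 hl).2
  have h2 := Fintype.card_subtype_compl p
  have h3 := Fintype.card_subtype_le p
  have h4 : Fintype.card O ≤ Fintype.card {l // ¬ p l} + s.card := by omega
  have : (Fintype.card O : ℝ) ≤ Fintype.card {l // ¬ p l} + s.card := by exact_mod_cast h4
  linarith

/-- The event that `x` has degree `j` while the hybrid graph has a different number of vertices of
degree `j`. A union bound over the vertices in `exists_of_numFull_ne_numRest` costs a polynomial in
`n m`, which the exponential factor from `coupledLaw_farDeg_le` outweighs. -/
lemma coupledLaw_numFull_ne_le (h : Regular φ μ ε m) {θ : ℝ} (hθ0 : 0 < θ) (hθ1 : θ ≤ 1) (x : 𝕏)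
    (j : ℕ) :
    coupledLaw μ O {q | starDeg φ x (fun l => (q.1 l).1) = j ∧
      numFull φ j x (fun l => (q.1 l).1) q.2 ≠ numRest φ j (fun l => hybrid φ x (q.1 l)) q.2} ≤
    ENNReal.ofReal (decouplingError φ μ ε m θ j (Fintype.card O) x) := by
  classical
  have hm := h.nonneg
  have hb : 0 ≤ φ.meanDeg μ x + ε ^ 2 * m / 2 := by
    have := φ.meanDeg_nonneg μ x
    positivity
  set n := Fintype.card O with hn
  set C : ℝ := (θ ^ (2 * j))⁻¹ *
    Real.exp (-((1 - θ) * (φ.meanDeg μ x + ε ^ 2 * m / 2) * (n - 2))) with hC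
  have hC0 : 0 ≤ C := by positivity
  set κ : Measure (((𝕏 × I) × (𝕏 × I)) × I) := ((μ.prod (volume : Measure I)).prod
      (μ.prod (volume : Measure I))).prod (volume : Measure I) with hκ
  have hCle : ∀ (p : O → Prop) (s : Finset O), (∀ l, p l → l ∈ s) → s.card ≤ 2 →
      ENNReal.ofReal ((θ ^ (2 * j))⁻¹ * Real.exp (-((1 - θ) *
        (φ.meanDeg μ x + ε ^ 2 * m / 2) * Fintype.card {l // ¬ p l}))) ≤ ENNReal.ofReal C := by
    intro p s hs hs2
    refine ENNReal.ofReal_le_ofReal (mul_le_mul_of_nonneg_left (Real.exp_le_exp.2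
      (neg_le_neg (mul_le_mul_of_nonneg_left ?_ (mul_nonneg (by linarith) hb)))) (by positivity))
    have := card_le_card_compl_add hs
    have h2 : (s.card : ℝ) ≤ 2 := by exact_mod_cast hs2
    linarith
  -- vertices which are themselves close to `x`
  have hself : ∀ (y : (𝕏 × I) × (𝕏 × I) → 𝕏), Measurable y → ∀ u : O,
      coupledLaw μ O {q | starDeg φ x (fun l => (q.1 l).1) = j ∧ NearBy φ x (q.1 u) ∧
        farDeg φ x (y (q.1 u)) q.1 q.2 u ≤ j} ≤ ENNReal.ofReal (C * (2 * m)) := by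
    intro y hy u
    have hK : MeasurableSet {z : {l // l = u} → ((𝕏 × I) × (𝕏 × I)) × I |
        NearBy φ x (z ⟨u, rfl⟩).1} := measurableSet_nearBy φ x (by fun_prop)
    have hkey := coupledLaw_farDeg_le h hθ0 hθ1 x j u (fun l => l = u) rfl hy hK
    rw [ENNReal.ofReal_mul hC0]
    refine le_trans (measure_mono ?_) (hkey.trans (mul_le_mul' (hCle _ {u} (by simp) (by simp)) ?_))
    · rintro q ⟨h1, h2, h3⟩
      exact ⟨h1, h3, h2⟩
    · have hmp : MeasurePreserving (fun r : O → ((𝕏 × I) × (𝕏 × I)) × I => (r u).1)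
          (Measure.pi fun _ => κ) ((μ.prod (volume : Measure I)).prod (μ.prod volume)) :=
        measurePreserving_fst.comp (measurePreserving_eval (fun _ : O => κ) u)
      exact (hmp.measure_preimage
        (measurableSet_nearBy φ x measurable_id).nullMeasurableSet).trans_le (measure_nearBy_le h x)
  -- vertices with a neighbour close to `x`
  have hpair : ∀ u k : O, k ≠ u →
      coupledLaw μ O {q | starDeg φ x (fun l => (q.1 l).1) = j ∧
        farDeg φ x (q.1 u).1.1 q.1 q.2 u ≤ j ∧ NearBy φ x (q.1 k) ∧
        (φ.Linked (q.1 u).1.1 ((q.1 k).1.1, q.2 s(u, k)) ∨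
          φ.Linked (q.1 u).1.1 ((q.1 k).2.1, q.2 s(u, k)))} ≤
      ENNReal.ofReal (C * (4 * m ^ 2)) := by
    intro u k hku
    have hS : MeasurableSet {p : (((𝕏 × I) × (𝕏 × I)) × I) × (((𝕏 × I) × (𝕏 × I)) × I) |
        NearBy φ x p.2.1 ∧ (φ.Linked p.1.1.1.1 (p.2.1.1.1, p.2.2) ∨
          φ.Linked p.1.1.1.1 (p.2.1.2.1, p.2.2))} :=
      (measurableSet_nearBy φ x (by fun_prop)).inter
        ((φ.measurableSet_linked (by fun_prop) (by fun_prop)).union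
          (φ.measurableSet_linked (by fun_prop) (by fun_prop)))
    have hz : Measurable fun z : {l // l = u ∨ l = k} → ((𝕏 × I) × (𝕏 × I)) × I =>
        (z ⟨u, Or.inl rfl⟩, z ⟨k, Or.inr rfl⟩) := by fun_prop
    have hkey := coupledLaw_farDeg_le h hθ0 hθ1 x j u (fun l => l = u ∨ l = k) (Or.inl rfl)
      (y := fun c => c.1.1) (by fun_prop) (hz hS)
    rw [ENNReal.ofReal_mul hC0]
    refine le_trans (measure_mono ?_) (hkey.trans (mul_le_mul' (hCle _ {u, k} (by simp)
      Finset.card_le_two) ?_))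
    · rintro q ⟨h1, h2, h3⟩
      exact ⟨h1, h2, h3⟩
    · have hmp : (Measure.pi fun _ : O => κ).map (fun r => (r u, r k)) = κ.prod κ := by
        rw [← Measure.infinitePi_eq_pi]
        exact Measure.infinitePi_map_eval_prod hku.symm
      have := measure_nearBy_linked_le h x
      rw [← hκ, ← hmp, Measure.map_apply (by fun_prop) hS] at this
      exact this
  have hsub : {q : (O → (𝕏 × I) × (𝕏 × I)) × (Sym2 O → I) |
      starDeg φ x (fun l => (q.1 l).1) = j ∧
      numFull φ j x (fun l => (q.1 l).1) q.2 ≠ numRest φ j (fun l => hybrid φ x (q.1 l)) q.2} ⊆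
      ⋃ u ∈ (Finset.univ : Finset O),
        (({q | starDeg φ x (fun l => (q.1 l).1) = j ∧ NearBy φ x (q.1 u) ∧
          farDeg φ x (q.1 u).1.1 q.1 q.2 u ≤ j} ∪
        {q | starDeg φ x (fun l => (q.1 l).1) = j ∧ NearBy φ x (q.1 u) ∧
          farDeg φ x (q.1 u).2.1 q.1 q.2 u ≤ j}) ∪
        ⋃ k ∈ Finset.univ.erase u, {q | starDeg φ x (fun l => (q.1 l).1) = j ∧
          farDeg φ x (q.1 u).1.1 q.1 q.2 u ≤ j ∧ NearBy φ x (q.1 k) ∧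
          (φ.Linked (q.1 u).1.1 ((q.1 k).1.1, q.2 s(u, k)) ∨
            φ.Linked (q.1 u).1.1 ((q.1 k).2.1, q.2 s(u, k)))}) := by
    rintro q ⟨hq, hne⟩
    obtain ⟨u, hu⟩ := exists_of_numFull_ne_numRest φ x j q.1 q.2 hne
    simp only [Set.mem_iUnion, Finset.mem_univ, exists_prop, true_and, Set.mem_union,
      Finset.mem_erase, and_true]
    refine ⟨u, ?_⟩
    rcases hu with hu | hu | ⟨k, hk, hu⟩
    · exact Or.inl (Or.inl ⟨hq, hu⟩)
    · exact Or.inl (Or.inr ⟨hq, hu⟩)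
    · exact Or.inr ⟨k, hk, hq, hu⟩
  refine (measure_mono hsub).trans ((measure_biUnion_finset_le _ _).trans ?_)
  have hu : ∀ u ∈ (Finset.univ : Finset O), coupledLaw μ O
      (({q | starDeg φ x (fun l => (q.1 l).1) = j ∧ NearBy φ x (q.1 u) ∧
          farDeg φ x (q.1 u).1.1 q.1 q.2 u ≤ j} ∪
        {q | starDeg φ x (fun l => (q.1 l).1) = j ∧ NearBy φ x (q.1 u) ∧
          farDeg φ x (q.1 u).2.1 q.1 q.2 u ≤ j}) ∪
        ⋃ k ∈ Finset.univ.erase u, {q | starDeg φ x (fun l => (q.1 l).1) = j ∧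
          farDeg φ x (q.1 u).1.1 q.1 q.2 u ≤ j ∧ NearBy φ x (q.1 k) ∧
          (φ.Linked (q.1 u).1.1 ((q.1 k).1.1, q.2 s(u, k)) ∨
            φ.Linked (q.1 u).1.1 ((q.1 k).2.1, q.2 s(u, k)))}) ≤
      ENNReal.ofReal (C * (2 * m) + C * (2 * m) + n * (C * (4 * m ^ 2))) := by
    intro u _
    rw [ENNReal.ofReal_add (by positivity) (by positivity),
      ENNReal.ofReal_add (by positivity) (by positivity)]
    refine (measure_union_le _ _).trans (add_le_add ((measure_union_le _ _).trans (add_le_add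
      (hself (fun c => c.1.1) (by fun_prop) u) (hself (fun c => c.2.1) (by fun_prop) u))) ?_)
    refine (measure_biUnion_finset_le _ _).trans ((Finset.sum_le_sum fun k hk =>
      hpair u k (Finset.ne_of_mem_erase hk)).trans ?_)
    rw [Finset.sum_const, nsmul_eq_mul, ENNReal.ofReal_mul (Nat.cast_nonneg n),
      ENNReal.ofReal_natCast]
    refine mul_le_mul' (Nat.cast_le.2 ?_) le_rfl
    exact (Finset.card_le_univ _)
  refine (Finset.sum_le_sum hu).trans (le_of_eq ?_)
  rw [Finset.sum_const, nsmul_eq_mul, Finset.card_univ, ← hn, ← ENNReal.ofReal_natCast,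
    ← ENNReal.ofReal_mul (Nat.cast_nonneg n)]
  congr 1
  rw [decouplingError, ← hC]
  ring

lemma measurableSet_starDeg (φ : ConnectionFunction 𝕏) (x : 𝕏) (j : ℕ) :
    MeasurableSet {q : (O → 𝕏 × I) × (Sym2 O → I) | starDeg φ x q.1 = j} :=
  measurable_starDeg φ measurable_const measurable_fst (measurableSet_singleton j)

/-- Given that `x` has degree `j`, the number of other vertices of degree `j` has nearly the law of
the number of such vertices in the graph without `x`. -/
lemma abs_restLaw_sub_mul_le (h : Regular φ μ ε m) {θ : ℝ} (hθ0 : 0 < θ) (hθ1 : θ ≤ 1) (x : 𝕏)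
    (j k : ℕ) :
    |(restLaw μ O).real {q | starDeg φ x q.1 = j ∧ numFull φ j x q.1 q.2 = k} -
      (restLaw μ O).real {q | starDeg φ x q.1 = j} *
        (restLaw μ O).real {q | numRest φ j q.1 q.2 = k}| ≤
    decouplingError φ μ ε m θ j (Fintype.card O) x := by
  have hm := h.nonneg
  have h0 : 0 ≤ decouplingError φ μ ε m θ j (Fintype.card O) x := by
    unfold decouplingError; positivity
  have hmp : MeasurePreserving (Prod.map (fun (c : O → (𝕏 × I) × (𝕏 × I)) l => (c l).1) id)
      (coupledLaw μ O) (restLaw μ O) :=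
    (measurePreserving_pi _ _ fun _ => measurePreserving_fst).prod (MeasurePreserving.id _)
  have hA : MeasurableSet {q : (O → 𝕏 × I) × (Sym2 O → I) |
      starDeg φ x q.1 = j ∧ numFull φ j x q.1 q.2 = k} :=
    (measurableSet_starDeg φ x j).inter (measurable_numFull φ j measurable_const measurable_fst
      measurable_snd (measurableSet_singleton k))
  rw [← hmp.measureReal_preimage hA.nullMeasurableSet]
  have h2 : (restLaw μ O).real {q | starDeg φ x q.1 = j} *
      (restLaw μ O).real {q | numRest φ j q.1 q.2 = k} =
      (coupledLaw μ O).real {q | starDeg φ x (fun l => (q.1 l).1) = j ∧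
        numRest φ j (fun l => hybrid φ x (q.1 l)) q.2 = k} := by
    simp_rw [measureReal_def]
    rw [← ENNReal.toReal_mul, coupledLaw_hybrid]
  rw [h2]
  have hD : (coupledLaw μ O).real {q | starDeg φ x (fun l => (q.1 l).1) = j ∧
      numFull φ j x (fun l => (q.1 l).1) q.2 ≠ numRest φ j (fun l => hybrid φ x (q.1 l)) q.2} ≤
      decouplingError φ μ ε m θ j (Fintype.card O) x :=
    ENNReal.toReal_le_of_le_ofReal h0 (coupledLaw_numFull_ne_le h hθ0 hθ1 x j)
  rw [abs_sub_le_iff]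
  constructor
  · rw [sub_le_iff_le_add]
    refine (measureReal_mono ?_).trans ((measureReal_union_le _ _).trans (add_le_add_left hD _))
    rintro q ⟨h1, h3⟩
    by_cases hne : numFull φ j x (fun l => (q.1 l).1) q.2 =
        numRest φ j (fun l => hybrid φ x (q.1 l)) q.2
    · exact Or.inr ⟨h1, hne ▸ h3⟩
    · exact Or.inl ⟨h1, hne⟩
  · rw [sub_le_iff_le_add]
    refine (measureReal_mono ?_).trans ((measureReal_union_le _ _).trans (add_le_add_left hD _))
    rintro q ⟨h1, h3⟩
    by_cases hne : numFull φ j x (fun l => (q.1 l).1) q.2 =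
        numRest φ j (fun l => hybrid φ x (q.1 l)) q.2
    · exact Or.inr ⟨h1, hne.trans h3⟩
    · exact Or.inl ⟨h1, hne⟩

/-- Adding a vertex at `x` affects the count of the other vertices of degree `j` only if `x` is linked
to a vertex of degree at most `j`. -/
lemma restLaw_numFull_ne_le (h : Regular φ μ ε m) {θ : ℝ} (hθ0 : 0 < θ) (hθ1 : θ ≤ 1) (x : 𝕏)
    (j : ℕ) :
    (restLaw μ O).real {q | numFull φ j x q.1 q.2 ≠ numRest φ j q.1 q.2} ≤
      removalError ε m θ j (Fintype.card O) := by
  classical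
  have hm := h.nonneg
  have hε := h.pos
  set n := Fintype.card O with hn
  set C : ℝ := (θ ^ j)⁻¹ * Real.exp (-((1 - θ) * (ε * m) * (n - 1))) with hC
  have hC0 : 0 ≤ C := by positivity
  have h0 : 0 ≤ removalError ε m θ j n := by unfold removalError; positivity
  refine ENNReal.toReal_le_of_le_ofReal h0 ?_
  have hu : ∀ u ∈ (Finset.univ : Finset O), restLaw μ O
      {q | φ.Linked x (q.1 u) ∧ restDeg φ q.1 q.2 u ≤ j} ≤ ENNReal.ofReal (C * m) := by
    intro u _
    have hK : MeasurableSet {z : {l // l = u} → (𝕏 × I) × I | φ.Linked x (z ⟨u, rfl⟩).1} :=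
      φ.measurableSet_linked measurable_const (by fun_prop)
    have hB : MeasurableSet {q : ({l // l = u} → (𝕏 × I) × I) × ((𝕏 × I) × I) |
        q.2 ∈ {r : (𝕏 × I) × I | φ.Linked (q.1 ⟨u, rfl⟩).1.1 (r.1.1, r.2)}} :=
      φ.measurableSet_linked (by fun_prop) (by fun_prop)
    have hB' : ∀ y, ε * m ≤ ((μ.prod (volume : Measure I)).prod (volume : Measure I)).real
        {r | φ.Linked y (r.1.1, r.2)} := by
      intro y
      have hmp : MeasurePreserving (fun r : (𝕏 × I) × I => (r.1.1, r.2))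
          ((μ.prod (volume : Measure I)).prod (volume : Measure I)) (μ.prod volume) :=
        measurePreserving_fst.prod (MeasurePreserving.id _)
      have := hmp.measureReal_preimage (φ.measurableSet_linked (f := fun _ => y) measurable_const
        measurable_id).nullMeasurableSet
      rw [show {r : (𝕏 × I) × I | φ.Linked y (r.1.1, r.2)} =
        (fun r : (𝕏 × I) × I => (r.1.1, r.2)) ⁻¹' {a | φ.Linked y (id a)} from rfl, this]
      exact (h.ge y).trans_eq (φ.measureReal_linked μ y).symm
    have hkey := pi_inter_card_le (ι := O) ((μ.prod (volume : Measure I)).prod (volume : Measure I))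
      (fun l => l = u) hK hB hθ0 hθ1 (fun z => hB' (z ⟨u, rfl⟩).1.1) j
    have hstar := measurePreserving_star (μ.prod (volume : Measure I)) u
    rw [ENNReal.ofReal_mul hC0]
    rw [← hstar.map_eq] at hkey
    refine (measure_mono ?_).trans ((Measure.le_map_apply hstar.measurable.aemeasurable _).trans
      (hkey.trans (mul_le_mul' ?_ ?_)))
    · rintro q ⟨h1, h2⟩
      exact ⟨h1, h2⟩
    · refine ENNReal.ofReal_le_ofReal (mul_le_mul_of_nonneg_left (Real.exp_le_exp.2
        (neg_le_neg (mul_le_mul_of_nonneg_left ?_ (mul_nonneg (by linarith) (by positivity)))))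
        (by positivity))
      have := card_le_card_compl_add (p := fun l => l = u) (s := {u}) (by simp)
      simpa using this
    · rw [hstar.map_eq]
      have hmp : MeasurePreserving (fun r : O → (𝕏 × I) × I => (r u).1)
          (Measure.pi fun _ => (μ.prod (volume : Measure I)).prod (volume : Measure I))
          (μ.prod (volume : Measure I)) :=
        measurePreserving_fst.comp
          (measurePreserving_eval (fun _ : O => (μ.prod (volume : Measure I)).prod volume) u)
      refine (hmp.measure_preimage (φ.measurableSet_linked (f := fun _ => x) measurable_const
        measurable_id).nullMeasurableSet).trans_le ?_
      exact (φ.measure_linked μ x).trans_le (ENNReal.ofReal_le_ofReal (h.le x))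
  have hsub : {q : (O → 𝕏 × I) × (Sym2 O → I) | numFull φ j x q.1 q.2 ≠ numRest φ j q.1 q.2} ⊆
      ⋃ u ∈ (Finset.univ : Finset O), {q | φ.Linked x (q.1 u) ∧ restDeg φ q.1 q.2 u ≤ j} := by
    intro q hq
    by_contra hcon
    simp only [Set.mem_iUnion, Finset.mem_univ, exists_prop, true_and, not_exists,
      Set.mem_ofPred_eq, not_and, not_le] at hcon
    refine hq ?_
    unfold numFull numRest
    congr 1
    ext u
    simp only [Finset.mem_filter, Finset.mem_univ, true_and]
    by_cases hl : φ.Linked x (q.1 u)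
    · have := hcon u hl
      rw [if_pos hl]
      constructor <;> intro _ <;> omega
    · simp [hl]
  refine (measure_mono hsub).trans ((measure_biUnion_finset_le _ _).trans
    ((Finset.sum_le_sum hu).trans (le_of_eq ?_)))
  rw [Finset.sum_const, nsmul_eq_mul, Finset.card_univ, ← hn, ← ENNReal.ofReal_natCast,
    ← ENNReal.ofReal_mul (Nat.cast_nonneg n), removalError]

end Decoupling

/-! ### The Stein-Chen recursion for the binomial model -/

section Recursion

lemma measureReal_prod_eq_integral {α β : Type*} [MeasurableSpace α] [MeasurableSpace β]
    (μ : Measure α) (ν : Measure β) [IsProbabilityMeasure μ] [IsProbabilityMeasure ν]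
    {S : Set (α × β)} (hS : MeasurableSet S) :
    (μ.prod ν).real S = ∫ x, ν.real (Prod.mk x ⁻¹' S) ∂μ := by
  simp_rw [measureReal_def]
  rw [Measure.prod_apply hS, integral_toReal (measurable_measure_prodMk_left hS).aemeasurable
    (ae_of_all _ fun x => measure_lt_top _ _)]

lemma integrable_measureReal_section {α β : Type*} [MeasurableSpace α] [MeasurableSpace β]
    (μ : Measure α) (ν : Measure β) [IsProbabilityMeasure μ] [IsProbabilityMeasure ν]
    {S : Set (α × β)} (hS : MeasurableSet S) :
    Integrable (fun x => ν.real (Prod.mk x ⁻¹' S)) μ :=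
  Integrable.of_bound (measurable_measure_prodMk_left hS).ennreal_toReal.aestronglyMeasurable 1
    (ae_of_all _ fun x => by
      rw [Real.norm_eq_abs, abs_of_nonneg measureReal_nonneg]; exact measureReal_le_one)

variable {𝕏 : Type*} [MeasurableSpace 𝕏]

/-- The probability that a given vertex has degree `i`, if there are `n` other vertices. -/
noncomputable def degProb (φ : ConnectionFunction 𝕏) (μ : Measure 𝕏) (n i : ℕ) : ℝ :=
  ∫ x, n.choose i * φ.meanDeg μ x ^ i * (1 - φ.meanDeg μ x) ^ (n - i) ∂μ

lemma measureReal_starDeg_eq {O : Type*} [Fintype O] (φ : ConnectionFunction 𝕏) (μ : Measure 𝕏)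
    [IsProbabilityMeasure μ] (x : 𝕏) (i : ℕ) :
    (restLaw μ O).real {q | starDeg φ x q.1 = i} =
      (Fintype.card O).choose i * φ.meanDeg μ x ^ i *
        (1 - φ.meanDeg μ x) ^ (Fintype.card O - i) := by
  classical
  have hm : MeasurableSet {a : O → 𝕏 × I | starDeg φ x a = i} :=
    measurable_starDeg φ measurable_const measurable_id (measurableSet_singleton i)
  have h1 : restLaw μ O {q | starDeg φ x q.1 = i} =
      Measure.pi (fun _ : O => μ.prod (volume : Measure I)) {a | starDeg φ x a = i} :=
    (measurePreserving_fst (μ := Measure.pi fun _ : O => μ.prod (volume : Measure I))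
      (ν := Measure.pi fun _ : Sym2 O => (volume : Measure I))).measure_preimage
      hm.nullMeasurableSet
  have h2 := pi_card_eq (ι := O) (μ.prod (volume : Measure I))
    (φ.measurableSet_linked (f := fun _ => x) measurable_const measurable_id) i
  have h3 : {r : O → 𝕏 × I | (Finset.univ.filter fun l => r l ∈ {b | φ.Linked x (id b)}).card = i} =
      {a | starDeg φ x a = i} := by
    ext a
    simp only [starDeg, Set.mem_ofPred_eq, id]
  have h4 : (μ.prod (volume : Measure I)).real {b | φ.Linked x (id b)} = φ.meanDeg μ x :=
    φ.measureReal_linked μ x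
  rw [h3, h4] at h2
  rw [measureReal_def, h1, h2, ENNReal.toReal_ofReal]
  have e1 := φ.meanDeg_nonneg μ x
  have e2 := φ.meanDeg_le_one μ x
  have e3 : 0 ≤ 1 - φ.meanDeg μ x := by linarith
  positivity

lemma IsMarkedSample.measurable_points {Ω : Type*} [MeasurableSpace Ω] {μ : Measure 𝕏}
    {P : Measure Ω} {X : ℕ → Ω → 𝕏} {T : ℕ → Ω → ℕ → I} {Z : ℝ≥0 → Ω → ℕ}
    (h : IsMarkedSample μ P X T Z) : Measurable fun ω i => X i ω :=
  measurable_pi_iff.2 h.measurable_point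

lemma IsMarkedSample.measurable_marks {Ω : Type*} [MeasurableSpace Ω] {μ : Measure 𝕏}
    {P : Measure Ω} {X : ℕ → Ω → 𝕏} {T : ℕ → Ω → ℕ → I} {Z : ℝ≥0 → Ω → ℕ}
    (h : IsMarkedSample μ P X T Z) : Measurable fun ω i => T i ω :=
  measurable_pi_iff.2 h.measurable_mark

variable {Ω : Type*} [MeasurableSpace Ω] {μ : Measure 𝕏} [IsProbabilityMeasure μ]
  {P : Measure Ω} [IsProbabilityMeasure P] {X : ℕ → Ω → 𝕏} {T : ℕ → Ω → ℕ → I}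
  {Z : ℝ≥0 → Ω → ℕ}

lemma measurable_starDeg_view (φ : ConnectionFunction 𝕏) {O : Type*} [Fintype O] :
    Measurable fun w : 𝕏 × (O → 𝕏 × I) × (Sym2 O → I) => starDeg φ w.1 w.2.1 :=
  measurable_starDeg φ measurable_fst measurable_snd.fst

lemma measurable_numFull_view (φ : ConnectionFunction 𝕏) (j : ℕ) {O : Type*} [Fintype O] :
    Measurable fun w : 𝕏 × (O → 𝕏 × I) × (Sym2 O → I) => numFull φ j w.1 w.2.1 w.2.2 :=
  measurable_numFull φ j measurable_fst measurable_snd.fst measurable_snd.snd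

lemma measurable_viewFrom {β : Type*} [MeasurableSpace β] {n : ℕ} (v : Fin (n + 1))
    {x : β → ℕ → 𝕏} {t : β → ℕ → ℕ → I} (hx : Measurable x) (ht : Measurable t) :
    Measurable fun b => viewFrom v (x b) (t b) := by
  unfold viewFrom
  fun_prop

open Classical in
lemma measurable_degree_irg {β : Type*} [MeasurableSpace β] (φ : ConnectionFunction 𝕏) {n : ℕ}
    (v : Fin n) {x : β → ℕ → 𝕏} {t : β → ℕ → ℕ → I} (hx : Measurable x) (ht : Measurable t) :
    Measurable fun b => (irg φ n (x b) (t b)).degree v := by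
  cases n with
  | zero => exact v.elim0
  | succ n =>
    simp_rw [degree_irg_self]
    exact (measurable_starDeg_view φ).comp (measurable_viewFrom v hx ht)

lemma measurable_numDeg_irg {β : Type*} [MeasurableSpace β] (φ : ConnectionFunction 𝕏) (n j : ℕ)
    {x : β → ℕ → 𝕏} {t : β → ℕ → ℕ → I} (hx : Measurable x) (ht : Measurable t) :
    Measurable fun b => numDeg (irg φ n (x b) (t b)) j := by
  classical
  simp_rw [numDeg, Finset.card_filter]
  refine Finset.measurable_sum _ fun v _ => Measurable.ite ?_ measurable_const measurable_const
  exact measurable_degree_irg φ v hx ht (measurableSet_singleton j)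

open Classical in
lemma measureReal_degree_eq (h : IsMarkedSample μ P X T Z) (φ : ConnectionFunction 𝕏) {n : ℕ}
    (v : Fin (n + 1)) (i : ℕ) :
    P.real {ω | (irg φ (n + 1) (X · ω) (T · ω)).degree v = i} = degProb φ μ n i := by
  have hS : MeasurableSet {w : 𝕏 × (Fin n → 𝕏 × I) × (Sym2 (Fin n) → I) |
      starDeg φ w.1 w.2.1 = i} := measurable_starDeg_view φ (measurableSet_singleton i)
  have := (map_viewFrom h v).measureReal_preimage hS.nullMeasurableSet
  simp_rw [degree_irg_self]
  refine this.trans ?_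
  rw [measureReal_prod_eq_integral _ _ hS, degProb]
  refine integral_congr_ae (ae_of_all _ fun x => ?_)
  have := measureReal_starDeg_eq (O := Fin n) φ μ x i
  rw [Fintype.card_fin] at this
  exact this

lemma lintegral_numDeg_irg (h : IsMarkedSample μ P X T Z) (φ : ConnectionFunction 𝕏) (n i : ℕ) :
    ∫⁻ ω, (numDeg (irg φ (n + 1) (X · ω) (T · ω)) i : ENNReal) ∂P =
      ENNReal.ofReal ((n + 1) * degProb φ μ n i) := by
  classical
  have h1 : ∀ ω, (numDeg (irg φ (n + 1) (X · ω) (T · ω)) i : ENNReal) =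
      ∑ v : Fin (n + 1), {ω | (irg φ (n + 1) (X · ω) (T · ω)).degree v = i}.indicator 1 ω := by
    intro ω
    rw [numDeg, Finset.card_filter]
    push_cast
    refine Finset.sum_congr rfl fun v _ => ?_
    simp [Set.indicator_apply]
  have hm : ∀ v : Fin (n + 1), MeasurableSet {ω | (irg φ (n + 1) (X · ω) (T · ω)).degree v = i} :=
    fun v => measurable_degree_irg φ v h.measurable_points h.measurable_marks
      (measurableSet_singleton i)
  simp_rw [h1]
  rw [lintegral_finsetSum _ fun v _ => measurable_one.indicator (hm v)]
  simp_rw [lintegral_indicator_one (hm _)]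
  have h2 : ∀ v : Fin (n + 1), P {ω | (irg φ (n + 1) (X · ω) (T · ω)).degree v = i} =
      ENNReal.ofReal (degProb φ μ n i) := by
    intro v
    rw [← measureReal_degree_eq h φ v i, ofReal_measureReal]
  simp_rw [h2]
  rw [Finset.sum_const, Finset.card_univ, Fintype.card_fin, nsmul_eq_mul,
    ENNReal.ofReal_mul (by positivity)]
  congr 1
  rw [← Nat.cast_succ, ENNReal.ofReal_natCast]

open Classical in
/-- Double counting of the vertices of degree `j`. -/
lemma succ_mul_measureReal_numDeg {μ : Measure 𝕏} (h : IsMarkedSample μ P X T Z)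
    (φ : ConnectionFunction 𝕏) (n j k : ℕ) :
    (k + 1) * P.real {ω | numDeg (irg φ (n + 1) (X · ω) (T · ω)) j = k + 1} =
      ∑ v : Fin (n + 1), P.real {ω | (irg φ (n + 1) (X · ω) (T · ω)).degree v = j ∧
        numDeg (irg φ (n + 1) (X · ω) (T · ω)) j = k + 1} := by
  have hE : MeasurableSet {ω | numDeg (irg φ (n + 1) (X · ω) (T · ω)) j = k + 1} :=
    measurable_numDeg_irg φ (n + 1) j h.measurable_points h.measurable_marks
      (measurableSet_singleton _)
  have hm : ∀ v : Fin (n + 1), MeasurableSet {ω | (irg φ (n + 1) (X · ω) (T · ω)).degree v = j ∧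
      numDeg (irg φ (n + 1) (X · ω) (T · ω)) j = k + 1} :=
    fun v => (measurable_degree_irg φ v h.measurable_points h.measurable_marks
      (measurableSet_singleton j)).inter hE
  have h1 : ∀ v : Fin (n + 1), P.real {ω | (irg φ (n + 1) (X · ω) (T · ω)).degree v = j ∧
      numDeg (irg φ (n + 1) (X · ω) (T · ω)) j = k + 1} =
      ∫ ω, {ω | (irg φ (n + 1) (X · ω) (T · ω)).degree v = j ∧
        numDeg (irg φ (n + 1) (X · ω) (T · ω)) j = k + 1}.indicator (fun _ => (1 : ℝ)) ω ∂P :=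
    fun v => (integral_indicator_one (μ := P) (hm v)).symm
  simp_rw [h1]
  rw [← integral_finsetSum _ fun v _ => (integrable_const (1 : ℝ)).indicator (hm v),
    ← integral_indicator_one (μ := P) hE, ← integral_const_mul]
  refine integral_congr_ae (ae_of_all _ fun ω => ?_)
  by_cases hω : numDeg (irg φ (n + 1) (X · ω) (T · ω)) j = k + 1
  · have h2 : ∀ v : Fin (n + 1), ({ω | (irg φ (n + 1) (X · ω) (T · ω)).degree v = j ∧
        numDeg (irg φ (n + 1) (X · ω) (T · ω)) j = k + 1}.indicator (fun _ => (1 : ℝ)) ω) =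
        if (irg φ (n + 1) (X · ω) (T · ω)).degree v = j then 1 else 0 := by
      intro v
      simp [Set.indicator_apply, hω]
    simp only [h2]
    rw [Finset.sum_boole]
    have h3 : ({ω | numDeg (irg φ (n + 1) (X · ω) (T · ω)) j = k + 1}.indicator 1 ω : ℝ) = 1 := by
      simp [hω]
    rw [h3, mul_one]
    have : ((numDeg (irg φ (n + 1) (X · ω) (T · ω)) j : ℕ) : ℝ) = k + 1 := by
      rw [hω]; push_cast; rfl
    rw [← this]
    rfl
  · simp [hω]

lemma Regular.eps_le_one {φ : ConnectionFunction 𝕏} {ε m : ℝ} (h : Regular φ μ ε m) : ε ≤ 1 := by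
  obtain ⟨x⟩ : Nonempty 𝕏 := nonempty_of_isProbabilityMeasure μ
  linarith [φ.nonneg x x, h.bound x x]

/-- The choice `θ = ε ^ 2 / 8` makes the exponent beat `n * φ.meanDeg μ x` by a multiple of `n m`, so
that the integral over `x` is of the order of the expected number of isolated vertices times a
factor tending to zero. -/
lemma decouplingError_le {φ : ConnectionFunction 𝕏} {ε m : ℝ} (h : Regular φ μ ε m) (j n : ℕ)
    (x : 𝕏) :
    decouplingError φ μ ε m (ε ^ 2 / 8) j n x ≤
      ((ε ^ 2 / 8) ^ (2 * j))⁻¹ * Real.exp 2 * Real.exp (-(ε ^ 2 / 4 * (n * m))) *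
        (4 * (n * m) + 4 * (n * m) ^ 2) * Real.exp (-(n * φ.meanDeg μ x)) := by
  have hm := h.nonneg
  have hε := h.pos
  have hε1 := h.eps_le_one
  have hl0 := φ.meanDeg_nonneg μ x
  have hl := h.le x
  have hh := h.le_half
  set l := φ.meanDeg μ x
  have hn : (0 : ℝ) ≤ n := Nat.cast_nonneg n
  have hε2 : ε ^ 2 ≤ 1 := by nlinarith
  have hexp : -((1 - ε ^ 2 / 8) * (l + ε ^ 2 * m / 2) * (n - 2)) ≤
      2 + -(ε ^ 2 / 4 * (n * m)) + -(n * l) := by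
    have hnm : 0 ≤ (n : ℝ) * m := by positivity
    have e1 : ε ^ 2 / 8 * (n * l) ≤ ε ^ 2 / 8 * (n * m) := by gcongr
    have e2 : 7 / 16 * ε ^ 2 * (n * m) ≤ (1 - ε ^ 2 / 8) * (ε ^ 2 / 2) * (n * m) := by
      refine mul_le_mul_of_nonneg_right ?_ hnm
      nlinarith [sq_nonneg ε]
    have e3 : (1 - ε ^ 2 / 8) * (l + ε ^ 2 * m / 2) ≤ 1 := by
      have : l + ε ^ 2 * m / 2 ≤ 1 := by nlinarith
      have h0 : 0 ≤ l + ε ^ 2 * m / 2 := by positivity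
      nlinarith [sq_nonneg ε]
    nlinarith [mul_nonneg (sq_nonneg ε) hnm]
  unfold decouplingError
  calc _ ≤ ((ε ^ 2 / 8) ^ (2 * j))⁻¹ *
        Real.exp (2 + -(ε ^ 2 / 4 * (n * m)) + -(n * l)) *
        (4 * n * m + 4 * n ^ 2 * m ^ 2) := by gcongr
    _ = _ := by
      rw [Real.exp_add, Real.exp_add]
      ring

/-- The Stein-Chen recursion: the probabilities `p k` that there are `k` vertices of degree `j`
satisfy `(k + 1) * p (k + 1) ≈ E * p k`, where `E` is the expected number of such vertices. -/
lemma abs_succ_mul_sub_le (h : IsMarkedSample μ P X T Z) {φ : ConnectionFunction 𝕏} {ε m : ℝ}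
    (hφ : Regular φ μ ε m) (n j k : ℕ) :
    |(k + 1) * P.real {ω | numDeg (irg φ (n + 1) (X · ω) (T · ω)) j = k + 1} -
      (n + 1) * degProb φ μ n j * P.real {ω | numDeg (irg φ (n + 1) (X · ω) (T · ω)) j = k}| ≤
    ((ε ^ 2 / 8) ^ (2 * j))⁻¹ * Real.exp 2 * Real.exp (-(ε ^ 2 / 4 * (n * m))) *
        (4 * (n * m) + 4 * (n * m) ^ 2) * ((n + 1) * ∫ x, Real.exp (-(n * φ.meanDeg μ x)) ∂μ) +
      (n + 1) * degProb φ μ n j * (degProb φ μ n j + removalError ε m (ε ^ 2 / 8) j n) := by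
  classical
  have hm := hφ.nonneg
  have hε := hφ.pos
  have hε1 := hφ.eps_le_one
  have hθ0 : 0 < ε ^ 2 / 8 := by positivity
  have hθ1 : ε ^ 2 / 8 ≤ 1 := by nlinarith
  let Q := restLaw μ (Fin n)
  let W := 𝕏 × (Fin n → 𝕏 × I) × (Sym2 (Fin n) → I)
  let r : ℝ := Q.real {q | numRest φ j q.1 q.2 = k}
  let K : ℝ := ((ε ^ 2 / 8) ^ (2 * j))⁻¹ * Real.exp 2 * Real.exp (-(ε ^ 2 / 4 * (n * m))) *
        (4 * (n * m) + 4 * (n * m) ^ 2)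
  let E : ℝ := ∫ x, Real.exp (-(n * φ.meanDeg μ x)) ∂μ
  let β := degProb φ μ n j
  have hA : MeasurableSet {w : W | starDeg φ w.1 w.2.1 = j} :=
    measurable_starDeg_view φ (measurableSet_singleton j)
  have hAF : MeasurableSet {w : W | starDeg φ w.1 w.2.1 = j ∧ numFull φ j w.1 w.2.1 w.2.2 = k} :=
    hA.inter (measurable_numFull_view φ j (measurableSet_singleton k))
  have hF : MeasurableSet {w : W | (if starDeg φ w.1 w.2.1 = j then 1 else 0) +
      numFull φ j w.1 w.2.1 w.2.2 = k} :=
    ((Measurable.ite hA measurable_const measurable_const).add (measurable_numFull_view φ j))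
      (measurableSet_singleton k)
  have hβ : ∫ x, Q.real {q | starDeg φ x q.1 = j} ∂μ = β := by
    refine integral_congr_ae (ae_of_all _ fun x => ?_)
    have := measureReal_starDeg_eq (O := Fin n) φ μ x j
    rw [Fintype.card_fin] at this
    exact this
  have hAint : Integrable (fun x => Q.real {q | starDeg φ x q.1 = j}) μ :=
    integrable_measureReal_section μ Q hA
  have hAFint : Integrable
      (fun x => Q.real {q | starDeg φ x q.1 = j ∧ numFull φ j x q.1 q.2 = k}) μ :=
    integrable_measureReal_section μ Q hAF
  have hFint : Integrable (fun x => Q.real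
      {q | (if starDeg φ x q.1 = j then 1 else 0) + numFull φ j x q.1 q.2 = k}) μ :=
    integrable_measureReal_section μ Q hF
  have hβ0 : 0 ≤ β := by rw [← hβ]; exact integral_nonneg fun x => measureReal_nonneg
  have hEint : Integrable (fun x => Real.exp (-(n * φ.meanDeg μ x))) μ := by
    refine Integrable.of_bound ?_ 1 (ae_of_all _ fun x => ?_)
    · exact (Real.measurable_exp.comp
        ((φ.measurable_meanDeg μ).const_mul _).neg).aestronglyMeasurable
    · rw [Real.norm_eq_abs, abs_of_pos (Real.exp_pos _), Real.exp_le_one_iff]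
      have := φ.meanDeg_nonneg μ x
      have : (0 : ℝ) ≤ n * φ.meanDeg μ x := by positivity
      linarith
  -- each vertex contributes about `β * r`
  have hv : ∀ v : Fin (n + 1), |P.real {ω | (irg φ (n + 1) (X · ω) (T · ω)).degree v = j ∧
        numDeg (irg φ (n + 1) (X · ω) (T · ω)) j = k + 1} - β * r| ≤ K * E := by
    intro v
    have e1 : P.real {ω | (irg φ (n + 1) (X · ω) (T · ω)).degree v = j ∧
        numDeg (irg φ (n + 1) (X · ω) (T · ω)) j = k + 1} =
        ∫ x, Q.real {q | starDeg φ x q.1 = j ∧ numFull φ j x q.1 q.2 = k} ∂μ := by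
      refine Eq.trans ?_ (measureReal_prod_eq_integral μ Q hAF)
      rw [← (map_viewFrom h v).measureReal_preimage hAF.nullMeasurableSet]
      congr 1
      ext ω
      simp only [Set.mem_ofPred_eq, Set.mem_preimage]
      rw [degree_irg_self, numDeg_irg φ v]
      refine and_congr_right fun hd => ?_
      rw [if_pos hd]
      omega
    rw [e1, ← hβ, ← integral_mul_const, ← integral_sub hAFint
      (hAint.mul_const r), ← integral_const_mul]
    refine (abs_integral_le_integral_abs).trans (integral_mono
      (hAFint.sub (hAint.mul_const r)).abs
      (hEint.const_mul K) fun x => ?_)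
    refine (abs_restLaw_sub_mul_le hφ hθ0 hθ1 x j k).trans ?_
    rw [Fintype.card_fin]
    exact decouplingError_le hφ j n x
  -- removing a vertex hardly changes the law of the count
  have hr : |P.real {ω | numDeg (irg φ (n + 1) (X · ω) (T · ω)) j = k} - r| ≤
      β + removalError ε m (ε ^ 2 / 8) j n := by
    have e1 : P.real {ω | numDeg (irg φ (n + 1) (X · ω) (T · ω)) j = k} =
        ∫ x, Q.real {q | (if starDeg φ x q.1 = j then 1 else 0) + numFull φ j x q.1 q.2 = k} ∂μ := by
      refine Eq.trans ?_ (measureReal_prod_eq_integral μ Q hF)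
      rw [← (map_viewFrom h 0).measureReal_preimage hF.nullMeasurableSet]
      congr 1
      ext ω
      simp only [Set.mem_ofPred_eq, Set.mem_preimage]
      rw [numDeg_irg φ 0]
      exact Iff.rfl
    have e2 : r = ∫ _x, r ∂μ := by simp
    have e3 : removalError ε m (ε ^ 2 / 8) j n = ∫ _x, removalError ε m (ε ^ 2 / 8) j n ∂μ := by
      simp
    rw [e1, e2, ← hβ, e3, ← integral_sub hFint
      (integrable_const r), ← integral_add hAint (integrable_const _)]
    refine (abs_integral_le_integral_abs).trans (integral_mono
      (hFint.sub (integrable_const r)).abs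
      (hAint.add (integrable_const _)) fun x => ?_)
    have hne := restLaw_numFull_ne_le (O := Fin n) hφ hθ0 hθ1 x j
    rw [Fintype.card_fin] at hne
    refine le_trans ?_ (add_le_add_right hne _)
    have hu := measureReal_union_le (μ := Q) {q | starDeg φ x q.1 = j}
      {q | numFull φ j x q.1 q.2 ≠ numRest φ j q.1 q.2}
    refine le_trans ?_ hu
    rw [abs_sub_le_iff]
    constructor
    · rw [sub_le_iff_le_add]
      refine (measureReal_mono ?_).trans (measureReal_union_le _ _)
      intro q hq
      by_cases h1 : starDeg φ x q.1 = j
      · exact Or.inl (Or.inl h1)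
      by_cases h2 : numFull φ j x q.1 q.2 = numRest φ j q.1 q.2
      · refine Or.inr ?_
        simpa [h1, h2] using hq
      · exact Or.inl (Or.inr h2)
    · rw [sub_le_iff_le_add]
      refine (measureReal_mono ?_).trans (measureReal_union_le _ _)
      intro q hq
      by_cases h1 : starDeg φ x q.1 = j
      · exact Or.inl (Or.inl h1)
      by_cases h2 : numFull φ j x q.1 q.2 = numRest φ j q.1 q.2
      · refine Or.inr ?_
        simpa [h1, h2] using hq
      · exact Or.inl (Or.inr h2)
  rw [succ_mul_measureReal_numDeg h φ n j k]
  have hsum : |∑ v : Fin (n + 1), P.real {ω | (irg φ (n + 1) (X · ω) (T · ω)).degree v = j ∧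
        numDeg (irg φ (n + 1) (X · ω) (T · ω)) j = k + 1} - (n + 1) * β * r| ≤
      K * ((n + 1) * E) := by
    have : (n + 1) * β * r = ∑ _v : Fin (n + 1), β * r := by
      simp; ring
    rw [this, ← Finset.sum_sub_distrib]
    refine (Finset.abs_sum_le_sum_abs _ _).trans ((Finset.sum_le_sum fun v _ => hv v).trans ?_)
    simp
    linarith
  have hn : (0 : ℝ) ≤ (n + 1) * β := by positivity
  calc _ = |(∑ v : Fin (n + 1), P.real {ω | (irg φ (n + 1) (X · ω) (T · ω)).degree v = j ∧
        numDeg (irg φ (n + 1) (X · ω) (T · ω)) j = k + 1} - (n + 1) * β * r) -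
        (n + 1) * β * (P.real {ω | numDeg (irg φ (n + 1) (X · ω) (T · ω)) j = k} - r)| := by
        congr 1; ring
    _ ≤ _ := abs_sub _ _
    _ ≤ _ := by
      rw [abs_mul, abs_of_nonneg hn]
      exact add_le_add hsum (mul_le_mul_of_nonneg_left hr hn)

end Recursion

/-! ### From the recursion to the Poisson limit -/

section PoissonLimit

/-- Sub-probability weights `p i` which asymptotically satisfy the recursion of the Poisson weights
and whose tails are uniformly small converge to the Poisson weights. -/
lemma tendsto_poisson_of_recursion {ι : Type*} {l : Filter ι} {p : ι → ℕ → ℝ} {α C : ℝ}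
    (hp0 : ∀ i k, 0 ≤ p i k) (hp1 : ∀ i K, ∑ k ∈ Finset.range K, p i k ≤ 1)
    (htail : ∀ᶠ i in l, ∀ K : ℕ, 0 < K → 1 - C / K ≤ ∑ k ∈ Finset.range K, p i k)
    (hrec : ∀ k : ℕ, Tendsto (fun i => (k + 1) * p i (k + 1) - α * p i k) l (𝓝 0)) (k : ℕ) :
    Tendsto (fun i => p i k) l (𝓝 (Real.exp (-α) * α ^ k / k.factorial)) := by
  -- all weights are determined by the weight at `0`
  have h1 : ∀ k : ℕ, Tendsto (fun i => p i k - p i 0 * (α ^ k / k.factorial)) l (𝓝 0) := by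
    intro k
    induction k with
    | zero => simpa using tendsto_const_nhds
    | succ k ih =>
      have hk : ((k : ℝ) + 1) ≠ 0 := by positivity
      have h := ((hrec k).add (ih.const_mul α)).mul_const ((k : ℝ) + 1)⁻¹
      simp only [mul_zero, add_zero, zero_mul] at h
      refine h.congr fun i => ?_
      have hf : (k.factorial : ℝ) ≠ 0 := by positivity
      rw [Nat.factorial_succ]
      push_cast
      field_simp
      ring
  have h2 : ∀ K : ℕ, Tendsto (fun i => ∑ k ∈ Finset.range K, p i k -
      p i 0 * ∑ k ∈ Finset.range K, α ^ k / k.factorial) l (𝓝 0) := by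
    intro K
    have h := tendsto_finsetSum (Finset.range K) fun k _ => h1 k
    simp only [Finset.sum_const_zero] at h
    refine h.congr fun i => ?_
    rw [Finset.sum_sub_distrib, Finset.mul_sum]
  have hexp : Tendsto (fun K : ℕ => ∑ k ∈ Finset.range K, α ^ k / k.factorial) atTop
      (𝓝 (Real.exp α)) := by
    rw [Real.exp_eq_exp_ℝ]
    exact (NormedSpace.expSeries_div_hasSum_exp α).tendsto_sum_nat
  have hp01 : ∀ i, p i 0 ≤ 1 := fun i => by simpa using hp1 i 1
  have h3 : Tendsto (fun i => p i 0 * Real.exp α) l (𝓝 1) := by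
    rw [Metric.tendsto_nhds]
    intro δ hδ
    have hCK : Tendsto (fun K : ℕ => C / (K : ℝ)) atTop (𝓝 0) :=
      tendsto_const_div_atTop_nhds_zero_nat C
    obtain ⟨K, ⟨hK1, hK2⟩, hK0⟩ := (((hCK.eventually_lt_const (show (0 : ℝ) < δ / 3 by positivity)).and
      (Metric.tendsto_nhds.1 hexp (δ / 3) (by positivity))).and (eventually_gt_atTop 0)).exists
    filter_upwards [htail, Metric.tendsto_nhds.1 (h2 K) (δ / 3) (by positivity)] with i hi1 hi2
    have hi1 := hi1 K hK0
    have hi3 := hp1 i K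
    rw [Real.dist_eq, abs_lt] at hK2 hi2 ⊢
    have h0 := hp0 i 0
    have h01 := hp01 i
    have e1 : p i 0 * (∑ k ∈ Finset.range K, α ^ k / k.factorial - Real.exp α) ≤ δ / 3 := by
      nlinarith
    have e2 : -(δ / 3) ≤ p i 0 * (∑ k ∈ Finset.range K, α ^ k / k.factorial - Real.exp α) := by
      nlinarith
    constructor <;> nlinarith
  have h4 : Tendsto (fun i => p i 0) l (𝓝 (Real.exp (-α))) := by
    have h := h3.mul_const (Real.exp (-α))
    rw [one_mul] at h
    refine h.congr fun i => ?_
    rw [mul_assoc, ← Real.exp_add]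
    simp
  have h5 := (h1 k).add (h4.mul_const (α ^ k / k.factorial))
  rw [zero_add] at h5
  rw [mul_div_assoc]
  refine h5.congr fun i => ?_
  ring

lemma sum_range_measureReal_eq {Ω : Type*} [MeasurableSpace Ω] (P : Measure Ω)
    [IsProbabilityMeasure P] {W : Ω → ℕ} (hW : Measurable W) (K : ℕ) :
    ∑ k ∈ Finset.range K, P.real {ω | W ω = k} = P.real {ω | W ω < K} := by
  rw [← measureReal_biUnion_finset]
  · congr 1
    ext ω
    simp
  · intro a _ b _ hab
    exact Set.disjoint_left.2 fun ω h1 h2 => hab (h1.symm.trans h2)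
  · exact fun k _ => hW (measurableSet_singleton k)

/-- Markov's inequality for the lower bound on the tail sums in `tendsto_poisson_of_recursion`. -/
lemma one_sub_div_le_measureReal_lt {Ω : Type*} [MeasurableSpace Ω] (P : Measure Ω)
    [IsProbabilityMeasure P] {W : Ω → ℕ} (hW : Measurable W) {C : ℝ} (hC : 0 ≤ C)
    (hmean : ∫⁻ ω, (W ω : ENNReal) ∂P ≤ ENNReal.ofReal C) {K : ℕ} (hK : 0 < K) :
    1 - C / K ≤ P.real {ω | W ω < K} := by
  have hset : {ω | W ω < K} = {ω | K ≤ W ω}ᶜ := by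
    ext ω
    simp
  have hm : MeasurableSet {ω | K ≤ W ω} := hW measurableSet_Ici
  rw [hset, probReal_compl_eq_one_sub hm]
  have h := mul_meas_ge_le_lintegral (μ := P) (f := fun ω => (W ω : ENNReal))
    (measurable_from_nat.comp hW) K
  have h' : (K : ENNReal) * P {ω | K ≤ W ω} ≤ ENNReal.ofReal C := by
    refine le_trans (le_of_eq ?_) (h.trans hmean)
    simp
  have h2 := ENNReal.toReal_le_of_le_ofReal hC h'
  rw [ENNReal.toReal_mul, ENNReal.toReal_natCast] at h2
  have hK' : (0 : ℝ) < K := by exact_mod_cast hK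
  have : P.real {ω | K ≤ W ω} ≤ C / K := by
    rw [le_div_iff₀ hK', mul_comm]
    exact h2
  linarith

end PoissonLimit

/-! ### The Poisson limit for the binomial model -/

section BinomialLimit

variable {𝕏 : Type*} [MeasurableSpace 𝕏] {Ω : Type*} [MeasurableSpace Ω] {μ : Measure 𝕏}
  [IsProbabilityMeasure μ] {P : Measure Ω} [IsProbabilityMeasure P] {X : ℕ → Ω → 𝕏}
  {T : ℕ → Ω → ℕ → I} {Z : ℝ≥0 → Ω → ℕ}

lemma tendsto_pow_mul_exp_neg_mul {c : ℝ} (hc : 0 < c) (p : ℕ) :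
    Tendsto (fun x : ℝ => x ^ p * Real.exp (-(c * x))) atTop (𝓝 0) := by
  have h := ((Real.tendsto_pow_mul_exp_neg_atTop_nhds_zero p).comp
    (tendsto_id.const_mul_atTop hc)).const_mul (c ^ p)⁻¹
  rw [mul_zero] at h
  refine h.congr fun x => ?_
  simp only [Function.comp, id]
  rw [mul_pow, ← mul_assoc, ← mul_assoc, inv_mul_cancel₀ (pow_pos hc p).ne', one_mul]

lemma degProb_nonneg (φ : ConnectionFunction 𝕏) (μ : Measure 𝕏) [IsProbabilityMeasure μ]
    (n i : ℕ) : 0 ≤ degProb φ μ n i :=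
  integral_nonneg fun x => by
    have h0 := φ.meanDeg_nonneg μ x
    have h1 : 0 ≤ 1 - φ.meanDeg μ x := sub_nonneg.2 (φ.meanDeg_le_one μ x)
    positivity

lemma removalError_le {φ : ConnectionFunction 𝕏} {ε m : ℝ} (h : Regular φ μ ε m) (j n : ℕ) :
    removalError ε m (ε ^ 2 / 8) j n ≤
      ((ε ^ 2 / 8) ^ j)⁻¹ * Real.exp 1 * ((n * m) ^ 1 * Real.exp (-(ε / 2 * (n * m)))) := by
  have hm := h.nonneg
  have hε := h.pos
  have hε1 := h.eps_le_one
  have hh := h.le_half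
  have hn : (0 : ℝ) ≤ n := Nat.cast_nonneg n
  have hexp : -((1 - ε ^ 2 / 8) * (ε * m) * (n - 1)) ≤ 1 + -(ε / 2 * (n * m)) := by
    have hε2 : ε ^ 2 ≤ 1 := by nlinarith
    have e1 : 1 / 2 ≤ 1 - ε ^ 2 / 8 := by linarith
    have e2 : 1 - ε ^ 2 / 8 ≤ 1 := by nlinarith [sq_nonneg ε]
    have e3 : 1 / 2 * (ε * m * n) ≤ (1 - ε ^ 2 / 8) * (ε * m * n) := by gcongr
    have e4 : (1 - ε ^ 2 / 8) * (ε * m) ≤ 1 * (1 * 1) := by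
      gcongr
      linarith
    linarith
  unfold removalError
  calc _ ≤ n * (((ε ^ 2 / 8) ^ j)⁻¹ * Real.exp (1 + -(ε / 2 * (n * m))) * m) := by gcongr
    _ = _ := by
      rw [Real.exp_add]
      ring

/-- The Poisson limit for the binomial model, along an arbitrary filter. The last hypothesis bounds
the expected number of isolated vertices, which controls the integrated decoupling error. -/
lemma tendsto_measureReal_numDeg (h : IsMarkedSample μ P X T Z) {ι : Type*} {l : Filter ι}
    {φ : ι → ConnectionFunction 𝕏} {m : ι → ℝ} {n : ι → ℕ} {ε α C : ℝ} {j : ℕ} (hε : 0 < ε)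
    (hreg : ∀ᶠ i in l, Regular (φ i) μ ε (m i)) (hn : Tendsto n l atTop)
    (hb : Tendsto (fun i => n i * m i) l atTop)
    (hmean : Tendsto (fun i => (n i + 1) * degProb (φ i) μ (n i) j) l (𝓝 α))
    (hE : ∀ᶠ i in l, (n i + 1) * ∫ x, Real.exp (-(n i * (φ i).meanDeg μ x)) ∂μ ≤ C) (k : ℕ) :
    Tendsto (fun i => P.real {ω | numDeg (irg (φ i) (n i + 1) (X · ω) (T · ω)) j = k}) l
      (𝓝 (Real.exp (-α) * α ^ k / k.factorial)) := by
  have hW : ∀ i, Measurable fun ω => numDeg (irg (φ i) (n i + 1) (X · ω) (T · ω)) j := fun i =>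
    measurable_numDeg_irg (φ i) (n i + 1) j h.measurable_points h.measurable_marks
  rcases l.eq_or_neBot with rfl | hl
  · exact tendsto_bot
  have hα : 0 ≤ α := ge_of_tendsto' hmean fun i =>
    mul_nonneg (by positivity) (degProb_nonneg _ μ _ _)
  refine tendsto_poisson_of_recursion
    (p := fun i k => P.real {ω | numDeg (irg (φ i) (n i + 1) (X · ω) (T · ω)) j = k})
    (C := α + 1) (fun i k => measureReal_nonneg) (fun i K => ?_) ?_ (fun k => ?_) k
  · rw [sum_range_measureReal_eq P (hW i)]
    exact measureReal_le_one
  · filter_upwards [hmean.eventually_lt_const (lt_add_one α)] with i hi K hK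
    rw [sum_range_measureReal_eq P (hW i)]
    refine one_sub_div_le_measureReal_lt P (hW i) (by linarith) ?_ hK
    rw [lintegral_numDeg_irg h]
    exact ENNReal.ofReal_le_ofReal hi.le
  · have hninv : Tendsto (fun i => ((n i : ℝ) + 1)⁻¹) l (𝓝 0) :=
      (tendsto_atTop_add_const_right _ _ (tendsto_natCast_atTop_atTop.comp hn)).inv_tendsto_atTop
    have hβ : Tendsto (fun i => degProb (φ i) μ (n i) j) l (𝓝 0) := by
      have := hmean.mul hninv
      rw [mul_zero] at this
      refine this.congr fun i => ?_
      have : (n i : ℝ) + 1 ≠ 0 := by positivity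
      field_simp
    have hp : ∀ {c : ℝ}, 0 < c → ∀ p : ℕ, Tendsto (fun i => (n i * m i) ^ p *
        Real.exp (-(c * (n i * m i)))) l (𝓝 0) :=
      fun hc p => (tendsto_pow_mul_exp_neg_mul hc p).comp hb
    have hd : 0 < ε ^ 2 / 4 := by positivity
    have hbound := (((((hp hd 1).const_mul 4).add ((hp hd 2).const_mul 4)).const_mul
        (((ε ^ 2 / 8) ^ (2 * j))⁻¹ * Real.exp 2)).mul_const C).add
      (hmean.mul (hβ.add ((hp (half_pos hε) 1).const_mul (((ε ^ 2 / 8) ^ j)⁻¹ * Real.exp 1))))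
    simp only [mul_zero, add_zero, zero_mul] at hbound
    have hdiff : Tendsto (fun i => (k + 1) *
        P.real {ω | numDeg (irg (φ i) (n i + 1) (X · ω) (T · ω)) j = k + 1} -
        (n i + 1) * degProb (φ i) μ (n i) j *
          P.real {ω | numDeg (irg (φ i) (n i + 1) (X · ω) (T · ω)) j = k}) l (𝓝 0) := by
      refine squeeze_zero_norm' ?_ hbound
      filter_upwards [hreg, hE] with i hi hEi
      have hm := hi.nonneg
      rw [Real.norm_eq_abs]
      refine (abs_succ_mul_sub_le h hi (n i) j k).trans (add_le_add ?_ ?_)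
      · calc _ ≤ ((ε ^ 2 / 8) ^ (2 * j))⁻¹ * Real.exp 2 *
              Real.exp (-(ε ^ 2 / 4 * (n i * m i))) *
              (4 * (n i * m i) + 4 * (n i * m i) ^ 2) * C := by gcongr
          _ = _ := by ring
      · refine mul_le_mul_of_nonneg_left (add_le_add_right (removalError_le hi j (n i)) _)
          (mul_nonneg (by positivity) (degProb_nonneg _ μ _ _))
    have hcorr : Tendsto (fun i => ((n i + 1) * degProb (φ i) μ (n i) j - α) *
          P.real {ω | numDeg (irg (φ i) (n i + 1) (X · ω) (T · ω)) j = k}) l (𝓝 0) := by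
      have h0 : Tendsto (fun i => (n i + 1) * degProb (φ i) μ (n i) j - α) l (𝓝 0) := by
        simpa using hmean.sub_const α
      refine squeeze_zero_norm (fun i => ?_) (by simpa using h0.norm)
      rw [norm_mul]
      refine mul_le_of_le_one_right (norm_nonneg _) ?_
      rw [Real.norm_eq_abs, abs_of_nonneg measureReal_nonneg]
      exact measureReal_le_one
    have := hdiff.add hcorr
    rw [add_zero] at this
    refine this.congr fun i => ?_
    ring

end BinomialLimit

/-! ### Poisson and binomial degree probabilities -/

section Degrees

/-- The Poisson weight `e⁻ᵗ tⁱ / i!`. -/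
noncomputable def poissonWeight (i : ℕ) (t : ℝ) : ℝ := t ^ i / i.factorial * Real.exp (-t)

lemma poissonWeight_nonneg (i : ℕ) {t : ℝ} (ht : 0 ≤ t) : 0 ≤ poissonWeight i t := by
  unfold poissonWeight; positivity

lemma poissonWeight_le (i : ℕ) {t : ℝ} (ht : 0 ≤ t) :
    poissonWeight i t ≤ 2 ^ i * Real.exp (-(t / 2)) := by
  have h := Real.pow_div_factorial_le_exp (x := t / 2) (by positivity) i
  have h1 : t ^ i / i.factorial = 2 ^ i * ((t / 2) ^ i / i.factorial) := by
    rw [div_pow]; field_simp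
  have h2 : Real.exp (-t) = Real.exp (-(t / 2)) * Real.exp (-(t / 2)) := by
    rw [← Real.exp_add]; ring_nf
  unfold poissonWeight
  rw [h1, h2]
  calc 2 ^ i * ((t / 2) ^ i / i.factorial) * (Real.exp (-(t / 2)) * Real.exp (-(t / 2)))
      ≤ 2 ^ i * Real.exp (t / 2) * (Real.exp (-(t / 2)) * Real.exp (-(t / 2))) := by gcongr
    _ = 2 ^ i * (Real.exp (t / 2) * Real.exp (-(t / 2))) * Real.exp (-(t / 2)) := by ring
    _ = _ := by rw [← Real.exp_add]; simp

lemma poissonWeight_le_one (i : ℕ) {t : ℝ} (ht : 0 ≤ t) : poissonWeight i t ≤ 1 := by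
  have h := Real.pow_div_factorial_le_exp (x := t) ht i
  unfold poissonWeight
  calc _ ≤ Real.exp t * Real.exp (-t) := by gcongr
    _ = 1 := by rw [← Real.exp_add]; simp

/-- For large `t` the Poisson weights below `j` are negligible compared with the weight at `j`. -/
lemma poissonWeight_le_mul {i j : ℕ} (hij : i < j) {t c : ℝ} (hc : 1 ≤ c) (hct : c ≤ t) :
    poissonWeight i t ≤ j.factorial / c * poissonWeight j t := by
  have ht : 1 ≤ t := hc.trans hct
  have hc0 : 0 < c := by linarith
  have h1 : t ^ i / i.factorial ≤ t ^ i := by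
    refine div_le_self (by positivity) ?_
    exact_mod_cast Nat.one_le_iff_ne_zero.2 (Nat.factorial_ne_zero i)
  have h2 : c * t ^ i ≤ t ^ j := by
    calc c * t ^ i ≤ t * t ^ i := by gcongr
      _ = t ^ (i + 1) := by ring
      _ ≤ t ^ j := pow_le_pow_right₀ ht hij
  unfold poissonWeight
  rw [← mul_assoc]
  refine mul_le_mul_of_nonneg_right ?_ (Real.exp_pos _).le
  calc t ^ i / i.factorial ≤ t ^ i := h1
    _ ≤ t ^ j / c := by rw [le_div_iff₀ hc0, mul_comm]; exact h2
    _ = _ := by field_simp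

lemma exp_neg_le_one_sub {x : ℝ} (h1 : x ≤ 1 / 2) :
    Real.exp (-(x + 2 * x ^ 2)) ≤ 1 - x := by
  have hx : 0 < 1 - x := by linarith
  rw [← Real.le_log_iff_exp_le hx]
  refine le_trans ?_ (Real.one_sub_inv_le_log_of_pos hx)
  have : (1 - x)⁻¹ ≤ 1 + x + 2 * x ^ 2 := by
    rw [inv_le_iff_one_le_mul₀ hx]
    nlinarith [mul_nonneg (sq_nonneg x) (show 0 ≤ 1 - 2 * x by linarith)]
  linarith

/-- A binomial degree probability is at most a factor close to `1` times the Poisson one. -/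
lemma binomial_le_poissonWeight {n i : ℕ} {s l m : ℝ} (hs : 0 < s) (hl : 0 ≤ l) (hlm : l ≤ m)
    (hm : m ≤ 1 / 2) (hin : i ≤ n) :
    (n + 1) * (n.choose i * l ^ i * (1 - l) ^ (n - i)) ≤
      (n + 1) * n ^ i / s ^ (i + 1) * Real.exp ((|n - s| + i) * m) *
        (s * poissonWeight i (s * l)) := by
  have hl1 : 0 ≤ 1 - l := by linarith
  have hf : (0 : ℝ) < i.factorial := by positivity
  have hch : (n.choose i : ℝ) ≤ n ^ i / i.factorial := Nat.choose_le_pow_div i n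
  have hexp : (1 - l) ^ (n - i) ≤ Real.exp ((|n - s| + i) * m) * Real.exp (-(s * l)) := by
    calc (1 - l) ^ (n - i) ≤ Real.exp (-l) ^ (n - i) :=
          pow_le_pow_left₀ hl1 (by linarith [Real.add_one_le_exp (-l)]) _
      _ = Real.exp (((n - i : ℕ) : ℝ) * -l) := (Real.exp_nat_mul _ _).symm
      _ ≤ Real.exp ((|n - s| + i) * m + -(s * l)) := by
          refine Real.exp_le_exp.2 ?_
          rw [Nat.cast_sub hin]
          have h1 : s - n ≤ |n - s| := by rw [abs_sub_comm]; exact le_abs_self _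
          have h2 : (s - n + i) * l ≤ (|n - s| + i) * l := by gcongr
          have h3 : (|n - s| + i) * l ≤ (|n - s| + i) * m := by gcongr
          linarith
      _ = _ := Real.exp_add _ _
  calc _ ≤ (n + 1) * (n ^ i / i.factorial * l ^ i *
        (Real.exp ((|n - s| + i) * m) * Real.exp (-(s * l)))) := by gcongr
    _ = _ := by
      unfold poissonWeight
      rw [mul_pow]
      field_simp
      ring

/-- A binomial degree probability is at least a factor close to `1` times the Poisson one. -/
lemma poissonWeight_le_binomial {n i : ℕ} {s l m : ℝ} (hs : 0 < s) (hl : 0 ≤ l) (hlm : l ≤ m)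
    (hm : m ≤ 1 / 2) (hin : i ≤ n) :
    (n + 1) * (n + 1 - i) ^ i / s ^ (i + 1) * Real.exp (-(|n - s| * m + 2 * (n * m ^ 2))) *
        (s * poissonWeight i (s * l)) ≤
    (n + 1) * (n.choose i * l ^ i * (1 - l) ^ (n - i)) := by
  have hl1 : 0 ≤ 1 - l := by linarith
  have hf : (0 : ℝ) < i.factorial := by positivity
  have hni : (i : ℝ) ≤ n := by exact_mod_cast hin
  have hch : ((n : ℝ) + 1 - i) ^ i / i.factorial ≤ n.choose i := by
    rw [div_le_iff₀ hf]
    have h1 := Nat.pow_sub_le_descFactorial n i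
    rw [Nat.descFactorial_eq_factorial_mul_choose] at h1
    have h2 : (((n + 1 - i : ℕ) : ℝ)) ^ i ≤ (i.factorial * n.choose i : ℕ) := by exact_mod_cast h1
    rw [Nat.cast_sub (by omega)] at h2
    push_cast at h2
    linarith
  have hexp : Real.exp (-(|n - s| * m + 2 * (n * m ^ 2))) * Real.exp (-(s * l)) ≤
      (1 - l) ^ (n - i) := by
    calc _ = Real.exp (-(|n - s| * m + 2 * (n * m ^ 2)) + -(s * l)) := (Real.exp_add _ _).symm
      _ ≤ Real.exp (n * -(l + 2 * l ^ 2)) := by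
          refine Real.exp_le_exp.2 ?_
          have h1 : n - s ≤ |n - s| := le_abs_self _
          have h2 : (n - s) * l ≤ |n - s| * l := by gcongr
          have h3 : |n - s| * l ≤ |n - s| * m := by gcongr
          have h4 : n * l ^ 2 ≤ n * m ^ 2 := by gcongr
          linarith
      _ = Real.exp (-(l + 2 * l ^ 2)) ^ n := Real.exp_nat_mul _ _
      _ ≤ (1 - l) ^ n := pow_le_pow_left₀ (Real.exp_pos _).le
          (exp_neg_le_one_sub (hlm.trans hm)) _
      _ ≤ _ := pow_le_pow_of_le_one hl1 (by linarith) (Nat.sub_le _ _)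
  have h0 : (0 : ℝ) ≤ n + 1 - i := by linarith
  calc _ = (n + 1) * ((n + 1 - i) ^ i / i.factorial * l ^ i *
        (Real.exp (-(|n - s| * m + 2 * (n * m ^ 2))) * Real.exp (-(s * l)))) := by
          unfold poissonWeight
          rw [mul_pow]
          field_simp
          ring
    _ ≤ _ := by gcongr

/-- The thinning identity: a binomial number of successes in a Poisson number of trials is
Poisson. -/
lemma hasSum_poisson_mul_binomial (s : ℝ) (l : ℝ) (i : ℕ) :
    HasSum (fun n : ℕ => Real.exp (-s) * s ^ n / n.factorial *
      (n.choose i * l ^ i * (1 - l) ^ (n - i))) (poissonWeight i (s * l)) := by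
  have hinj : Function.Injective fun k : ℕ => k + i := add_left_injective i
  rw [← hinj.hasSum_iff]
  · have h := (NormedSpace.expSeries_div_hasSum_exp (s * (1 - l))).mul_left
      (Real.exp (-s) * ((s * l) ^ i / i.factorial))
    rw [← Real.exp_eq_exp_ℝ] at h
    have e1 : Real.exp (-s) * ((s * l) ^ i / i.factorial) * Real.exp (s * (1 - l)) =
        poissonWeight i (s * l) := by
      unfold poissonWeight
      rw [mul_comm (Real.exp (-s)), mul_assoc, ← Real.exp_add]
      ring_nf
    rw [e1] at h
    refine h.congr_fun fun k => ?_
    simp only [Function.comp, Nat.add_sub_cancel]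
    have hch : ((k + i).choose i : ℝ) = (k + i).factorial / (i.factorial * k.factorial) := by
      rw [Nat.cast_choose ℝ (Nat.le_add_left i k), Nat.add_sub_cancel]
    have h1 : ((k + i).factorial : ℝ) ≠ 0 := by positivity
    rw [hch, mul_pow, mul_pow, pow_add]
    field_simp
  · intro n hn
    have : n < i := by
      by_contra hcon
      exact hn ⟨n - i, by simp; omega⟩
    simp [Nat.choose_eq_zero_of_lt this]

variable {𝕏 : Type*} [MeasurableSpace 𝕏] {μ : Measure 𝕏} [IsProbabilityMeasure μ]

/-- The expected number of vertices of degree `i` in the Poisson model of intensity `s`. -/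
noncomputable def poissonMean (φ : ConnectionFunction 𝕏) (μ : Measure 𝕏) (s : ℝ) (i : ℕ) : ℝ :=
  s * ∫ x, poissonWeight i (s * φ.meanDeg μ x) ∂μ

lemma measurable_poissonWeight (i : ℕ) : Measurable (poissonWeight i) := by
  unfold poissonWeight
  fun_prop

lemma integrable_poissonWeight (φ : ConnectionFunction 𝕏) (μ : Measure 𝕏) [IsProbabilityMeasure μ]
    {s : ℝ} (hs : 0 ≤ s) (i : ℕ) :
    Integrable (fun x => poissonWeight i (s * φ.meanDeg μ x)) μ :=
  Integrable.of_bound ((measurable_poissonWeight i).comp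
    ((φ.measurable_meanDeg μ).const_mul s)).aestronglyMeasurable 1 (ae_of_all _ fun x => by
      have h := mul_nonneg hs (φ.meanDeg_nonneg μ x)
      rw [Real.norm_eq_abs, abs_of_nonneg (poissonWeight_nonneg i h)]
      exact poissonWeight_le_one i h)

lemma integrable_binomial (φ : ConnectionFunction 𝕏) (μ : Measure 𝕏) [IsProbabilityMeasure μ]
    (n i : ℕ) : Integrable (fun x => n.choose i * φ.meanDeg μ x ^ i *
      (1 - φ.meanDeg μ x) ^ (n - i)) μ := by
  have hm := φ.measurable_meanDeg μ
  refine Integrable.of_bound (by fun_prop) (n.choose i) (ae_of_all _ fun x => ?_)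
  have h0 := φ.meanDeg_nonneg μ x
  have h1 := φ.meanDeg_le_one μ x
  have h2 : 0 ≤ 1 - φ.meanDeg μ x := by linarith
  rw [Real.norm_eq_abs, abs_of_nonneg (by positivity), mul_assoc]
  refine mul_le_of_le_one_right (Nat.cast_nonneg _) (mul_le_one₀ (pow_le_one₀ h0 h1)
    (by positivity) (pow_le_one₀ h2 (by linarith)))

lemma poissonMean_nonneg (φ : ConnectionFunction 𝕏) (μ : Measure 𝕏) [IsProbabilityMeasure μ]
    {s : ℝ} (hs : 0 ≤ s) (i : ℕ) : 0 ≤ poissonMean φ μ s i :=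
  mul_nonneg hs (integral_nonneg fun x =>
    poissonWeight_nonneg i (mul_nonneg hs (φ.meanDeg_nonneg μ x)))

end Degrees

/-! ### Asymptotics of the expected degrees -/

section Asymptotics

variable {𝕏 : Type*} [MeasurableSpace 𝕏] {μ : Measure 𝕏} [IsProbabilityMeasure μ]
  {ι : Type*} {l : Filter ι} {φ : ι → ConnectionFunction 𝕏} {s m : ι → ℝ} {ε : ℝ}

/-- If the expected number of isolated vertices stays bounded, the maximal expected degree tends to
infinity. -/
lemma tendsto_maxDegree_atTop {C : ℝ} (hs : Tendsto s l atTop)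
    (hle : ∀ᶠ i in l, ∀ x, (φ i).meanDeg μ x ≤ m i)
    (hC : ∀ᶠ i in l, poissonMean (φ i) μ (s i) 0 ≤ C) :
    Tendsto (fun i => s i * m i) l atTop := by
  rcases l.eq_or_neBot with rfl | hl
  · exact tendsto_bot
  have hmain : ∀ᶠ i in l, s i * Real.exp (-(s i * m i)) ≤ C := by
    filter_upwards [hle, hC, hs.eventually_gt_atTop 0] with i hi hCi hsi
    refine le_trans (mul_le_mul_of_nonneg_left ?_ hsi.le) hCi
    have h1 : Real.exp (-(s i * m i)) = ∫ _x, Real.exp (-(s i * m i)) ∂μ := by simp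
    rw [h1]
    refine integral_mono (integrable_const _) (integrable_poissonWeight (φ i) μ hsi.le 0)
      fun x => ?_
    simp only [poissonWeight, pow_zero, Nat.factorial_zero, Nat.cast_one, div_one, one_mul]
    have := mul_le_mul_of_nonneg_left (hi x) hsi.le
    exact Real.exp_le_exp.2 (neg_le_neg this)
  obtain ⟨i₀, hi₀, hi₀s⟩ := (hmain.and (hs.eventually_gt_atTop 0)).exists
  have hC0 : 0 < C := lt_of_lt_of_le (mul_pos hi₀s (Real.exp_pos _)) hi₀
  refine tendsto_atTop_mono' l ?_ (Real.tendsto_log_atTop.comp (hs.atTop_div_const hC0))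
  filter_upwards [hmain, hs.eventually_gt_atTop 0] with i hi hsi
  rw [Function.comp, Real.log_le_iff_le_exp (by positivity), div_le_iff₀ hC0]
  calc s i = Real.exp (s i * m i) * (s i * Real.exp (-(s i * m i))) := by
        rw [mul_comm (s i) (Real.exp _), ← mul_assoc, ← Real.exp_add]; simp
    _ ≤ _ := mul_le_mul_of_nonneg_left hi (Real.exp_pos _).le

/-- If the expected number of vertices of small degree stays away from zero, the maximal expected
degree is at most of logarithmic order. -/
lemma tendsto_rpow_mul_zero (hε : 0 < ε) {c : ℝ} (hc : 0 < c) {j : ℕ} (hs : Tendsto s l atTop)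
    (hm : ∀ᶠ i in l, 0 ≤ m i) (hge : ∀ᶠ i in l, ∀ x, ε * m i ≤ (φ i).meanDeg μ x)
    (hlow : ∀ᶠ i in l, c ≤ ∑ k ∈ Finset.range (j + 1), poissonMean (φ i) μ (s i) k) :
    Tendsto (fun i => s i ^ (3 / 4 : ℝ) * m i) l (𝓝 0) := by
  set K : ℝ := ∑ k ∈ Finset.range (j + 1), 2 ^ k with hK
  have hK0 : 0 < K := Finset.sum_pos (fun k _ => by positivity) ⟨0, by simp⟩
  have hmain : ∀ᶠ i in l, c ≤ s i * K * Real.exp (-(ε * (s i * m i) / 2)) := by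
    filter_upwards [hge, hlow, hs.eventually_gt_atTop 0] with i hi hci hsi
    refine hci.trans ?_
    rw [hK, Finset.mul_sum, Finset.sum_mul]
    refine Finset.sum_le_sum fun k _ => ?_
    rw [poissonMean, mul_assoc]
    refine mul_le_mul_of_nonneg_left ?_ hsi.le
    have h1 : 2 ^ k * Real.exp (-(ε * (s i * m i) / 2)) =
        ∫ _x, 2 ^ k * Real.exp (-(ε * (s i * m i) / 2)) ∂μ := by simp
    rw [h1]
    refine integral_mono (integrable_poissonWeight (φ i) μ hsi.le k) (integrable_const _)
      fun x => ?_
    refine (poissonWeight_le k (mul_nonneg hsi.le ((φ i).meanDeg_nonneg μ x))).trans ?_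
    refine mul_le_mul_of_nonneg_left (Real.exp_le_exp.2 (neg_le_neg ?_)) (by positivity)
    have := mul_le_mul_of_nonneg_left (hi x) hsi.le
    linarith
  have hlim : Tendsto (fun x : ℝ => 2 / ε * (Real.log (K / c) * x ^ (-(1 / 4 : ℝ)) +
      Real.log x / x ^ (1 / 4 : ℝ))) atTop (𝓝 0) := by
    have h1 := (tendsto_rpow_neg_atTop (show (0 : ℝ) < 1 / 4 by norm_num)).const_mul
      (Real.log (K / c))
    have h2 := (isLittleO_log_rpow_atTop (show (0 : ℝ) < 1 / 4 by norm_num)).tendsto_div_nhds_zero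
    have h3 := (h1.add h2).const_mul (2 / ε)
    simpa using h3
  refine squeeze_zero' ?_ ?_ (hlim.comp hs)
  · filter_upwards [hm, hs.eventually_gt_atTop 0] with i hi hsi
    positivity
  · filter_upwards [hmain, hs.eventually_gt_atTop 0] with i hi hsi
    have hlog : ε * (s i * m i) / 2 ≤ Real.log (K / c) + Real.log (s i) := by
      rw [← Real.log_mul (by positivity) (by positivity), Real.le_log_iff_exp_le (by positivity)]
      rw [div_mul_eq_mul_div, le_div_iff₀ hc]
      calc Real.exp (ε * (s i * m i) / 2) * c ≤ Real.exp (ε * (s i * m i) / 2) *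
            (s i * K * Real.exp (-(ε * (s i * m i) / 2))) :=
            mul_le_mul_of_nonneg_left hi (Real.exp_pos _).le
        _ = s i * K * (Real.exp (ε * (s i * m i) / 2) * Real.exp (-(ε * (s i * m i) / 2))) := by
            ring
        _ = K * s i := by rw [← Real.exp_add]; simp [mul_comm]
    have hsm : s i * m i ≤ 2 / ε * (Real.log (K / c) + Real.log (s i)) := by
      rw [div_mul_eq_mul_div, le_div_iff₀ hε]
      linarith
    have hp : 0 < s i ^ (-(1 / 4 : ℝ)) := Real.rpow_pos_of_pos hsi _
    have e1 : s i ^ (3 / 4 : ℝ) * m i = s i * m i * s i ^ (-(1 / 4 : ℝ)) := by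
      have : s i ^ (3 / 4 : ℝ) = s i * s i ^ (-(1 / 4 : ℝ)) := by
        conv_rhs => rw [← Real.rpow_one (s i), ← Real.rpow_mul hsi.le, ← Real.rpow_add hsi]
        norm_num
      rw [this]; ring
    have e2 : Real.log (s i) / s i ^ (1 / 4 : ℝ) = Real.log (s i) * s i ^ (-(1 / 4 : ℝ)) := by
      rw [Real.rpow_neg hsi.le, div_eq_mul_inv]
    rw [Function.comp, e1, e2, ← add_mul, ← mul_assoc]
    exact mul_le_mul_of_nonneg_right hsm hp.le

/-- By homogeneity all expected degrees tend to infinity, so that degrees below `j` are negligible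
compared with degree `j`. -/
lemma tendsto_poissonMean_zero_of_lt (hε : 0 < ε) {C : ℝ} {i j : ℕ} (hij : i < j)
    (hs : Tendsto s l atTop) (hsm : Tendsto (fun a => s a * m a) l atTop)
    (hge : ∀ᶠ a in l, ∀ x, ε * m a ≤ (φ a).meanDeg μ x)
    (hC : ∀ᶠ a in l, poissonMean (φ a) μ (s a) j ≤ C) :
    Tendsto (fun a => poissonMean (φ a) μ (s a) i) l (𝓝 0) := by
  have hb := hsm.const_mul_atTop hε
  have hlim : Tendsto (fun a => j.factorial / (ε * (s a * m a)) * C) l (𝓝 0) := by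
    simpa using (tendsto_const_nhds.div_atTop hb).mul_const C
  refine squeeze_zero' ?_ ?_ hlim
  · filter_upwards [hs.eventually_ge_atTop 0] with a ha using poissonMean_nonneg _ μ ha i
  · filter_upwards [hge, hC, hs.eventually_gt_atTop 0, hb.eventually_ge_atTop 1] with a h1 h2 h3 h4
    refine le_trans ?_ (mul_le_mul_of_nonneg_left h2 (by positivity))
    rw [poissonMean, poissonMean, mul_left_comm]
    refine mul_le_mul_of_nonneg_left ?_ h3.le
    rw [← integral_const_mul]
    refine integral_mono (integrable_poissonWeight _ μ h3.le i)
      ((integrable_poissonWeight _ μ h3.le j).const_mul _) fun x => ?_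
    refine poissonWeight_le_mul hij h4 ?_
    have := mul_le_mul_of_nonneg_left (h1 x) h3.le
    linarith

variable {n : ι → ℕ}

/-- The binomial and the Poisson model have asymptotically the same expected number of vertices of
degree `k`, if the number of points is close enough to the intensity. -/
lemma tendsto_succ_mul_degProb {a : ℝ} {k : ℕ} (hs : Tendsto s l atTop) (hn : Tendsto n l atTop)
    (hns : Tendsto (fun i => (n i : ℝ) / s i) l (𝓝 1))
    (hm : Tendsto m l (𝓝 0)) (hd : Tendsto (fun i => |(n i : ℝ) - s i| * m i) l (𝓝 0))
    (hm2 : Tendsto (fun i => (n i : ℝ) * m i ^ 2) l (𝓝 0))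
    (hle : ∀ᶠ i in l, ∀ x, (φ i).meanDeg μ x ≤ m i)
    (ha : Tendsto (fun i => poissonMean (φ i) μ (s i) k) l (𝓝 a)) :
    Tendsto (fun i => (n i + 1) * degProb (φ i) μ (n i) k) l (𝓝 a) := by
  have hsinv : Tendsto (fun i => (s i)⁻¹) l (𝓝 0) := hs.inv_tendsto_atTop
  have hshift : ∀ b : ℝ, Tendsto (fun i => ((n i : ℝ) + b) / s i) l (𝓝 1) := by
    intro b
    have h := hns.add (hsinv.const_mul b)
    rw [mul_zero, add_zero] at h
    refine h.congr fun i => ?_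
    rw [add_div, div_eq_mul_inv b]
  have hup : Tendsto (fun i => ((n i : ℝ) + 1) * n i ^ k / s i ^ (k + 1) *
      Real.exp ((|n i - s i| + k) * m i)) l (𝓝 1) := by
    have h1 := (hshift 1).mul (hns.pow k)
    have h2 : Tendsto (fun i => Real.exp ((|n i - s i| + k) * m i)) l (𝓝 1) := by
      have h := hd.add (hm.const_mul (k : ℝ))
      rw [mul_zero, add_zero] at h
      have h' := (Real.continuous_exp.tendsto 0).comp h
      rw [Real.exp_zero] at h'
      refine h'.congr fun i => ?_
      simp only [Function.comp]
      ring_nf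
    have h3 := h1.mul h2
    simp only [one_pow, mul_one] at h3
    refine h3.congr fun i => ?_
    congr 1
    rw [div_pow, div_mul_div_comm, pow_succ' (s i)]
  have hlo : Tendsto (fun i => ((n i : ℝ) + 1) * (n i + 1 - k) ^ k / s i ^ (k + 1) *
      Real.exp (-(|n i - s i| * m i + 2 * (n i * m i ^ 2)))) l (𝓝 1) := by
    have h1 := (hshift 1).mul ((hshift (1 - k)).pow k)
    have h2 : Tendsto (fun i => Real.exp (-(|n i - s i| * m i + 2 * (n i * m i ^ 2)))) l
        (𝓝 1) := by
      have h := (hd.add (hm2.const_mul 2)).neg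
      rw [mul_zero, add_zero, neg_zero] at h
      have h' := (Real.continuous_exp.tendsto 0).comp h
      rw [Real.exp_zero] at h'
      exact h'
    have h3 := h1.mul h2
    simp only [one_pow, mul_one] at h3
    refine h3.congr fun i => ?_
    congr 1
    rw [div_pow, div_mul_div_comm, pow_succ' (s i), add_sub_assoc]
  have hupa := hup.mul ha
  have hloa := hlo.mul ha
  rw [one_mul] at hupa hloa
  have hmhalf : ∀ᶠ i in l, m i ≤ 1 / 2 := hm.eventually_le_const (by norm_num)
  refine tendsto_of_tendsto_of_tendsto_of_le_of_le' hloa hupa ?_ ?_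
  · filter_upwards [hle, hmhalf, hs.eventually_gt_atTop 0, hn.eventually_ge_atTop k]
      with i h1 h2 h3 h4
    rw [poissonMean, degProb, ← integral_const_mul, ← integral_const_mul, ← integral_const_mul]
    refine integral_mono (((integrable_poissonWeight _ μ h3.le k).const_mul _).const_mul _)
      ((integrable_binomial _ μ _ _).const_mul _) fun x => ?_
    exact poissonWeight_le_binomial h3 ((φ i).meanDeg_nonneg μ x) (h1 x) h2 h4
  · filter_upwards [hle, hmhalf, hs.eventually_gt_atTop 0, hn.eventually_ge_atTop k]
      with i h1 h2 h3 h4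
    rw [poissonMean, degProb, ← integral_const_mul, ← integral_const_mul, ← integral_const_mul]
    refine integral_mono ((integrable_binomial _ μ _ _).const_mul _)
      (((integrable_poissonWeight _ μ h3.le k).const_mul _).const_mul _) fun x => ?_
    exact binomial_le_poissonWeight h3 ((φ i).meanDeg_nonneg μ x) (h1 x) h2 h4

/-- The expected number of isolated vertices in the binomial model is bounded if it is so in the
Poisson model. -/
lemma eventually_succ_mul_integral_exp_le {C : ℝ} (hs : Tendsto s l atTop)
    (hns : Tendsto (fun i => (n i : ℝ) / s i) l (𝓝 1))
    (hd : Tendsto (fun i => |(n i : ℝ) - s i| * m i) l (𝓝 0))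
    (hle : ∀ᶠ i in l, ∀ x, (φ i).meanDeg μ x ≤ m i)
    (hC : ∀ᶠ i in l, poissonMean (φ i) μ (s i) 0 ≤ C) :
    ∀ᶠ i in l, (n i + 1) * ∫ x, Real.exp (-(n i * (φ i).meanDeg μ x)) ∂μ ≤
      3 * Real.exp 1 * C := by
  have hsinv : Tendsto (fun i => (s i)⁻¹) l (𝓝 0) := hs.inv_tendsto_atTop
  filter_upwards [hle, hC, hs.eventually_gt_atTop 0, hd.eventually_le_const zero_lt_one,
    hns.eventually_le_const one_lt_two, hsinv.eventually_le_const zero_lt_one]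
    with i h1 h2 h3 h4 h5 h6
  have hexp : ∫ x, Real.exp (-(n i * (φ i).meanDeg μ x)) ∂μ ≤
      ∫ x, Real.exp 1 * poissonWeight 0 (s i * (φ i).meanDeg μ x) ∂μ := by
    have hmeas := (φ i).measurable_meanDeg μ
    refine integral_mono_of_nonneg (ae_of_all _ fun x => (Real.exp_pos _).le)
      ((integrable_poissonWeight _ μ h3.le 0).const_mul _) (ae_of_all _ fun x => ?_)
    have h0 := (φ i).meanDeg_nonneg μ x
    have e : -(n i * (φ i).meanDeg μ x) ≤ 1 + -(s i * (φ i).meanDeg μ x) := by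
      have e1 : s i - n i ≤ |(n i : ℝ) - s i| := by rw [abs_sub_comm]; exact le_abs_self _
      have e2 := mul_le_mul_of_nonneg_right e1 h0
      have e3 := mul_le_mul_of_nonneg_left (h1 x) (abs_nonneg ((n i : ℝ) - s i))
      linarith
    simp only [poissonWeight, pow_zero, Nat.factorial_zero, Nat.cast_one, div_one, one_mul]
    rw [← Real.exp_add]
    exact Real.exp_le_exp.2 e
  have hn1 : (n i : ℝ) + 1 ≤ 3 * s i := by
    rw [div_le_iff₀ h3] at h5
    have : 1 ≤ s i := by
      rw [inv_le_one_iff₀] at h6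
      rcases h6 with h6 | h6
      · linarith
      · exact h6
    linarith
  calc _ ≤ 3 * s i * ∫ x, Real.exp 1 * poissonWeight 0 (s i * (φ i).meanDeg μ x) ∂μ := by
        refine mul_le_mul hn1 hexp (integral_nonneg fun x => (Real.exp_pos _).le) (by linarith)
    _ = 3 * Real.exp 1 * poissonMean (φ i) μ (s i) 0 := by
        rw [integral_const_mul, poissonMean]; ring
    _ ≤ _ := by gcongr

end Asymptotics

/-! ### Poisson mixtures -/

section Mixture

variable {𝕏 Ω : Type*} [MeasurableSpace 𝕏] [MeasurableSpace Ω] {μ : Measure 𝕏}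
  {P : Measure Ω} {X : ℕ → Ω → 𝕏} {T : ℕ → Ω → ℕ → I} {Z : ℝ≥0 → Ω → ℕ}

/-- The Poisson model is the mixture of the binomial models over the Poisson distributed number of
points. -/
lemma lintegral_count [IsProbabilityMeasure P] (h : IsMarkedSample μ P X T Z) (s : ℝ≥0)
    {g : ℕ → (ℕ → 𝕏 × (ℕ → I)) → ENNReal} (hg : ∀ n, Measurable (g n)) :
    ∫⁻ ω, g (Z s ω) (fun i => (X i ω, T i ω)) ∂P =
      ∑' n, ENNReal.ofReal (Real.exp (-s) * s ^ n / n.factorial) *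
        ∫⁻ ω, g n (fun i => (X i ω, T i ω)) ∂P := by
  have hY : Measurable fun ω i => (X i ω, T i ω) :=
    measurable_pi_iff.2 fun i => (h.measurable_point i).prodMk (h.measurable_mark i)
  have hZ := h.measurable_count s
  have hg' : Measurable fun p : ℕ × (ℕ → 𝕏 × (ℕ → I)) => g p.1 p.2 :=
    measurable_from_prod_countable_right hg
  have hmap := (indepFun_iff_map_prod_eq_prod_map_map hZ.aemeasurable hY.aemeasurable).1
    (h.indep_count s)
  have hYp : IsProbabilityMeasure (P.map fun ω i => (X i ω, T i ω)) :=
    Measure.isProbabilityMeasure_map hY.aemeasurable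
  rw [(h.law_count s).map_eq] at hmap
  calc ∫⁻ ω, g (Z s ω) (fun i => (X i ω, T i ω)) ∂P
      = ∫⁻ p, g p.1 p.2 ∂(P.map fun ω => (Z s ω, fun i => (X i ω, T i ω))) :=
        (lintegral_map hg' (hZ.prodMk hY)).symm
    _ = ∫⁻ n, ∫⁻ y, g n y ∂(P.map fun ω i => (X i ω, T i ω)) ∂(poissonMeasure s) := by
        rw [hmap, lintegral_prod _ hg'.aemeasurable]
    _ = _ := by
        rw [lintegral_countable']
        refine tsum_congr fun n => ?_
        rw [poissonMeasure_singleton, lintegral_map (hg n) hY, mul_comm]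

lemma measureReal_count [IsProbabilityMeasure P] (h : IsMarkedSample μ P X T Z) (s : ℝ≥0)
    {A : ℕ → Set (ℕ → 𝕏 × (ℕ → I))} (hA : ∀ n, MeasurableSet (A n)) :
    P.real {ω | (fun i => (X i ω, T i ω)) ∈ A (Z s ω)} =
      ∑' n, Real.exp (-s) * s ^ n / n.factorial *
        P.real {ω | (fun i => (X i ω, T i ω)) ∈ A n} := by
  have hY : Measurable fun ω i => (X i ω, T i ω) :=
    measurable_pi_iff.2 fun i => (h.measurable_point i).prodMk (h.measurable_mark i)
  have hS : MeasurableSet {p : ℕ × (ℕ → 𝕏 × (ℕ → I)) | p.2 ∈ A p.1} := by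
    refine measurableSet_setOfPred.2 (measurable_from_prod_countable_right fun n => ?_)
    exact measurableSet_setOfPred.1 (hA n)
  have hB : MeasurableSet {ω | (fun i => (X i ω, T i ω)) ∈ A (Z s ω)} :=
    ((h.measurable_count s).prodMk hY) hS
  have h1 := lintegral_count h s (g := fun n => (A n).indicator 1)
    fun n => measurable_one.indicator (hA n)
  have e1 : ∫⁻ ω, (A (Z s ω)).indicator 1 (fun i => (X i ω, T i ω)) ∂P =
      P {ω | (fun i => (X i ω, T i ω)) ∈ A (Z s ω)} := by
    rw [← lintegral_indicator_one hB]
    rfl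
  have e2 : ∀ n, ∫⁻ ω, (A n).indicator 1 (fun i => (X i ω, T i ω)) ∂P =
      P {ω | (fun i => (X i ω, T i ω)) ∈ A n} := by
    intro n
    exact (lintegral_congr fun ω => rfl).trans (lintegral_indicator_one (hY (hA n)))
  rw [e1] at h1
  simp_rw [e2] at h1
  rw [measureReal_def, h1, ENNReal.tsum_toReal_eq fun n =>
    ENNReal.mul_ne_top ENNReal.ofReal_ne_top (measure_ne_top _ _)]
  refine tsum_congr fun n => ?_
  rw [ENNReal.toReal_mul, ENNReal.toReal_ofReal (by positivity), measureReal_def]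

lemma measurable_numDeg_count (h : IsMarkedSample μ P X T Z) (φ : ConnectionFunction 𝕏) (s : ℝ≥0)
    (i : ℕ) : Measurable fun ω => numDeg (irg φ (Z s ω) (X · ω) (T · ω)) i := by
  have hm : Measurable fun p : ℕ × Ω => numDeg (irg φ p.1 (X · p.2) (T · p.2)) i :=
    measurable_from_prod_countable_right fun n =>
      measurable_numDeg_irg φ n i h.measurable_points h.measurable_marks
  exact hm.comp ((h.measurable_count s).prodMk measurable_id)

/-- The expected number of vertices of degree `i` in the Poisson model. -/
lemma lintegral_numDeg_count [IsProbabilityMeasure μ] [IsProbabilityMeasure P]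
    (h : IsMarkedSample μ P X T Z) (φ : ConnectionFunction 𝕏) (s : ℝ≥0) (i : ℕ) :
    ∫⁻ ω, (numDeg (irg φ (Z s ω) (X · ω) (T · ω)) i : ENNReal) ∂P =
      ENNReal.ofReal (poissonMean φ μ s i) := by
  have hmix := lintegral_count h s (g := fun n y =>
    (numDeg (irg φ n (fun k => (y k).1) (fun k => (y k).2)) i : ENNReal)) fun n => by
      refine (measurable_from_top (f := fun k : ℕ => (k : ENNReal))).comp
        (measurable_numDeg_irg φ n i ?_ ?_) <;> fun_prop
  simp only at hmix
  refine hmix.trans ?_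
  have h0 : ∀ ω, numDeg (irg φ 0 (X · ω) (T · ω)) i = 0 := fun ω => by simp [numDeg]
  rw [tsum_eq_zero_add' ENNReal.summable]
  simp only [h0, Nat.cast_zero, lintegral_zero, mul_zero, zero_add]
  have hb : ∀ n : ℕ, ∀ x, 0 ≤ (n.choose i : ℝ) * φ.meanDeg μ x ^ i *
      (1 - φ.meanDeg μ x) ^ (n - i) := fun n x => by
    have h0 := φ.meanDeg_nonneg μ x
    have h1 : 0 ≤ 1 - φ.meanDeg μ x := by linarith [φ.meanDeg_le_one μ x]
    positivity
  have hmeas := φ.measurable_meanDeg μ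
  calc ∑' n : ℕ, ENNReal.ofReal (Real.exp (-s) * s ^ (n + 1) / (n + 1).factorial) *
        ∫⁻ ω, (numDeg (irg φ (n + 1) (X · ω) (T · ω)) i : ENNReal) ∂P
      = ∑' n : ℕ, ∫⁻ x, ENNReal.ofReal (s * (Real.exp (-s) * s ^ n / n.factorial *
          (n.choose i * φ.meanDeg μ x ^ i * (1 - φ.meanDeg μ x) ^ (n - i)))) ∂μ := by
        refine tsum_congr fun n => ?_
        rw [lintegral_numDeg_irg h, ← ENNReal.ofReal_mul (by positivity),
          ← ofReal_integral_eq_lintegral_ofReal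
            (((integrable_binomial φ μ n i).const_mul _).const_mul _)
            (ae_of_all _ fun x => mul_nonneg s.coe_nonneg (mul_nonneg (by positivity) (hb n x)))]
        congr 1
        rw [integral_const_mul, integral_const_mul, degProb, Nat.factorial_succ, pow_succ]
        push_cast
        field_simp
    _ = ∫⁻ x, ∑' n : ℕ, ENNReal.ofReal (s * (Real.exp (-s) * s ^ n / n.factorial *
          (n.choose i * φ.meanDeg μ x ^ i * (1 - φ.meanDeg μ x) ^ (n - i)))) ∂μ :=
        (lintegral_tsum fun n => by fun_prop).symm
    _ = ∫⁻ x, ENNReal.ofReal (s * poissonWeight i (s * φ.meanDeg μ x)) ∂μ := by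
        refine lintegral_congr fun x => ?_
        have hs := (hasSum_poisson_mul_binomial s (φ.meanDeg μ x) i).mul_left (s : ℝ)
        rw [← hs.tsum_eq, ENNReal.ofReal_tsum_of_nonneg (fun n =>
          mul_nonneg s.coe_nonneg (mul_nonneg (by positivity) (hb n x))) hs.summable]
    _ = _ := by
        rw [← ofReal_integral_eq_lintegral_ofReal
            ((integrable_poissonWeight φ μ s.coe_nonneg i).const_mul _)
            (ae_of_all _ fun x => mul_nonneg s.coe_nonneg
              (poissonWeight_nonneg i (mul_nonneg s.coe_nonneg (φ.meanDeg_nonneg μ x)))),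
          integral_const_mul, poissonMean]

lemma integral_numDegLE_count [IsProbabilityMeasure μ] [IsProbabilityMeasure P]
    (h : IsMarkedSample μ P X T Z) (φ : ConnectionFunction 𝕏) (s : ℝ≥0) (j : ℕ) :
    ∫ ω, (numDegLE (irg φ (Z s ω) (X · ω) (T · ω)) j : ℝ) ∂P =
      ∑ i ∈ Finset.range (j + 1), poissonMean φ μ s i := by
  have hn : ∀ i, 0 ≤ poissonMean φ μ s i := fun i => poissonMean_nonneg φ μ s.coe_nonneg i
  have hm : ∀ i, Measurable fun ω => (numDeg (irg φ (Z s ω) (X · ω) (T · ω)) i : ENNReal) :=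
    fun i => (measurable_from_top (f := fun k : ℕ => (k : ENNReal))).comp
      (measurable_numDeg_count h φ s i)
  rw [integral_eq_lintegral_of_nonneg_ae (ae_of_all _ fun ω => Nat.cast_nonneg _)]
  · have e : ∀ ω, ENNReal.ofReal (numDegLE (irg φ (Z s ω) (X · ω) (T · ω)) j : ℝ) =
        ∑ i ∈ Finset.range (j + 1), (numDeg (irg φ (Z s ω) (X · ω) (T · ω)) i : ENNReal) := by
      intro ω
      rw [ENNReal.ofReal_natCast, numDegLE]
      push_cast
      rfl
    simp_rw [e]
    rw [lintegral_finsetSum _ fun i _ => hm i]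
    simp_rw [lintegral_numDeg_count h]
    rw [← ENNReal.ofReal_sum_of_nonneg fun i _ => hn i,
      ENNReal.toReal_ofReal (Finset.sum_nonneg fun i _ => hn i)]
  · unfold numDegLE
    exact ((measurable_from_top (f := fun k : ℕ => (k : ℝ))).comp (Finset.measurable_sum _
      fun i _ => measurable_numDeg_count h φ s i)).aestronglyMeasurable

end Mixture

/-! ### Concentration of the Poisson distribution -/

section Concentration

/-- The size-bias identity `E (N f(N)) = s E f(N + 1)` of a Poisson variable `N` of mean `s`. -/
lemma hasSum_poisson_mul_succ {s a : ℝ} {f : ℕ → ℝ}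
    (hf : HasSum (fun n : ℕ => Real.exp (-s) * s ^ n / n.factorial * f (n + 1)) a) :
    HasSum (fun n : ℕ => Real.exp (-s) * s ^ n / n.factorial * (n * f n)) (s * a) := by
  rw [← hasSum_nat_add_iff' 1]
  simp only [Finset.range_one, Finset.sum_singleton, Nat.cast_zero, zero_mul, mul_zero, sub_zero]
  refine (hf.mul_left s).congr_fun fun n => ?_
  rw [Nat.factorial_succ, pow_succ]
  push_cast
  field_simp

/-- The variance of the Poisson distribution. -/
lemma hasSum_poisson_mul_sq (s : ℝ≥0) :
    HasSum (fun n : ℕ => Real.exp (-s) * s ^ n / n.factorial * ((n : ℝ) - s) ^ 2) (s : ℝ) := by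
  have h0 : HasSum (fun n : ℕ => Real.exp (-s) * (s : ℝ) ^ n / n.factorial * 1) (1 : ℝ) := by
    simpa using hasSum_one_poissonMeasure s
  have h1 : HasSum (fun n : ℕ => Real.exp (-s) * (s : ℝ) ^ n / n.factorial * (n * 1))
      ((s : ℝ) * 1) := hasSum_poisson_mul_succ (f := fun _ => 1) h0
  have h2 : HasSum (fun n : ℕ => Real.exp (-s) * (s : ℝ) ^ n / n.factorial * (n * n))
      ((s : ℝ) * (s + 1)) := by
    refine hasSum_poisson_mul_succ (f := fun n => (n : ℝ)) ?_
    have := h1.add h0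
    rw [mul_one] at this
    refine this.congr_fun fun n => ?_
    push_cast
    ring
  have h3 := (h2.sub (h1.mul_left (2 * (s : ℝ)))).add (h0.mul_left ((s : ℝ) ^ 2))
  have e : (s : ℝ) * (s + 1) - 2 * s * (s * 1) + s ^ 2 * 1 = s := by ring
  rw [e] at h3
  refine h3.congr_fun fun n => ?_
  ring

/-- The filter of pairs `(s, n)` with `s → ∞` and `|n - s| ≤ s ^ (3 / 4)`: by Chebyshev's inequality
the second component may be taken as a Poisson variable of mean `s`. Any exponent strictly between
`1 / 2` and `1` would do, since the maximal expected degree is of logarithmic order. -/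
def window : Filter (ℝ≥0 × ℕ) :=
  comap Prod.fst atTop ⊓ 𝓟 {p | |(p.2 : ℝ) - p.1| ≤ (p.1 : ℝ) ^ (3 / 4 : ℝ)}

/-- Convergence along the window carries over to Poisson mixtures. -/
lemma tendsto_tsum_poisson {u : ℝ≥0 × ℕ → ℝ} {c : ℝ} (hu0 : ∀ p, 0 ≤ u p) (hu1 : ∀ p, u p ≤ 1)
    (hu : Tendsto u window (𝓝 c)) :
    Tendsto (fun s : ℝ≥0 => ∑' n : ℕ, Real.exp (-s) * s ^ n / n.factorial * u (s, n)) atTop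
      (𝓝 c) := by
  have hp0 : ∀ (s : ℝ≥0) (n : ℕ), 0 ≤ Real.exp (-s) * (s : ℝ) ^ n / n.factorial := fun s n => by
    positivity
  rw [Metric.tendsto_nhds]
  intro δ hδ
  have h1 := (Metric.tendsto_nhds.1 hu) (δ / 2) (by positivity)
  rw [window, eventually_inf_principal, eventually_comap] at h1
  have hc : ∃ B : ℝ, 0 < B ∧ ∀ p, |u p - c| ≤ B := ⟨1 + |c|, by positivity, fun p => by
    refine (abs_sub _ _).trans ?_
    rw [abs_of_nonneg (hu0 p)]
    linarith [hu1 p]⟩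
  obtain ⟨B, hB, hBu⟩ := hc
  have hlim : Tendsto (fun s : ℝ≥0 => B * (s : ℝ) ^ (-(1 / 2 : ℝ))) atTop (𝓝 0) := by
    have := ((tendsto_rpow_neg_atTop (show (0 : ℝ) < 1 / 2 by norm_num)).comp
      (NNReal.tendsto_coe_atTop.2 tendsto_id)).const_mul B
    simpa using this
  filter_upwards [h1, hlim.eventually_lt_const (half_pos hδ), eventually_gt_atTop 0]
    with s hs hBs hs0
  have hs0' : (0 : ℝ) < s := hs0
  have hsq : ((s : ℝ) ^ (3 / 4 : ℝ)) ^ 2 = s ^ (3 / 2 : ℝ) := by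
    rw [← Real.rpow_natCast, ← Real.rpow_mul s.coe_nonneg]; norm_num
  have hpow : (s : ℝ) = s ^ (-(1 / 2 : ℝ)) * s ^ (3 / 2 : ℝ) := by
    rw [← Real.rpow_add hs0']; norm_num
  have hpos : (0 : ℝ) < (s : ℝ) ^ (3 / 2 : ℝ) := Real.rpow_pos_of_pos hs0' _
  -- outside of the window, `1` is at most the squared deviation divided by the squared width
  have hterm : ∀ n : ℕ, |u (s, n) - c| ≤ δ / 2 + B / s ^ (3 / 2 : ℝ) * ((n : ℝ) - s) ^ 2 := by
    intro n
    by_cases hn : |(n : ℝ) - s| ≤ (s : ℝ) ^ (3 / 4 : ℝ)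
    · have h2 := hs (s, n) rfl hn
      rw [Real.dist_eq] at h2
      have : 0 ≤ B / s ^ (3 / 2 : ℝ) * ((n : ℝ) - s) ^ 2 := by positivity
      linarith
    · have h3 : (s : ℝ) ^ (3 / 2 : ℝ) ≤ ((n : ℝ) - s) ^ 2 := by
        rw [← hsq, ← sq_abs ((n : ℝ) - s)]
        exact pow_le_pow_left₀ (by positivity) (not_le.1 hn).le 2
      have h4 : B ≤ B / s ^ (3 / 2 : ℝ) * ((n : ℝ) - s) ^ 2 := by
        rw [div_mul_eq_mul_div, le_div_iff₀ hpos]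
        gcongr
      linarith [hBu (s, n)]
  have hsum1 : HasSum (fun n : ℕ => Real.exp (-s) * (s : ℝ) ^ n / n.factorial * c) c := by
    simpa using (hasSum_one_poissonMeasure s).mul_right c
  have hsumu : Summable fun n : ℕ => Real.exp (-s) * (s : ℝ) ^ n / n.factorial * u (s, n) :=
    (hasSum_one_poissonMeasure s).summable.of_nonneg_of_le
      (fun n => mul_nonneg (hp0 s n) (hu0 _)) fun n => mul_le_of_le_one_right (hp0 s n) (hu1 _)
  have hbound := ((hasSum_one_poissonMeasure s).mul_right (δ / 2)).add
    ((hasSum_poisson_mul_sq s).mul_left (B / s ^ (3 / 2 : ℝ)))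
  rw [Real.dist_eq]
  have hdiff := hsumu.hasSum.sub hsum1
  rw [← hdiff.tsum_eq, ← Real.norm_eq_abs]
  refine (tsum_of_norm_bounded hbound fun n => ?_).trans_lt ?_
  · rw [← mul_sub, Real.norm_eq_abs, abs_mul, abs_of_nonneg (hp0 s n)]
    refine (mul_le_mul_of_nonneg_left (hterm n) (hp0 s n)).trans_eq ?_
    ring
  · have e : B / s ^ (3 / 2 : ℝ) * s = B * (s : ℝ) ^ (-(1 / 2 : ℝ)) := by
      rw [div_mul_eq_mul_div, div_eq_iff hpos.ne', mul_assoc, ← hpow]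
    rw [e]
    linarith

lemma tendsto_floor_window : Tendsto (fun s : ℝ≥0 => ((⌊s⌋₊ : ℝ≥0), ⌊s⌋₊)) atTop window := by
  refine tendsto_inf.2 ⟨tendsto_comap_iff.2 ?_, tendsto_principal.2
    (Eventually.of_forall fun s => ?_)⟩
  · exact tendsto_natCast_atTop_atTop.comp tendsto_nat_floor_atTop
  · simp only [Set.mem_ofPred_eq, NNReal.coe_natCast, sub_self, abs_zero]
    positivity

end Concentration

/-! ### Convergence in distribution of counting variables -/

section Distribution

/-- Integer valued variables converge in distribution if their point probabilities converge. -/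
lemma tendstoInDistribution_of_tendsto_measureReal {Ω ι : Type*} [MeasurableSpace Ω]
    {P : Measure Ω} [IsProbabilityMeasure P] {l : Filter ι} [l.IsCountablyGenerated]
    {W : ι → Ω → ℕ} (hW : ∀ i, Measurable (W i)) {ν : Measure ℕ} [IsProbabilityMeasure ν]
    (h : ∀ k, Tendsto (fun i => P.real {ω | W i ω = k}) l (𝓝 (ν.real {k}))) :
    TendstoInDistribution W l (id : ℕ → ℕ) (fun _ => P) ν := by
  refine ⟨fun i => (hW i).aemeasurable, aemeasurable_id, ?_⟩
  have hpi : IsPiSystem {S : Set ℕ | S = ∅ ∨ ∃ k, S = {k}} := by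
    rintro S hS S' hS' hne
    rcases hS with rfl | ⟨k, rfl⟩
    · simp
    rcases hS' with rfl | ⟨k', rfl⟩
    · simp
    obtain ⟨a, ha, ha'⟩ := hne
    obtain rfl : a = k := ha
    obtain rfl : a = k' := ha'
    exact Or.inr ⟨a, by simp⟩
  refine hpi.tendsto_probabilityMeasure_of_tendsto_of_mem (fun S _ => .of_discrete) ?_ ?_
  · intro U _ x hx
    exact ⟨{x}, Or.inr ⟨x, rfl⟩, by simp, by simpa using hx⟩
  · rintro S (rfl | ⟨k, rfl⟩)
    · simpa using tendsto_const_nhds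
    · rw [← NNReal.tendsto_coe]
      have e1 : ∀ i, P.real {ω | W i ω = k} = (P.map (W i)).real {k} := fun i => by
        rw [map_measureReal_apply (hW i) (measurableSet_singleton k)]; rfl
      have hk := h k
      simp_rw [e1] at hk
      simp only [Measure.map_id]
      exact hk

end Distribution

/-! ### The limit along the window, and conclusion -/

section Window

lemma tendsto_window_fst : Tendsto (fun p : ℝ≥0 × ℕ => (p.1 : ℝ)) window atTop :=
  NNReal.tendsto_coe_atTop.2 (tendsto_comap.mono_left inf_le_left)

lemma eventually_window_le :
    ∀ᶠ p in window, |((p.2 - 1 : ℕ) : ℝ) - p.1| ≤ 2 * (p.1 : ℝ) ^ (3 / 4 : ℝ) := by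
  have h1 : ∀ᶠ p : ℝ≥0 × ℕ in window, |(p.2 : ℝ) - p.1| ≤ (p.1 : ℝ) ^ (3 / 4 : ℝ) :=
    (mem_inf_of_right (mem_principal_self _) : _ ∈ window)
  filter_upwards [h1, tendsto_window_fst.eventually_ge_atTop 1] with p hp hp1
  have h2 : (1 : ℝ) ≤ (p.1 : ℝ) ^ (3 / 4 : ℝ) := Real.one_le_rpow hp1 (by norm_num)
  have h3 : |((p.2 - 1 : ℕ) : ℝ) - p.2| ≤ 1 := by
    have e1 : (p.2 : ℝ) ≤ ((p.2 - 1 : ℕ) : ℝ) + 1 := by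
      exact_mod_cast (by omega : p.2 ≤ p.2 - 1 + 1)
    have e2 : ((p.2 - 1 : ℕ) : ℝ) ≤ p.2 := by exact_mod_cast Nat.sub_le _ _
    rw [abs_le]
    constructor <;> linarith
  have := abs_sub_le ((p.2 - 1 : ℕ) : ℝ) p.2 p.1
  linarith

lemma tendsto_window_div : Tendsto (fun p => ((p.2 - 1 : ℕ) : ℝ) / (p.1 : ℝ)) window (𝓝 1) := by
  rw [tendsto_iff_norm_sub_tendsto_zero]
  have hlim : Tendsto (fun p : ℝ≥0 × ℕ => 2 * (p.1 : ℝ) ^ (-(1 / 4 : ℝ))) window (𝓝 0) := by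
    have := ((tendsto_rpow_neg_atTop (show (0 : ℝ) < 1 / 4 by norm_num)).comp
      tendsto_window_fst).const_mul 2
    simpa using this
  refine squeeze_zero' (Eventually.of_forall fun p => norm_nonneg _) ?_ hlim
  filter_upwards [eventually_window_le, tendsto_window_fst.eventually_gt_atTop 0] with p hp hp0
  have e : ((p.2 - 1 : ℕ) : ℝ) / (p.1 : ℝ) - 1 = (((p.2 - 1 : ℕ) : ℝ) - p.1) / p.1 := by
    field_simp
  rw [e, Real.norm_eq_abs, abs_div, abs_of_pos hp0, div_le_iff₀ hp0]
  refine hp.trans_eq ?_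
  conv_rhs => rw [mul_assoc, ← Real.rpow_add_one hp0.ne']
  norm_num

lemma tendsto_window_pred : Tendsto (fun p : ℝ≥0 × ℕ => p.2 - 1) window atTop := by
  rw [← tendsto_natCast_atTop_iff (R := ℝ)]
  refine (tendsto_window_div.pos_mul_atTop one_pos tendsto_window_fst).congr' ?_
  filter_upwards [tendsto_window_fst.eventually_gt_atTop 0] with p hp
  field_simp

end Window

section Limit

lemma ConnectionFunction.IsHomogeneous.mul_iSup_le {𝕏 : Type*}
    [MeasurableSpace 𝕏] {μ : Measure 𝕏} {φ : ConnectionFunction 𝕏} {ε : ℝ}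
    (h : φ.IsHomogeneous μ ε) (x : 𝕏) : ε * ⨆ y, φ.meanDeg μ y ≤ φ.meanDeg μ x :=
  h.trans (ciInf_le (f := fun y => φ.meanDeg μ y)
    ⟨0, by rintro _ ⟨y, rfl⟩; exact φ.meanDeg_nonneg μ y⟩ x)

variable {𝕏 Ω : Type*} [MeasurableSpace 𝕏] [MeasurableSpace Ω] {μ : Measure 𝕏}
  [IsProbabilityMeasure μ] {P : Measure Ω} [IsProbabilityMeasure P] {X : ℕ → Ω → 𝕏}
  {T : ℕ → Ω → ℕ → I} {Z : ℝ≥0 → Ω → ℕ} {ε : ℝ}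

lemma ConnectionFunction.meanDeg_le_iSup (φ : ConnectionFunction 𝕏) (x : 𝕏) :
    φ.meanDeg μ x ≤ ⨆ y, φ.meanDeg μ y :=
  le_ciSup (f := fun y => φ.meanDeg μ y) ⟨1, by rintro _ ⟨y, rfl⟩; exact φ.meanDeg_le_one μ y⟩ x

lemma ConnectionFunction.toFun_le_sup (φ : ConnectionFunction 𝕏) (x y : 𝕏) :
    φ.toFun x y ≤ φ.sup :=
  le_ciSup (f := fun p : 𝕏 × 𝕏 => φ.toFun p.1 p.2)
    ⟨1, by rintro _ ⟨p, rfl⟩; exact φ.le_one p.1 p.2⟩ (x, y)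

/-- Markov's inequality for the number of vertices of degree less than `j`. -/
lemma measureReal_one_le_numDegLT_le (h : IsMarkedSample μ P X T Z) (φ : ConnectionFunction 𝕏)
    (n j : ℕ) : P.real {ω | 1 ≤ numDegLT (irg φ (n + 1) (X · ω) (T · ω)) j} ≤
      ∑ i ∈ Finset.range j, (n + 1) * degProb φ μ n i := by
  have hn : ∀ i, 0 ≤ (n + 1) * degProb φ μ n i := fun i =>
    mul_nonneg (by positivity) (degProb_nonneg φ μ n i)
  have hm : ∀ i, Measurable fun ω => (numDeg (irg φ (n + 1) (X · ω) (T · ω)) i : ENNReal) :=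
    fun i => (measurable_from_top (f := fun k : ℕ => (k : ENNReal))).comp
      (measurable_numDeg_irg φ (n + 1) i h.measurable_points h.measurable_marks)
  have h1 := mul_meas_ge_le_lintegral (μ := P) (f := fun ω => ∑ i ∈ Finset.range j,
    (numDeg (irg φ (n + 1) (X · ω) (T · ω)) i : ENNReal))
    (Finset.measurable_fun_sum _ fun i _ => hm i) 1
  rw [lintegral_finsetSum _ fun i _ => hm i, one_mul] at h1
  simp_rw [lintegral_numDeg_irg h] at h1
  rw [← ENNReal.ofReal_sum_of_nonneg fun i _ => hn i] at h1
  rw [measureReal_def]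
  refine ENNReal.toReal_le_of_le_ofReal (Finset.sum_nonneg fun i _ => hn i) (le_trans ?_ h1)
  refine measure_mono fun ω (hω : 1 ≤ numDegLT _ j) => ?_
  rw [numDegLT] at hω
  exact_mod_cast hω

/-- The two limits hold uniformly over all numbers of points in the window. -/
lemma tendsto_window (h : IsMarkedSample μ P X T Z) {j : ℕ} (hε : 0 < ε)
    {φ : ℝ≥0 → ConnectionFunction 𝕏} (hhom : ∀ s, 0 < s → (φ s).IsHomogeneous μ ε)
    (hsup : ∀ s, 0 < s → (φ s).sup ≤ 1 - ε) {α : ℝ} (hα : 0 < α)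
    (hmean : Tendsto (fun s : ℝ≥0 => ∑ i ∈ Finset.range (j + 1), poissonMean (φ s) μ s i) atTop
      (𝓝 α)) :
    (∀ k, Tendsto (fun p : ℝ≥0 × ℕ => P.real {ω |
      numDeg (irg (φ p.1) p.2 (X · ω) (T · ω)) j = k}) window
        (𝓝 (Real.exp (-α) * α ^ k / k.factorial))) ∧
    Tendsto (fun p : ℝ≥0 × ℕ => P.real {ω |
      1 ≤ numDegLT (irg (φ p.1) p.2 (X · ω) (T · ω)) j}) window (𝓝 0) := by
  -- the number of points is `n + 1` with `n = p.2 - 1`; the truncation at `p.2 = 0` is not seen by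
  -- the window
  set m : ℝ≥0 × ℕ → ℝ := fun p => ⨆ x, (φ p.1).meanDeg μ x with hmdef
  obtain ⟨x₀⟩ : Nonempty 𝕏 := nonempty_of_isProbabilityMeasure μ
  have hs := tendsto_window_fst
  have hns := tendsto_window_div
  have hn := tendsto_window_pred
  have hle : ∀ᶠ p in window, ∀ x, (φ p.1).meanDeg μ x ≤ m p :=
    Eventually.of_forall fun p x => (φ p.1).meanDeg_le_iSup x
  have hge : ∀ᶠ p in window, ∀ x, ε * m p ≤ (φ p.1).meanDeg μ x := by
    filter_upwards [hs.eventually_gt_atTop 0] with p hp x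
    exact (hhom p.1 (by exact_mod_cast hp)).mul_iSup_le x
  have hm0 : ∀ p, 0 ≤ m p := fun p =>
    ((φ p.1).meanDeg_nonneg μ x₀).trans ((φ p.1).meanDeg_le_iSup x₀)
  have hpm : ∀ (p : ℝ≥0 × ℕ) i, 0 ≤ poissonMean (φ p.1) μ p.1 i := fun p i =>
    poissonMean_nonneg _ μ p.1.coe_nonneg i
  have hsum : Tendsto (fun p : ℝ≥0 × ℕ => ∑ i ∈ Finset.range (j + 1),
      poissonMean (φ p.1) μ p.1 i) window (𝓝 α) :=
    hmean.comp (NNReal.tendsto_coe_atTop.1 hs)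
  have hlow : ∀ᶠ p in window, α / 2 ≤ ∑ i ∈ Finset.range (j + 1), poissonMean (φ p.1) μ p.1 i :=
    hsum.eventually_const_le (half_lt_self hα)
  have hC : ∀ i ∈ Finset.range (j + 1), ∀ᶠ p in window, poissonMean (φ p.1) μ p.1 i ≤ α + 1 := by
    intro i hi
    filter_upwards [hsum.eventually_le_const (lt_add_one α)] with p hp
    exact (Finset.single_le_sum (f := fun i => poissonMean (φ p.1) μ p.1 i)
      (fun i _ => hpm p i) hi).trans hp
  have hC0 := hC 0 (by simp)
  have hCj := hC j (by simp)
  have hsm : Tendsto (fun p : ℝ≥0 × ℕ => (p.1 : ℝ) * m p) window atTop :=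
    tendsto_maxDegree_atTop hs hle hC0
  have hr : Tendsto (fun p : ℝ≥0 × ℕ => (p.1 : ℝ) ^ (3 / 4 : ℝ) * m p) window (𝓝 0) :=
    tendsto_rpow_mul_zero hε (half_pos hα) hs (Eventually.of_forall hm0) hge hlow
  have hm : Tendsto m window (𝓝 0) := by
    refine squeeze_zero' (Eventually.of_forall hm0) ?_ hr
    filter_upwards [hs.eventually_ge_atTop 1] with p hp
    exact le_mul_of_one_le_left (hm0 p) (Real.one_le_rpow hp (by norm_num))
  have hd : Tendsto (fun p : ℝ≥0 × ℕ => |((p.2 - 1 : ℕ) : ℝ) - p.1| * m p) window (𝓝 0) := by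
    refine squeeze_zero' (Eventually.of_forall fun p => mul_nonneg (abs_nonneg _) (hm0 p)) ?_
      (by simpa using hr.const_mul 2)
    filter_upwards [eventually_window_le] with p hp
    rw [← mul_assoc]
    exact mul_le_mul_of_nonneg_right hp (hm0 p)
  have hm2 : Tendsto (fun p : ℝ≥0 × ℕ => ((p.2 - 1 : ℕ) : ℝ) * m p ^ 2) window (𝓝 0) := by
    refine squeeze_zero' (Eventually.of_forall fun p => by positivity) ?_
      (by simpa using (hr.pow 2).const_mul 2)
    filter_upwards [hns.eventually_le_const one_lt_two, hs.eventually_ge_atTop 1] with p h1 h2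
    rw [div_le_iff₀ (by linarith)] at h1
    have h3 : (p.1 : ℝ) ≤ ((p.1 : ℝ) ^ (3 / 4 : ℝ)) ^ 2 := by
      rw [← Real.rpow_natCast, ← Real.rpow_mul p.1.coe_nonneg]
      exact Real.self_le_rpow_of_one_le h2 (by norm_num)
    rw [mul_pow, ← mul_assoc]
    exact mul_le_mul_of_nonneg_right (h1.trans (by linarith)) (sq_nonneg _)
  have hnm : Tendsto (fun p : ℝ≥0 × ℕ => ((p.2 - 1 : ℕ) : ℝ) * m p) window atTop := by
    refine (hns.pos_mul_atTop one_pos hsm).congr' ?_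
    filter_upwards [hs.eventually_gt_atTop 0] with p hp
    field_simp
  have hreg : ∀ᶠ p in window, Regular (φ p.1) μ ε (m p) := by
    filter_upwards [hle, hge, hm.eventually_le_const (show (0 : ℝ) < 1 / 2 by norm_num),
      hs.eventually_gt_atTop 0] with p h1 h2 h3 h4
    exact ⟨hε, h3, h1, h2, fun x y =>
      ((φ p.1).toFun_le_sup x y).trans (hsup p.1 (by exact_mod_cast h4))⟩
  have hzero : ∀ i < j, Tendsto (fun p : ℝ≥0 × ℕ => poissonMean (φ p.1) μ p.1 i) window (𝓝 0) :=
    fun i hij => tendsto_poissonMean_zero_of_lt hε hij hs hsm hge hCj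
  have hj : Tendsto (fun p : ℝ≥0 × ℕ => poissonMean (φ p.1) μ p.1 j) window (𝓝 α) := by
    have h1 := tendsto_finsetSum (Finset.range j) fun i hi => hzero i (Finset.mem_range.1 hi)
    have h2 := hsum.sub h1
    simp only [Finset.sum_const_zero, sub_zero] at h2
    refine h2.congr fun p => ?_
    rw [Finset.sum_range_succ]
    ring
  have hsucc : ∀ᶠ p : ℝ≥0 × ℕ in window, p.2 - 1 + 1 = p.2 := by
    filter_upwards [hn.eventually_ge_atTop 1] with p hp
    omega
  have hdeg : ∀ {i a}, Tendsto (fun p : ℝ≥0 × ℕ => poissonMean (φ p.1) μ p.1 i) window (𝓝 a) →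
      Tendsto (fun p : ℝ≥0 × ℕ => (((p.2 - 1 : ℕ) : ℝ) + 1) * degProb (φ p.1) μ (p.2 - 1) i)
        window (𝓝 a) := fun ha => tendsto_succ_mul_degProb hs hn hns hm hd hm2 hle ha
  refine ⟨fun k => ?_, ?_⟩
  · have hlim := tendsto_measureReal_numDeg h hε hreg hn hnm (hdeg hj)
      (eventually_succ_mul_integral_exp_le hs hns hd hle hC0) k
    refine hlim.congr' ?_
    filter_upwards [hsucc] with p hp
    rw [hp]
  · have h1 := tendsto_finsetSum (Finset.range j) fun i hi => hdeg (hzero i (Finset.mem_range.1 hi))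
    rw [Finset.sum_const_zero] at h1
    refine squeeze_zero' (Eventually.of_forall fun p => measureReal_nonneg) ?_ h1
    filter_upwards [hsucc] with p hp
    have h2 := measureReal_one_le_numDegLT_le h (φ p.1) (p.2 - 1) j
    rwa [hp] at h2

/-- An integer valued variable tends to zero in probability if it vanishes with probability tending
to one. -/
lemma tendstoInMeasure_zero_of_tendsto_measureReal {ι : Type*} {l : Filter ι} {W : ι → Ω → ℕ}
    (hW : Tendsto (fun i => P.real {ω | 1 ≤ W i ω}) l (𝓝 0)) :
    TendstoInMeasure P (fun i ω => (W i ω : ℝ)) l fun _ => 0 := by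
  intro δ hδ
  have hW' : Tendsto (fun i => P {ω | 1 ≤ W i ω}) l (𝓝 0) :=
    (ENNReal.tendsto_toReal_iff (fun i => measure_ne_top _ _) ENNReal.zero_ne_top).1 hW
  refine tendsto_of_tendsto_of_tendsto_of_le_of_le tendsto_const_nhds hW' (fun i => zero_le)
    fun i => measure_mono fun ω hω => ?_
  by_contra hcon
  have h0 : W i ω = 0 := by
    have : ¬ 1 ≤ W i ω := hcon
    omega
  have hω' : δ ≤ edist (W i ω : ℝ) 0 := hω
  rw [h0, Nat.cast_zero, edist_self] at hω'
  exact absurd hω' (not_le.2 hδ)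

end Limit

theorem theorem2p1 {𝕏 Ω : Type*} [MeasurableSpace 𝕏] [MeasurableSpace Ω]
    (μ : Measure 𝕏) [IsProbabilityMeasure μ] (P : Measure Ω) [IsProbabilityMeasure P]
    (X : ℕ → Ω → 𝕏) (T : ℕ → Ω → ℕ → I) (Z : ℝ≥0 → Ω → ℕ)
    (hXTZ : IsMarkedSample μ P X T Z)
    (j : ℕ) (ε : ℝ) (hε : 0 < ε) (φ : ℝ≥0 → ConnectionFunction 𝕏)
    (hhom : ∀ s, 0 < s → (φ s).IsHomogeneous μ ε)
    (hsup : ∀ s, 0 < s → (φ s).sup ≤ 1 - ε)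
    (α : ℝ≥0) (hα : 0 < α)
    (hmean : Tendsto
      (fun s : ℝ≥0 => ∫ ω, (numDegLE (irg (φ s) (Z s ω) (X · ω) (T · ω)) j : ℝ) ∂P)
      atTop (𝓝 (α : ℝ))) :
    TendstoInDistribution
      (fun (s : ℝ≥0) ω => numDeg (irg (φ s) (Z s ω) (X · ω) (T · ω)) j)
      atTop (id : ℕ → ℕ) (fun _ => P) (poissonMeasure α) ∧
    TendstoInDistribution
      (fun (s : ℝ≥0) ω => numDeg (irg (φ (⌊s⌋₊ : ℝ≥0)) ⌊s⌋₊ (X · ω) (T · ω)) j)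
      atTop (id : ℕ → ℕ) (fun _ => P) (poissonMeasure α) ∧
    TendstoInMeasure P
      (fun (s : ℝ≥0) ω => (numDegLT (irg (φ s) (Z s ω) (X · ω) (T · ω)) j : ℝ))
      atTop (fun _ => 0) ∧
    TendstoInMeasure P
      (fun (s : ℝ≥0) ω => (numDegLT (irg (φ (⌊s⌋₊ : ℝ≥0)) ⌊s⌋₊ (X · ω) (T · ω)) j : ℝ))
      atTop (fun _ => 0) := by
  simp_rw [integral_numDegLE_count hXTZ] at hmean
  obtain ⟨h1, h2⟩ := tendsto_window hXTZ hε hhom hsup (NNReal.coe_pos.2 hα) hmean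
  have hmeas : ∀ (s : ℝ≥0) (n i : ℕ), Measurable fun y : ℕ → 𝕏 × (ℕ → I) =>
      numDeg (irg (φ s) n (fun k => (y k).1) (fun k => (y k).2)) i := fun s n i =>
    measurable_numDeg_irg (φ s) n i (by fun_prop) (by fun_prop)
  have hdist : ∀ s : ℝ≥0, Measurable fun ω =>
      numDeg (irg (φ (⌊s⌋₊ : ℝ≥0)) ⌊s⌋₊ (X · ω) (T · ω)) j := fun s =>
    measurable_numDeg_irg (φ (⌊s⌋₊ : ℝ≥0)) ⌊s⌋₊ j hXTZ.measurable_points hXTZ.measurable_marks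
  refine ⟨tendstoInDistribution_of_tendsto_measureReal
    (fun s => measurable_numDeg_count hXTZ (φ s) s j) fun k => ?_,
    tendstoInDistribution_of_tendsto_measureReal hdist fun k => ?_,
    tendstoInMeasure_zero_of_tendsto_measureReal ?_,
    tendstoInMeasure_zero_of_tendsto_measureReal ?_⟩
  · rw [poissonMeasure_real_singleton]
    refine (tendsto_tsum_poisson (fun p => measureReal_nonneg) (fun p => measureReal_le_one)
      (h1 k)).congr fun s => ?_
    exact (measureReal_count hXTZ s (A := fun n => {y | numDeg (irg (φ s) n (fun k => (y k).1)
      (fun k => (y k).2)) j = k}) fun n => hmeas s n j (measurableSet_singleton k)).symm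
  · rw [poissonMeasure_real_singleton]
    simpa only [Function.comp_def] using (h1 k).comp tendsto_floor_window
  · have hA : ∀ (s : ℝ≥0) (n : ℕ), MeasurableSet {y : ℕ → 𝕏 × (ℕ → I) |
        1 ≤ numDegLT (irg (φ s) n (fun k => (y k).1) (fun k => (y k).2)) j} := fun s n =>
      (Finset.measurable_fun_sum (Finset.range j) fun i _ => hmeas s n i) measurableSet_Ici
    refine (tendsto_tsum_poisson (fun p => measureReal_nonneg) (fun p => measureReal_le_one)
      h2).congr fun s => ?_
    exact (measureReal_count hXTZ s (hA s)).symm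
  · simpa only [Function.comp_def] using h2.comp tendsto_floor_window
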